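/- There is a randomized algorithm that does the following. Its input is an integer $k \ge 1$ and an $n \times n$ doubly stochastic real matrix $M$ ($n\ge 1$) with $m$ nonzero entries, given in adjacency-array form: for each row an array of the columns and values of its nonzero entries, in arbitrary order. Its output is always the first $k$ weighted matchings $(\lambda_1,\sigma_1),\dots,(\lambda_k,\sigma_k)$ of a Birkhoff–von Neumann decomposition $M=\sum_{t=1}^{r}\lambda_t P_{\sigma_t}$, or the complete decomposition if $r<k$. Here $\sigma_1,\dots,\sigma_r$ are distinct permutations of $\{1,\dots,n\}$ (perfect matchings of rows with columns), $P_\sigma$ is the permutation matrix of $\sigma$, and the decomposition is obtained by successive subtraction: each $\sigma_t$ is a perfect matching in the support of $M_t = M-\sum_{s<t}\lambda_sP_{\sigma_s}$, and $\lambda_t=\min_i (M_t)_{i,\sigma_t(i)}>0$. The expected running time of the algorithm is $O(m+k\,n\log^2 n)$, with an absolute implied constant. Running time is the number of steps on a randomized random-access machine that operates in unit time on words of $O(\log(n+m+k))$ bits (arithmetic, comparison, indirect addressing) and on real weights (copying, addition, subtraction, comparison, and drawing a random number uniform between $0$ and a given weight and comparing it with another weight). -/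

import Mathlib

/-!
A randomized random-access machine, with programs written in a small structured language.
The machine handles two kinds of data, each in registers and in finitely many arrays with
indirect addressing.

* Words: natural numbers up to a bound fixed at the start of the run, that is, with a bounded
  number of bits. They serve as indices and counters.
* Weights: real numbers. They can only be copied, added, subtracted and compared, and used as the
  weights of a biased coin.

Every instruction and every test takes one step.
-/

namespace RandomRAM

/-- The arithmetic operations on words. Subtraction is truncated at `0`, division is rounded down
and division by `0` gives `0`. -/
inductive WordOp where
  | add
  | sub
  | mul
  | div

/-- The value of an operation on words. -/
def WordOp.eval : WordOp → ℕ → ℕ → ℕ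
  | .add, u, v => u + v
  | .sub, u, v => u - v
  | .mul, u, v => u * v
  | .div, u, v => u / v

/-- The instructions. Letters `d`, `i`, `j` are names of registers, `A` is the name of an array. -/
inductive Instr where
  /-- word register `d` := the literal `v` -/
  | wconst (d v : ℕ)
  /-- word register `d` := word register `i` `op` word register `j` -/
  | wop (op : WordOp) (d i j : ℕ)
  /-- word register `d` := `A[word register i]`, for a word array `A` -/
  | wload (d A i : ℕ)
  /-- `A[word register i]` := word register `j`, for a word array `A` -/
  | wstore (A i j : ℕ)
  /-- weight register `d` := `0` -/
  | rzero (d : ℕ)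
  /-- weight register `d` := `1` -/
  | rone (d : ℕ)
  /-- weight register `d` := weight register `i` + weight register `j` -/
  | radd (d i j : ℕ)
  /-- weight register `d` := weight register `i` - weight register `j` -/
  | rsub (d i j : ℕ)
  /-- weight register `d` := `A[word register i]`, for a weight array `A` -/
  | rload (d A i : ℕ)
  /-- `A[word register i]` := weight register `j`, for a weight array `A` -/
  | rstore (A i j : ℕ)
  /-- append word register `i` to the output words -/
  | wemit (i : ℕ)
  /-- append weight register `i` to the output weights -/
  | remit (i : ℕ)

/-- The tests, on which programs branch. -/
inductive Test where
  /-- word register `i` < word register `j` -/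
  | wlt (i j : ℕ)
  /-- word register `i` = word register `j` -/
  | weq (i j : ℕ)
  /-- weight register `i` < weight register `j` -/
  | rlt (i j : ℕ)
  /-- a fresh random number, uniform between `0` and weight register `j`, is smaller than
  weight register `i` -/
  | coin (i j : ℕ)

/-- Programs. -/
inductive Prog where
  | skip
  | instr (I : Instr)
  | seq (p q : Prog)
  | ite (b : Test) (p q : Prog)
  | loop (b : Test) (p : Prog)

/-- The content of the memory and what has been output so far. -/
@[ext]
structure State where
  /-- word registers -/
  wreg : ℕ → ℕ
  /-- weight registers -/
  rreg : ℕ → ℝ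
  /-- word arrays -/
  warr : ℕ → ℕ → ℕ
  /-- weight arrays -/
  rarr : ℕ → ℕ → ℝ
  /-- the output words, in the order in which they were output -/
  wout : List ℕ
  /-- the output weights, in the order in which they were output -/
  rout : List ℝ

noncomputable section

/-- Write `v` to the word register `d`; the machine fails if `v` exceeds the largest word `W`. -/
def State.setWord (W : ℕ) (s : State) (d v : ℕ) : Option State :=
  if v ≤ W then some { s with wreg := Function.update s.wreg d v } else none

/-- Write `v` to the weight register `d`. -/
def State.setWeight (s : State) (d : ℕ) (v : ℝ) : State :=
  { s with rreg := Function.update s.rreg d v }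

/-- The effect of an instruction on a machine with largest word `W`; `none` is failure. -/
def Instr.exec (W : ℕ) : Instr → State → Option State
  | .wconst d v, s => s.setWord W d v
  | .wop op d i j, s => s.setWord W d (op.eval (s.wreg i) (s.wreg j))
  | .wload d A i, s => s.setWord W d (s.warr A (s.wreg i))
  | .wstore A i j, s => some { s with
      warr := Function.update s.warr A (Function.update (s.warr A) (s.wreg i) (s.wreg j)) }
  | .rzero d, s => some (s.setWeight d 0)
  | .rone d, s => some (s.setWeight d 1)
  | .radd d i j, s => some (s.setWeight d (s.rreg i + s.rreg j))
  | .rsub d i j, s => some (s.setWeight d (s.rreg i - s.rreg j))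
  | .rload d A i, s => some (s.setWeight d (s.rarr A (s.wreg i)))
  | .rstore A i j, s => some { s with
      rarr := Function.update s.rarr A (Function.update (s.rarr A) (s.wreg i) (s.rreg j)) }
  | .wemit i, s => some { s with wout := s.wout ++ [s.wreg i] }
  | .remit i, s => some { s with rout := s.rout ++ [s.rreg i] }

/-- The probability that a random number, uniform between `0` and `w`, is smaller than `x`. It is
`0` by convention if `w ≤ 0`. -/
def coinProb (x w : ℝ) : NNReal :=
  if 0 < w then min 1 (Real.toNNReal (x / w)) else 0

theorem coinProb_le_one (x w : ℝ) : coinProb x w ≤ 1 := by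
  unfold coinProb
  split_ifs
  · exact min_le_left _ _
  · exact zero_le_one

/-- The distribution of a biased coin that shows `true` with probability `coinProb x w`. -/
def coinPMF (x w : ℝ) : PMF Bool :=
  PMF.ofFintype (fun b => if b then (coinProb x w : ENNReal) else 1 - (coinProb x w : ENNReal)) (by
    have h : (coinProb x w : ENNReal) ≤ 1 := by exact_mod_cast coinProb_le_one x w
    simp [h])

/-- The distribution of the outcome of a test. -/
def Test.eval : Test → State → PMF Bool
  | .wlt i j, s => PMF.pure (decide (s.wreg i < s.wreg j))
  | .weq i j, s => PMF.pure (decide (s.wreg i = s.wreg j))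
  | .rlt i j, s => PMF.pure (decide (s.rreg i < s.rreg j))
  | .coin i j, s => coinPMF (s.rreg i) (s.rreg j)

/-- A configuration: the programs that remain to be run, first one first, and the memory. -/
abbrev Config := List Prog × State

/-- A configuration has halted if nothing remains to be run. -/
def Config.Halted (c : Config) : Prop := c.1 = []

/-- One step of the machine with largest word `W`. A halted configuration stays as it is, and so
does one that fails, which therefore never halts. -/
def step (W : ℕ) : Config → PMF Config
  | ([], s) => PMF.pure ([], s)
  | (.skip :: K, s) => PMF.pure (K, s)
  | (.instr I :: K, s) =>
      match I.exec W s with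
      | some s' => PMF.pure (K, s')
      | none => PMF.pure (.instr I :: K, s)
  | (.seq p q :: K, s) => PMF.pure (p :: q :: K, s)
  | (.ite b p q :: K, s) =>
      (b.eval s).bind fun r => PMF.pure (if r then (p :: K, s) else (q :: K, s))
  | (.loop b p :: K, s) =>
      (b.eval s).bind fun r => PMF.pure (if r then (p :: .loop b p :: K, s) else (K, s))

/-- The distribution of the configuration after `t` steps from `c`. -/
def run (W : ℕ) (c : Config) : ℕ → PMF Config
  | 0 => PMF.pure c
  | t + 1 => (run W c t).bind (step W)

/-- The expected number of steps until `p`, started in memory `s`, halts: the sum over `t` of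
the probability that more than `t` steps are made. -/
def expectedTime (W : ℕ) (p : Prog) (s : State) : ENNReal :=
  ∑' t : ℕ, (run W ([p], s) t).toOuterMeasure {c | ¬ c.Halted}

/-- Whenever `p`, started in memory `s`, halts, its final memory satisfies `Q`. -/
def AlwaysReturns (W : ℕ) (p : Prog) (s : State) (Q : State → Prop) : Prop :=
  ∀ t : ℕ, ∀ c ∈ (run W ([p], s) t).support, c.Halted → Q c.2

end

end RandomRAM

namespace BirkhoffVonNeumann

/-- The number of nonzero entries of a matrix. -/
noncomputable def nnz {n : ℕ} (M : Matrix (Fin n) (Fin n) ℝ) : ℕ :=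
  {p : Fin n × Fin n | M p.1 p.2 ≠ 0}.ncard

/-- `adj` is an adjacency array of `M`: for each row `i`, the list `adj i` holds the columns of the
nonzero entries of that row, in any order and without repetition. -/
def IsAdjacencyArray {n : ℕ} (M : Matrix (Fin n) (Fin n) ℝ) (adj : Fin n → List (Fin n)) : Prop :=
  ∀ i, (adj i).Nodup ∧ ∀ j, j ∈ adj i ↔ M i j ≠ 0

/-- The memory that holds the input. Word registers `0`, `1`, `2` hold `n`, the number of nonzero
entries, and `k`. The rows of the adjacency array are stored one after the other: word array `1`
holds the columns and weight array `0` the values of the nonzero entries, and word array `0`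
holds, for each `i ≤ n`, the number of entries stored before row `i`, which is the position at
which row `i` starts (and the total number of entries for `i = n`). Everything else is `0`. -/
noncomputable def inputState {n : ℕ} (M : Matrix (Fin n) (Fin n) ℝ)
    (adj : Fin n → List (Fin n)) (k : ℕ) : RandomRAM.State where
  wreg := fun r => [n, nnz M, k].getD r 0
  rreg := fun _ => 0
  warr := fun A e =>
    if A = 0 then
      ((List.range (n + 1)).map fun i => ((List.ofFn adj).take i).flatten.length).getD e 0
    else if A = 1 then
      ((List.ofFn adj).flatten.map Fin.val).getD e 0
    else 0
  rarr := fun A e =>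
    if A = 0 then (List.ofFn fun i => (adj i).map (M i)).flatten.getD e 0 else 0
  wout := []
  rout := []

/-- The sum of the weighted permutation matrices in a list. The entry of `σ.permMatrix ℝ` at
`(i, j)` is `1` if `σ i = j`, and `0` otherwise. -/
noncomputable def weightedSum {n : ℕ} (l : List (ℝ × Equiv.Perm (Fin n))) :
    Matrix (Fin n) (Fin n) ℝ :=
  (l.map fun p => p.1 • p.2.permMatrix ℝ).sum

/-- `l` is a Birkhoff-von Neumann decomposition of `M`, obtained by subtracting one weighted
matching after the other. A permutation `σ` stands for the perfect matching of each row `i` with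
the column `σ i`. -/
structure IsDecomposition {n : ℕ} (M : Matrix (Fin n) (Fin n) ℝ)
    (l : List (ℝ × Equiv.Perm (Fin n))) : Prop where
  /-- The weighted matchings add up to `M`. -/
  sum_eq : weightedSum l = M
  /-- The matchings are distinct. -/
  nodup : (l.map Prod.snd).Nodup
  /-- The weights are positive. -/
  pos : ∀ p ∈ l, 0 < p.1
  /-- Each weight is the least entry, along its matching, of what is left of `M` after the earlier
  subtractions. So the matching lies in the support of what is left, and subtracting it turns
  at least one more entry into `0`. -/
  least : ∀ (t : ℕ) (h : t < l.length),
    IsLeast (Set.range fun i => (M - weightedSum (l.take t)) i (l[t].2 i)) l[t].1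

/-- The output in `s` is the list `l` of weighted matchings: the output weights are the weights,
and the output words are, for each matching `σ` in turn, the columns `σ 0, …, σ (n - 1)`. -/
def Outputs {n : ℕ} (s : RandomRAM.State) (l : List (ℝ × Equiv.Perm (Fin n))) : Prop :=
  s.rout = l.map Prod.fst ∧
  s.wout = l.flatMap fun p => List.ofFn fun i => (p.2 i : ℕ)

end BirkhoffVonNeumann

/-!
The program repeatedly finds a perfect matching in the support of the rest of the matrix by
alternating random walks: from a row, move to a column with probability proportional to the weight
of the entry, and from a matched column to its row, until a free column is reached. Since all row
and column sums are equal, the walk from a random free row takes `O(n / f)` steps on average if `f`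
rows are free, which is `O(n log n)` steps for one matching. The rows are kept as binary trees of
partial sums, so that one step, and one change of an entry, takes time `O(log n)`.
-/

/-! After some subtractions, what is left of the matrix is nonnegative and all its row and column
sums have the same value `S`. As long as `S > 0`, dividing by `S` makes it a table of transition
probabilities with row and column sums 1, and a perfect matching in its support is grown one row at
a time.

The heart is `sum_hit_le`. Given a partial matching, let h(u) be the expected number of steps from
row u until the alternating walk meets a free column. Then h(u) is 1 plus the sum of p(u,v) h(mate
of v) over the matched columns v. Summing over all n rows, and using that the columns of p sum to at
most 1 and that matched columns correspond to matched rows, the sum of h over all rows is at most n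
plus the sum of h over the matched rows. Cancelling the latter leaves at most n for the sum over the
free rows. From a uniformly random free row among f the walk thus takes at most n/f steps on
average, and f = n, n-1, ..., 1 gives n times a harmonic number for one perfect matching.

The last exits of the walk form, after erasing cycles, an augmenting path. It is no longer than the
walk, so the walk pays for the augmentation (`Walking.step`, `walk_ert_le`, `augment_spec`,
`phase_spec`). A step of the walk samples a column from the tree of a row by descending with biased
coins, and changing an entry repairs the sums on one path to the root; both take O(log n)
(`sample_ert_le`, `setLeaf_spec`). The random free row is sampled in the same way from an additional
row `n`, which holds weight 1 for free rows and 0 for the others. This gives O(n log² n) per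
matching, to which finding the minimum and subtracting add O(n log n). Building the trees takes
O(m).

On the side of the decomposition, each earlier matching passes through an entry that has become 0,
while a new matching has only positive entries; so the matchings are distinct (`IsPartial.concat`).
If the program stops at `k` matchings, Birkhoff's theorem supplies the unseen rest
(`IsPartial.exists_append`).

Programs are analysed by the transformer `ert`, which pushes a cost function back through a program.
A bound for `ert` bounds the expected time, and a finite bound for a cost function that is `⊤` off a
postcondition also proves that postcondition. `Spec` packages both for parts where a bound uniform
over the final memory suffices; `ert` itself is used where the remaining cost depends on the random
outcome. -/

open scoped ENNReal

/-! ### Expectations under discrete distributions -/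

namespace PMF

/-- The expectation of a function under a discrete distribution. -/
noncomputable def expect {α : Type*} (μ : PMF α) (f : α → ℝ≥0∞) : ℝ≥0∞ := ∑' a, μ a * f a

theorem expect_pure {α : Type*} (a : α) (f : α → ℝ≥0∞) : (PMF.pure a).expect f = f a := by
  classical
  rw [expect, tsum_eq_single a]
  · simp [PMF.pure_apply]
  · intro b hb
    simp [PMF.pure_apply, hb]

theorem expect_bind {α β : Type*} (μ : PMF α) (κ : α → PMF β) (f : β → ℝ≥0∞) :
    (μ.bind κ).expect f = μ.expect fun a => (κ a).expect f := by
  simp only [expect, PMF.bind_apply, ← ENNReal.tsum_mul_right, ← ENNReal.tsum_mul_left]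
  rw [ENNReal.tsum_comm]
  simp only [mul_assoc]

theorem expect_mono {α : Type*} (μ : PMF α) {f g : α → ℝ≥0∞} (h : ∀ a, f a ≤ g a) :
    μ.expect f ≤ μ.expect g :=
  ENNReal.tsum_le_tsum fun a => mul_le_mul_right (h a) _

theorem expect_add {α : Type*} (μ : PMF α) (f g : α → ℝ≥0∞) :
    μ.expect (fun a => f a + g a) = μ.expect f + μ.expect g := by
  simp only [expect, mul_add, ENNReal.tsum_add]

theorem expect_bool (μ : PMF Bool) (f : Bool → ℝ≥0∞) :
    μ.expect f = μ true * f true + μ false * f false := by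
  simp [expect, tsum_fintype]

theorem toOuterMeasure_eq_expect {α : Type*} (μ : PMF α) (S : Set α) :
    μ.toOuterMeasure S = μ.expect (S.indicator 1) := by
  classical
  rw [toOuterMeasure_apply, expect]
  refine tsum_congr fun a => ?_
  by_cases h : a ∈ S <;> simp [h]

end PMF

/-! ### A calculus for expected running times -/

namespace RandomRAM

open Function

/-- The expected time of a program started in a given memory plus the expectation of `g` at the
final memory, with the value `∞` if the machine may fail. -/
noncomputable def ert (W : ℕ) : Prog → (State → ℝ≥0∞) → State → ℝ≥0∞
  | .skip, g => fun s => 1 + g s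
  | .instr I, g => fun s =>
      match I.exec W s with
      | some s' => 1 + g s'
      | none => ⊤
  | .seq p q, g => fun s => 1 + ert W p (ert W q g) s
  | .ite b p q, g => fun s =>
      1 + (b.eval s true * ert W p g s + b.eval s false * ert W q g s)
  | .loop b p, g => sInf {I : State → ℝ≥0∞ |
      ∀ s, 1 + (b.eval s true * ert W p I s + b.eval s false * g s) ≤ I s}

theorem ert_seq (W : ℕ) (p q : Prog) (g : State → ℝ≥0∞) (s : State) :
    ert W (.seq p q) g s = 1 + ert W p (ert W q g) s := rfl

theorem ert_mono (W : ℕ) (p : Prog) : Monotone (ert W p) := by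
  induction p with
  | skip => intro f g h s; simpa [ert] using add_le_add_right (h s) 1
  | instr I =>
    intro f g h s
    simp only [ert]
    cases I.exec W s with
    | none => exact le_rfl
    | some s' => exact add_le_add_right (h s') 1
  | seq p q hp hq => intro f g h s; exact add_le_add_right (hp (hq h) s) 1
  | ite b p q hp hq =>
    intro f g h s
    simp only [ert]
    gcongr
    · exact hp h s
    · exact hq h s
  | loop b p hp =>
    intro f g h
    refine sInf_le_sInf fun I hI s => le_trans ?_ (hI s)
    gcongr
    exact h s

theorem ert_loop_le_of_invariant {W : ℕ} {b : Test} {p : Prog} {g I : State → ℝ≥0∞}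
    (h : ∀ s, 1 + (b.eval s true * ert W p I s + b.eval s false * g s) ≤ I s) :
    ert W (.loop b p) g ≤ I :=
  sInf_le h

/-- With `ert_loop_le`, this is Knaster–Tarski: the infimum of the prefixed points of a monotone map
is a fixed point, so a loop may be unrolled once. -/
theorem le_ert_loop (W : ℕ) (b : Test) (p : Prog) (g : State → ℝ≥0∞) (s : State) :
    1 + (b.eval s true * ert W p (ert W (.loop b p) g) s + b.eval s false * g s) ≤
      ert W (.loop b p) g s := by
  suffices (fun s => 1 + (b.eval s true * ert W p (ert W (.loop b p) g) s
      + b.eval s false * g s)) ≤ ert W (.loop b p) g from this s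
  refine le_sInf fun I hI s => le_trans ?_ (hI s)
  gcongr
  exact ert_mono W p (ert_loop_le_of_invariant hI) s

theorem ert_loop_le (W : ℕ) (b : Test) (p : Prog) (g : State → ℝ≥0∞) (s : State) :
    ert W (.loop b p) g s ≤
      1 + (b.eval s true * ert W p (ert W (.loop b p) g) s + b.eval s false * g s) := by
  refine ert_loop_le_of_invariant (I := fun s => 1 + (b.eval s true *
    ert W p (ert W (.loop b p) g) s + b.eval s false * g s)) (fun s => ?_) s
  gcongr
  exact ert_mono W p (fun s => le_ert_loop W b p g s) s

/-- `ert` for a stack of programs. -/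
noncomputable def ertStack (W : ℕ) (g : State → ℝ≥0∞) (c : Config) : ℝ≥0∞ :=
  c.1.foldr (ert W) g c.2

/-- The value of `ertStack` is a potential: each step of a configuration that has not halted lowers
its expectation by at least 1. A failing configuration has potential `⊤`. -/
theorem expect_step_le (W : ℕ) (g : State → ℝ≥0∞) (c : Config) :
    {c : Config | ¬ c.Halted}.indicator 1 c + (step W c).expect (ertStack W g) ≤
      ertStack W g c := by
  obtain ⟨K, s⟩ := c
  rcases K with _ | ⟨p, K⟩
  · simp [Config.Halted, step, PMF.expect_pure]
  have h : (p :: K, s) ∈ {c : Config | ¬ c.Halted} := by simp [Config.Halted]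
  rw [Set.indicator_of_mem h]
  cases p with
  | skip => simp [step, PMF.expect_pure, ertStack, ert]
  | instr I =>
    simp only [step, ertStack, List.foldr, ert]
    cases I.exec W s with
    | none => simp
    | some s' => rw [PMF.expect_pure]; exact le_rfl
  | seq p q => simp [step, PMF.expect_pure, ertStack, ert]
  | ite b p q =>
    simp [step, PMF.expect_bind, PMF.expect_pure, PMF.expect_bool, ertStack, ert]
  | loop b p =>
    simp only [step, PMF.expect_bind, PMF.expect_pure, PMF.expect_bool, ertStack]
    exact le_ert_loop W b p _ s

/-- Telescopes `expect_step_le` over `t` steps. The sum bounds the time, and the remaining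
expectation is what bears on the final memory. -/
theorem sum_add_expect_run_le (W : ℕ) (g : State → ℝ≥0∞) (c : Config) (t : ℕ) :
    ∑ i ∈ Finset.range t, (run W c i).toOuterMeasure {c | ¬ c.Halted}
      + (run W c t).expect (ertStack W g) ≤ ertStack W g c := by
  induction t with
  | zero => simp [run, PMF.expect_pure]
  | succ t ih =>
    refine le_trans ?_ ih
    rw [Finset.sum_range_succ, add_assoc, PMF.toOuterMeasure_eq_expect]
    simp only [run, PMF.expect_bind]
    rw [← PMF.expect_add]
    gcongr
    exact PMF.expect_mono _ fun c => expect_step_le W g c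

theorem expectedTime_le_ert (W : ℕ) (p : Prog) (s : State) (g : State → ℝ≥0∞) :
    expectedTime W p s ≤ ert W p g s := by
  rw [expectedTime, ENNReal.tsum_eq_iSup_nat]
  exact iSup_le fun t => le_self_add.trans (sum_add_expect_run_le W g ([p], s) t)

/-- A halted configuration outside `Q` that occurs with positive probability would alone contribute
`⊤` to the expected potential. -/
theorem alwaysReturns_of_ert_ne_top {W : ℕ} {p : Prog} {s : State} {Q : State → Prop}
    {g : State → ℝ≥0∞} (hg : ∀ s, ¬ Q s → g s = ⊤) (h : ert W p g s ≠ ⊤) :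
    AlwaysReturns W p s Q := by
  intro t c hc hh
  by_contra hQ
  apply h
  rw [← top_le_iff]
  refine le_trans ?_ ((le_add_self).trans (sum_add_expect_run_le W g ([p], s) t))
  refine le_trans ?_ (ENNReal.le_tsum c)
  have h1 : ertStack W g c = ⊤ := by
    obtain ⟨K, s'⟩ := c
    obtain rfl : K = [] := hh
    exact hg s' hQ
  rw [h1, ENNReal.mul_top (by simpa using hc)]

/-- From memory `s`, the program `p` ends in a memory that satisfies `Q`, in expected time at
most `c`. -/
def Spec (W : ℕ) (p : Prog) (s : State) (c : ℝ≥0∞) (Q : State → Prop) : Prop :=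
  ∀ (g : State → ℝ≥0∞) (b : ℝ≥0∞), (∀ s', Q s' → g s' ≤ b) → ert W p g s ≤ c + b

theorem Spec.expectedTime_le {W : ℕ} {p : Prog} {s : State} {c : ℝ≥0∞} {Q : State → Prop}
    (h : Spec W p s c Q) : expectedTime W p s ≤ c := by
  simpa using (expectedTime_le_ert W p s 0).trans (h 0 0 fun _ _ => le_rfl)

theorem Spec.alwaysReturns {W : ℕ} {p : Prog} {s : State} {c : ℝ≥0∞} {Q : State → Prop}
    (h : Spec W p s c Q) (hc : c ≠ ⊤) : AlwaysReturns W p s Q := by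
  classical
  refine alwaysReturns_of_ert_ne_top (g := fun s => if Q s then 0 else ⊤)
    (fun s hs => by simp [hs]) ?_
  have := h (fun s => if Q s then 0 else ⊤) 0 (fun s hs => by simp [hs])
  exact ne_top_of_le_ne_top (by simpa using hc) this

/-- Links the two styles: a first part with a uniform bound, followed by a part treated through
`ert` for a particular `g`. -/
theorem ert_seq_le {W : ℕ} {p q : Prog} {s : State} {c b : ℝ≥0∞} {R : State → Prop}
    {g : State → ℝ≥0∞} (hp : Spec W p s c R) (hq : ∀ s', R s' → ert W q g s' ≤ b) :
    ert W (.seq p q) g s ≤ 1 + c + b := by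
  rw [ert_seq, add_assoc]
  gcongr
  exact hp _ _ hq

theorem Spec.mono {W : ℕ} {p : Prog} {s : State} {c c' : ℝ≥0∞} {Q Q' : State → Prop}
    (h : Spec W p s c Q) (hc : c ≤ c') (hQ : ∀ s', Q s' → Q' s') : Spec W p s c' Q' :=
  fun g b hb => (h g b fun s' hs' => hb s' (hQ s' hs')).trans (by gcongr)

theorem Spec.skip {W : ℕ} {s : State} {Q : State → Prop} (h : Q s) : Spec W .skip s 1 Q :=
  fun g b hb => by simpa [ert] using add_le_add_right (hb s h) 1

theorem Spec.seq {W : ℕ} {p q : Prog} {s : State} {c₁ c₂ : ℝ≥0∞} {R Q : State → Prop}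
    (hp : Spec W p s c₁ R) (hq : ∀ s', R s' → Spec W q s' c₂ Q) :
    Spec W (.seq p q) s (1 + c₁ + c₂) Q := by
  intro g b hb
  have := hp (ert W q g) (c₂ + b) fun s' hs' => hq s' hs' g b hb
  simp only [ert]
  calc 1 + ert W p (ert W q g) s ≤ 1 + (c₁ + (c₂ + b)) := by gcongr
    _ = _ := by ring

/-- The value of a test that does not use randomness. -/
noncomputable def Test.holds : Test → State → Option Bool
  | .wlt i j, s => some (decide (s.wreg i < s.wreg j))
  | .weq i j, s => some (decide (s.wreg i = s.wreg j))
  | .rlt i j, s => some (decide (s.rreg i < s.rreg j))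
  | .coin _ _, _ => none

theorem Test.eval_of_holds {b : Test} {s : State} {r : Bool} (h : b.holds s = some r) :
    b.eval s = PMF.pure r := by
  cases b <;> simp_all [Test.holds, Test.eval]

/-- Only the branch that is taken has to be analysed, since the value of the test is known in `s`.
-/
theorem Spec.ite {W : ℕ} {b : Test} {p q : Prog} {s : State} {c : ℝ≥0∞} {Q : State → Prop}
    (h : (b.holds s = some true ∧ Spec W p s c Q) ∨ (b.holds s = some false ∧ Spec W q s c Q)) :
    Spec W (.ite b p q) s (1 + c) Q := by
  intro g d hd
  rcases h with ⟨h1, h2⟩ | ⟨h1, h2⟩ <;>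
  · have := h2 g d hd
    simp only [ert, Test.eval_of_holds h1, PMF.pure_apply, reduceCtorEq, if_false, if_true,
      zero_mul, one_mul, add_zero, zero_add, add_assoc]
    gcongr

/-- The rule for loops without randomness in the test. The invariant `Inv i` comes with an upper
bound `i` on the number of iterations and `T i` bounds the expected remaining time. -/
theorem Spec.loop {W : ℕ} {b : Test} {p : Prog} {Q : State → Prop} (Inv : ℕ → State → Prop)
    (T : ℕ → ℝ≥0∞)
    (h : ∀ i s, Inv i s → (b.holds s = some false ∧ Q s ∧ 1 ≤ T i) ∨
      (b.holds s = some true ∧ ∃ j < i, ∃ c, 1 + c + T j ≤ T i ∧ Spec W p s c (Inv j)))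
    {i : ℕ} {s : State} (hs : Inv i s) : Spec W (.loop b p) s (T i) Q := by
  intro g d hd
  induction i using Nat.strong_induction_on generalizing s with
  | _ i ih =>
    refine (ert_loop_le W b p g s).trans ?_
    rcases h i s hs with ⟨h1, h2, h3⟩ | ⟨h1, j, hj, c, hc, h2⟩
    · simp only [Test.eval_of_holds h1, PMF.pure_apply, reduceCtorEq, if_false, if_true,
        zero_mul, one_mul, zero_add]
      gcongr
      exact hd s h2
    · have := h2 (ert W (.loop b p) g) (T j + d) fun s' hs' => ih j hj hs'
      simp only [Test.eval_of_holds h1, PMF.pure_apply, reduceCtorEq, if_false, if_true,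
        zero_mul, one_mul, add_zero]
      calc 1 + ert W p (ert W (.loop b p) g) s ≤ 1 + (c + (T j + d)) := by gcongr
        _ = (1 + c + T j) + d := by ring
        _ ≤ _ := by gcongr

/-- The weakest precondition of an instruction. -/
noncomputable def Instr.wp (W : ℕ) : Instr → (State → Prop) → State → Prop
  | .wconst d v, Q, ⟨w, r, a, b, o, q⟩ => v ≤ W ∧ Q ⟨update w d v, r, a, b, o, q⟩
  | .wop op d i j, Q, ⟨w, r, a, b, o, q⟩ => op.eval (w i) (w j) ≤ W ∧
      Q ⟨update w d (op.eval (w i) (w j)), r, a, b, o, q⟩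
  | .wload d A i, Q, ⟨w, r, a, b, o, q⟩ => a A (w i) ≤ W ∧
      Q ⟨update w d (a A (w i)), r, a, b, o, q⟩
  | .wstore A i j, Q, ⟨w, r, a, b, o, q⟩ =>
      Q ⟨w, r, update a A (update (a A) (w i) (w j)), b, o, q⟩
  | .rzero d, Q, ⟨w, r, a, b, o, q⟩ => Q ⟨w, update r d 0, a, b, o, q⟩
  | .rone d, Q, ⟨w, r, a, b, o, q⟩ => Q ⟨w, update r d 1, a, b, o, q⟩
  | .radd d i j, Q, ⟨w, r, a, b, o, q⟩ => Q ⟨w, update r d (r i + r j), a, b, o, q⟩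
  | .rsub d i j, Q, ⟨w, r, a, b, o, q⟩ => Q ⟨w, update r d (r i - r j), a, b, o, q⟩
  | .rload d A i, Q, ⟨w, r, a, b, o, q⟩ => Q ⟨w, update r d (b A (w i)), a, b, o, q⟩
  | .rstore A i j, Q, ⟨w, r, a, b, o, q⟩ =>
      Q ⟨w, r, a, update b A (update (b A) (w i) (r j)), o, q⟩
  | .wemit i, Q, ⟨w, r, a, b, o, q⟩ => Q ⟨w, r, a, b, o ++ [w i], q⟩
  | .remit i, Q, ⟨w, r, a, b, o, q⟩ => Q ⟨w, r, a, b, o, q ++ [r i]⟩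

theorem Spec.instr {W : ℕ} {I : Instr} {s : State} {Q : State → Prop} (h : I.wp W Q s) :
    Spec W (.instr I) s 1 Q := by
  intro g b hb
  obtain ⟨w, r, a, e, o, q⟩ := s
  cases I <;> simp only [Instr.wp] at h <;>
    simp only [ert, Instr.exec, State.setWord, State.setWeight]
  case wconst d v => rw [if_pos h.1]; exact add_le_add_right (hb _ h.2) 1
  case wop d i j => rw [if_pos h.1]; exact add_le_add_right (hb _ h.2) 1
  case wload d A i => rw [if_pos h.1]; exact add_le_add_right (hb _ h.2) 1
  all_goals exact add_le_add_right (hb _ h) 1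

/-- A sequence of instructions. -/
def block : List Instr → Prog
  | [] => .skip
  | I :: l => .seq (.instr I) (block l)

/-- The weakest precondition of a sequence of instructions. -/
noncomputable def wpBlock (W : ℕ) : List Instr → (State → Prop) → State → Prop
  | [], Q => Q
  | I :: l, Q => I.wp W (wpBlock W l Q)

/-- True by eta for structures. `Instr.wp` matches on the constructor of `State`, so `simp` can
evaluate it only after this rewriting. -/
theorem wpBlock_of_mk {W : ℕ} {l : List Instr} {s : State} {Q : State → Prop}
    (h : wpBlock W l Q ⟨s.wreg, s.rreg, s.warr, s.rarr, s.wout, s.rout⟩) : wpBlock W l Q s := h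

theorem wpBlock_mono {W : ℕ} {l : List Instr} {s : State} {Q Q' : State → Prop}
    (hQ : ∀ s', Q s' → Q' s') (h : wpBlock W l Q s) : wpBlock W l Q' s := by
  induction l generalizing s with
  | nil => exact hQ s h
  | cons I l ih =>
    obtain ⟨w, r, a, e, o, q⟩ := s
    cases I <;> simp only [wpBlock, Instr.wp] at h ⊢
    case wconst => exact ⟨h.1, ih h.2⟩
    case wop => exact ⟨h.1, ih h.2⟩
    case wload => exact ⟨h.1, ih h.2⟩
    all_goals exact ih h

theorem Spec.block {W : ℕ} {l : List Instr} {s : State} {Q : State → Prop}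
    (h : wpBlock W l Q s) : Spec W (block l) s (2 * l.length + 1 : ℕ) Q := by
  induction l generalizing s with
  | nil => simpa [RandomRAM.block] using Spec.skip (Q := Q) h
  | cons I l ih =>
    refine (Spec.seq (Spec.instr (I := I) h) fun s' hs' => ih hs').mono ?_ fun _ h => h
    push_cast [List.length_cons]
    ring_nf
    exact le_rfl

/-- A loop rule for expectations, where the bound `F` depends on a ghost value. -/
theorem ert_loop_le_of_ghost {W : ℕ} {b : Test} {p : Prog} {g : State → ℝ≥0∞} {γ : Type*}
    (Inv : γ → State → Prop) (F : γ → ℝ≥0∞)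
    (h : ∀ a s, Inv a s → ∀ k : State → ℝ≥0∞, (∀ a' s', Inv a' s' → k s' ≤ F a') →
      1 + (b.eval s true * ert W p k s + b.eval s false * g s) ≤ F a)
    {a : γ} {s : State} (hs : Inv a s) : ert W (.loop b p) g s ≤ F a := by
  -- The least bound over all ghost values that fit the memory is itself a loop invariant; a memory
  -- that no ghost value fits gets the empty infimum `⊤`.
  refine (ert_loop_le_of_invariant (I := fun s => ⨅ a, ⨅ _ : Inv a s, F a) (fun s => ?_) s).trans
    (iInf₂_le a hs)
  exact le_iInf₂ fun a ha => h a s ha _ fun a' s' h' => iInf₂_le a' h'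

/-- This and the next rules are the previous ones for costs in `ℕ`, which `omega` can compare. -/
theorem Spec.mono_nat {W : ℕ} {p : Prog} {s : State} {c c' : ℕ} {Q Q' : State → Prop}
    (h : Spec W p s c Q) (hc : c ≤ c') (hQ : ∀ s', Q s' → Q' s') : Spec W p s c' Q' :=
  h.mono (by exact_mod_cast hc) hQ

theorem Spec.seq_nat {W : ℕ} {p q : Prog} {s : State} {c₁ c₂ : ℕ} {R Q : State → Prop}
    (hp : Spec W p s c₁ R) (hq : ∀ s', R s' → Spec W q s' c₂ Q) :
    Spec W (.seq p q) s (1 + c₁ + c₂ : ℕ) Q := by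
  simpa using Spec.seq hp hq

theorem Spec.ite_nat {W : ℕ} {b : Test} {p q : Prog} {s : State} {c : ℕ} {Q : State → Prop}
    (h : (b.holds s = some true ∧ Spec W p s c Q) ∨ (b.holds s = some false ∧ Spec W q s c Q)) :
    Spec W (.ite b p q) s (1 + c : ℕ) Q := by
  simpa using Spec.ite h

theorem Spec.loop_nat {W : ℕ} {b : Test} {p : Prog} {Q : State → Prop} (Inv : ℕ → State → Prop)
    (T : ℕ → ℕ)
    (h : ∀ i s, Inv i s → (b.holds s = some false ∧ Q s ∧ 1 ≤ T i) ∨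
      (b.holds s = some true ∧ ∃ j < i, ∃ c : ℕ, 1 + c + T j ≤ T i ∧ Spec W p s c (Inv j)))
    {i : ℕ} {s : State} (hs : Inv i s) : Spec W (.loop b p) s (T i) Q := by
  refine Spec.loop Inv (fun i => (T i : ℝ≥0∞)) (fun i s hi => ?_) hs
  rcases h i s hi with ⟨h1, h2, h3⟩ | ⟨h1, j, hj, c, hc, h2⟩
  · exact Or.inl ⟨h1, h2, by exact_mod_cast h3⟩
  · exact Or.inr ⟨h1, j, hj, c, by exact_mod_cast hc, h2⟩

end RandomRAM

/-! ### Trees in heap order and the layout of the memory -/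

/-- In a complete binary tree in heap order, the value at the root is the sum over the leaves. -/
theorem heap_root_eq_sum {α : Type*} [AddCommMonoid α] {f : ℕ → α} {d : ℕ} (hd : 1 ≤ d)
    (h : ∀ x, 1 ≤ x → x < d → f x = f (2 * x) + f (2 * x + 1)) :
    f 1 = ∑ x ∈ Finset.Ico d (2 * d), f x := by
  induction d, hd using Nat.le_induction with
  | base => simp
  | succ d hd ih =>
    -- From `d` to `d + 1` leaves, the leaf `d` turns into an inner node with the new leaves `2 * d`
    -- and `2 * d + 1`.
    rw [ih fun x h1 h2 => h x h1 (by omega), Finset.sum_eq_sum_Ico_succ_bot (by omega),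
      h d hd (by omega), show 2 * (d + 1) = 2 * d + 1 + 1 by ring,
      Finset.sum_Ico_succ_top (by omega), Finset.sum_Ico_succ_top (by omega), add_comm (_ + _)]
    abel

/-- The values of a complete binary tree with `d` leaves in heap order, from those of the leaves. -/
def heapExtend {α : Type*} [Add α] (d : ℕ) (φ : ℕ → α) (x : ℕ) : α :=
  if d ≤ x ∨ x = 0 then φ x else heapExtend d φ (2 * x) + heapExtend d φ (2 * x + 1)
termination_by d - x
decreasing_by all_goals omega

theorem heapExtend_leaf {α : Type*} [Add α] {d : ℕ} (φ : ℕ → α) {x : ℕ} (h : d ≤ x) :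
    heapExtend d φ x = φ x := by
  rw [heapExtend, if_pos (Or.inl h)]

theorem heapExtend_node {α : Type*} [Add α] {d : ℕ} (φ : ℕ → α) {x : ℕ} (h1 : 1 ≤ x) (h : x < d) :
    heapExtend d φ x = heapExtend d φ (2 * x) + heapExtend d φ (2 * x + 1) := by
  rw [heapExtend, if_neg (by omega)]

/-- The layout of the adjacency array in memory: `st i` is the position where row `i` starts and
`cl e` the column of the entry at position `e`. After the `n` rows of the matrix there is one more
row of length `n`. The number `L` bounds the depth of a binary tree with `n` leaves. -/
structure Layout where
  n : ℕ
  m : ℕ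
  L : ℕ
  st : ℕ → ℕ
  cl : ℕ → ℕ
  n_pos : 1 ≤ n
  n_le : n ≤ 2 ^ L
  st_zero : st 0 = 0
  st_n : st n = m
  st_succ : st (n + 1) = m + n
  st_lt : ∀ i ≤ n, st i < st (i + 1)
  deg_le' : ∀ i ≤ n, st (i + 1) ≤ st i + n
  cl_lt : ∀ e < m + n, cl e < n
  cl_inj : ∀ i ≤ n, ∀ e e', st i ≤ e → e < st (i + 1) → st i ≤ e' → e' < st (i + 1) →
    cl e = cl e' → e = e'
  cl_source : ∀ u < n, cl (m + u) = u

namespace Layout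

variable (Y : Layout)

/-- The number of entries of a row. -/
def deg (i : ℕ) : ℕ := Y.st (i + 1) - Y.st i

/-- The column of the leaf `x` of the binary tree of row `i`. -/
def col (i x : ℕ) : ℕ := Y.cl (Y.st i + (x - Y.deg i))

/-- The leaves of the binary tree of row `i`. -/
def IsLeaf (i x : ℕ) : Prop := Y.deg i ≤ x ∧ x < 2 * Y.deg i

theorem deg_pos {i : ℕ} (hi : i ≤ Y.n) : 1 ≤ Y.deg i := by
  have := Y.st_lt i hi
  unfold deg
  omega

theorem deg_le {i : ℕ} (hi : i ≤ Y.n) : Y.deg i ≤ Y.n := by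
  have := Y.deg_le' i hi
  unfold deg
  omega

theorem st_add_deg {i : ℕ} (hi : i ≤ Y.n) : Y.st i + Y.deg i = Y.st (i + 1) := by
  have := Y.st_lt i hi
  unfold deg
  omega

theorem st_mono {i j : ℕ} (hij : i ≤ j) (hj : j ≤ Y.n + 1) : Y.st i ≤ Y.st j := by
  induction j, hij using Nat.le_induction with
  | base => exact le_rfl
  | succ j hij ih => exact (ih (by omega)).trans (Y.st_lt j (by omega)).le

theorem st_le {i : ℕ} (hi : i ≤ Y.n + 1) : Y.st i ≤ Y.m + Y.n :=
  Y.st_succ ▸ Y.st_mono hi le_rfl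

theorem deg_n : Y.deg Y.n = Y.n := by
  have := Y.st_succ
  have := Y.st_n
  unfold deg
  omega

theorem isLeaf_n {u : ℕ} (hu : u < Y.n) : Y.IsLeaf Y.n (Y.n + u) := by
  rw [IsLeaf, Y.deg_n]
  omega

theorem col_n {u : ℕ} (hu : u < Y.n) : Y.col Y.n (Y.n + u) = u := by
  rw [col, Y.deg_n, Y.st_n, Nat.add_sub_cancel_left, Y.cl_source u hu]

theorem col_lt {i x : ℕ} (hi : i ≤ Y.n) (hx : Y.IsLeaf i x) : Y.col i x < Y.n := by
  apply Y.cl_lt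
  have h1 := Y.st_add_deg hi
  have h2 := Y.st_le (i := i + 1) (by omega)
  have := hx.1
  have := hx.2
  omega

theorem col_inj {i x y : ℕ} (hi : i ≤ Y.n) (hx : Y.IsLeaf i x) (hy : Y.IsLeaf i y)
    (h : Y.col i x = Y.col i y) : x = y := by
  have h1 := Y.st_add_deg hi
  obtain ⟨hx1, hx2⟩ := hx
  obtain ⟨hy1, hy2⟩ := hy
  have := Y.cl_inj i hi _ _ (by omega) (by omega) (by omega) (by omega) h
  omega

/-- Positions in the trees of different rows are different. -/
theorem tree_disjoint {i j x y : ℕ} (hi : i ≤ Y.n) (hj : j ≤ Y.n) (hx1 : 1 ≤ x)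
    (hx : x < 2 * Y.deg i) (hy1 : 1 ≤ y) (hy : y < 2 * Y.deg j)
    (h : 2 * Y.st i + x = 2 * Y.st j + y) : i = j ∧ x = y := by
  have h1 := Y.st_add_deg hi
  have h2 := Y.st_add_deg hj
  -- The tree of row `i` lies strictly between the positions `2 * Y.st i` and `2 * Y.st (i + 1)`.
  rcases lt_trichotomy i j with hij | rfl | hij
  · have := Y.st_mono (i := i + 1) (j := j) hij (by omega)
    omega
  · omega
  · have := Y.st_mono (i := j + 1) (j := i) hij (by omega)
    omega

/-- The part of the memory `R` that belongs to row `i` holds a binary tree, with the weights `w j`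
of the columns `j` of the row in its leaves and sums in the other nodes. -/
structure Row (R : ℕ → ℝ) (i : ℕ) (w : ℕ → ℝ) : Prop where
  node : ∀ x, 1 ≤ x → x < Y.deg i →
    R (2 * Y.st i + x) = R (2 * Y.st i + 2 * x) + R (2 * Y.st i + (2 * x + 1))
  leaf : ∀ x, Y.IsLeaf i x → R (2 * Y.st i + x) = w (Y.col i x)
  zero : ∀ j < Y.n, (∀ x, Y.IsLeaf i x → Y.col i x ≠ j) → w j = 0
  nonneg : ∀ j < Y.n, 0 ≤ w j

variable {Y}

/-- Distinct leaves of a row have distinct columns, so leaves can be exchanged for columns; the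
columns without a leaf contribute 0 by `h0`. -/
theorem sum_leaf {α : Type*} [AddCommMonoid α] {i : ℕ} (hi : i ≤ Y.n) (φ : ℕ → α)
    (h0 : ∀ j < Y.n, (∀ x, Y.IsLeaf i x → Y.col i x ≠ j) → φ j = 0) :
    ∑ x ∈ Finset.Ico (Y.deg i) (2 * Y.deg i), φ (Y.col i x) = ∑ j ∈ Finset.range Y.n, φ j := by
  classical
  have hl : ∀ x ∈ Finset.Ico (Y.deg i) (2 * Y.deg i), Y.IsLeaf i x :=
    fun x hx => Finset.mem_Ico.1 hx
  rw [← Finset.sum_image (s := Finset.Ico (Y.deg i) (2 * Y.deg i)) (g := Y.col i) (f := φ)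
    fun x hx y hy => Y.col_inj hi (hl x hx) (hl y hy)]
  apply Finset.sum_subset
  · intro j hj
    obtain ⟨x, hx, rfl⟩ := Finset.mem_image.1 hj
    exact Finset.mem_range.2 (Y.col_lt hi (hl x hx))
  · intro j hj hj'
    refine h0 j (Finset.mem_range.1 hj) fun x hx hxj => hj' ?_
    exact Finset.mem_image.2 ⟨x, Finset.mem_Ico.2 hx, hxj⟩

/-- Besides normalizing the sampling, this lets the program read off the common row sum from the
tree of row 0. -/
theorem Row.root {R : ℕ → ℝ} {i : ℕ} {w : ℕ → ℝ} (h : Y.Row R i w) (hi : i ≤ Y.n) :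
    R (2 * Y.st i + 1) = ∑ j ∈ Finset.range Y.n, w j := by
  rw [← sum_leaf hi w h.zero, heap_root_eq_sum (f := fun x => R (2 * Y.st i + x)) (Y.deg_pos hi)
    h.node]
  exact Finset.sum_congr rfl fun x hx => h.leaf x (Finset.mem_Ico.1 hx)

theorem Row.node_nonneg {R : ℕ → ℝ} {i : ℕ} {w : ℕ → ℝ} (h : Y.Row R i w) (hi : i ≤ Y.n) {x : ℕ}
    (h1 : 1 ≤ x) (h2 : x < 2 * Y.deg i) : 0 ≤ R (2 * Y.st i + x) := by
  induction hk : 2 * Y.deg i - x using Nat.strong_induction_on generalizing x with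
  | _ k ih =>
    rcases le_or_gt (Y.deg i) x with hx | hx
    · rw [h.leaf x ⟨hx, h2⟩]
      exact h.nonneg _ (Y.col_lt hi ⟨hx, h2⟩)
    · rw [h.node x h1 hx]
      exact add_nonneg (ih _ (by omega) (by omega) (by omega) rfl)
        (ih _ (by omega) (by omega) (by omega) rfl)

theorem Row.congr {R R' : ℕ → ℝ} {i : ℕ} {w : ℕ → ℝ} (h : Y.Row R i w)
    (hR : ∀ x, 1 ≤ x → x < 2 * Y.deg i → R' (2 * Y.st i + x) = R (2 * Y.st i + x))
    (hi : i ≤ Y.n) : Y.Row R' i w where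
  node x h1 h2 := by
    rw [hR x h1 (by omega), hR (2 * x) (by omega) (by omega), hR _ (by omega) (by omega)]
    exact h.node x h1 h2
  leaf x hx := by
    have := Y.deg_pos hi
    rw [hR x (by have := hx.1; omega) hx.2, h.leaf x hx]
  zero := h.zero
  nonneg := h.nonneg

end Layout

/-! ### Sampling from a row and changing an entry -/

namespace RandomRAM

open Function

theorem coinPMF_true {x w : ℝ} (hw : 0 < w) (h : x ≤ w) :
    coinPMF x w true = ENNReal.ofReal (x / w) := by
  have h1 : (x / w).toNNReal ≤ 1 := by
    rw [Real.toNNReal_le_one]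
    exact (div_le_one hw).2 h
  simp only [coinPMF, PMF.ofFintype_apply, coinProb, if_pos hw, min_eq_right h1, if_true]
  rfl

theorem coinPMF_false {x w : ℝ} (hx : 0 ≤ x) (hw : 0 < w) (h : x ≤ w) :
    coinPMF x w false = ENNReal.ofReal ((w - x) / w) := by
  have h1 : (x / w).toNNReal ≤ 1 := by
    rw [Real.toNNReal_le_one]
    exact (div_le_one hw).2 h
  simp only [coinPMF, PMF.ofFintype_apply, coinProb, if_pos hw, min_eq_right h1,
    if_false, Bool.false_eq_true]
  rw [sub_div, div_self hw.ne', ENNReal.ofReal_sub _ (by positivity), ENNReal.ofReal_one]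
  rfl

/-- Memory `s'` agrees with `s` in the word registers below `p`, the weight registers below `q` and
the output. -/
structure Keep (p q : ℕ) (s s' : State) : Prop where
  wreg : ∀ r < p, s'.wreg r = s.wreg r
  rreg : ∀ r < q, s'.rreg r = s.rreg r
  wout : s'.wout = s.wout
  rout : s'.rout = s.rout

theorem Keep.refl (p q : ℕ) (s : State) : Keep p q s s :=
  ⟨fun _ _ => rfl, fun _ _ => rfl, rfl, rfl⟩

/-- Registers are allotted by nesting, so that a routine preserves everything its callers need: word
registers 0 to 6 hold parameters, constants and the count of matchings, 7 the loop counter, 9 the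
start and 20 the position of the walk, 40 the row passed as an argument, and the higher ones are
scratch. In the same way, weight registers from 10 on are scratch. -/
theorem Keep.trans {p q p' q' : ℕ} {s s' s'' : State} (h : Keep p q s s')
    (h' : Keep p' q' s' s'') (hp : p ≤ p') (hq : q ≤ q') : Keep p q s s'' :=
  ⟨fun r hr => (h'.wreg r (hr.trans_le hp)).trans (h.wreg r hr),
    fun r hr => (h'.rreg r (hr.trans_le hq)).trans (h.rreg r hr),
    h'.wout.trans h.wout, h'.rout.trans h.rout⟩

/-- The constants and the layout in memory. -/
structure Stat (Y : Layout) (s : State) : Prop where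
  n : s.wreg 0 = Y.n
  one : s.wreg 3 = 1
  two : s.wreg 4 = 2
  zero : s.wreg 5 = 0
  st : s.warr 0 = Y.st
  cl : s.warr 1 = Y.cl

theorem Stat.of_keep {Y : Layout} {p q : ℕ} {s s' : State} (h : Stat Y s) (hk : Keep p q s s')
    (hp : 6 ≤ p) (h0 : s'.warr 0 = s.warr 0) (h1 : s'.warr 1 = s.warr 1) : Stat Y s' where
  n := (hk.wreg _ (by omega)).trans h.n
  one := (hk.wreg _ (by omega)).trans h.one
  two := (hk.wreg _ (by omega)).trans h.two
  zero := (hk.wreg _ (by omega)).trans h.zero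
  st := h0.trans h.st
  cl := h1.trans h.cl

/-- Words are large enough for all indices. -/
def Layout.Fits (Y : Layout) (W : ℕ) : Prop := 4 * (Y.m + Y.n) + 10 ≤ W

/-- For the row in word register `40`, compute the position `43` of its first entry, the number
`44` of its entries and the position `42` of its tree. -/
def rowAddr : List Instr :=
  [.wload 43 0 40, .wop .add 45 40 3, .wload 44 0 45, .wop .sub 44 44 43, .wop .add 42 43 43]

/-- After `rowAddr`, compute the column `47` of the leaf `41`. -/
def colOf : List Instr :=
  [.wop .sub 45 41 44, .wop .add 45 43 45, .wload 47 1 45]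

/-- One step down the tree to a random child. -/
def sampleStep : Prog :=
  .seq (block [.wop .add 45 42 41, .rload 10 1 45, .wop .add 46 41 41, .wop .add 45 42 46,
    .rload 11 1 45])
    (.ite (.coin 11 10) (block [.wop .add 41 46 5]) (block [.wop .add 41 46 3]))

/-- Select a random leaf `41`, with column `47`, of the row in word register `40`. -/
def sample : Prog :=
  .seq (block (rowAddr ++ [.wconst 41 1])) (.seq (.loop (.wlt 41 44) sampleStep) (block colOf))

/-- Write the weight register `12` to the leaf `41` of the row in word register `40`. -/
def setLeaf : Prog :=
  .seq (block (rowAddr ++ [.wop .add 45 42 41, .rstore 1 45 12, .wop .div 41 41 4]))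
    (.loop (.wlt 5 41) (block [.wop .add 46 41 41, .wop .add 45 42 46, .rload 10 1 45,
      .wop .add 45 45 3, .rload 11 1 45, .radd 10 10 11, .wop .add 45 42 41, .rstore 1 45 10,
      .wop .div 41 41 4]))

/-- The memory after `rowAddr` for row `i`, where `s` is the memory before it. -/
structure AtRow (Y : Layout) (i : ℕ) (s s' : State) : Prop where
  stat : Stat Y s'
  keep : Keep 41 10 s s'
  warr : s'.warr = s.warr
  base : s'.wreg 42 = 2 * Y.st i
  st : s'.wreg 43 = Y.st i
  deg : s'.wreg 44 = Y.deg i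

/-- Stated for a continuation `l`, so that the address computation can be the beginning of a longer
block. -/
theorem rowAddr_wp {Y : Layout} {W : ℕ} (hW : Layout.Fits Y W) {s : State} (hs : Stat Y s) {i : ℕ}
    (hi : i ≤ Y.n) (h40 : s.wreg 40 = i) {l : List Instr} {Q : State → Prop}
    (h : ∀ s', AtRow Y i s s' → s'.rarr = s.rarr → s'.rreg = s.rreg → s'.wreg 41 = s.wreg 41 →
      wpBlock W l Q s') : wpBlock W (rowAddr ++ l) Q s := by
  have h1 := Y.st_add_deg hi
  have h2 := Y.st_le (i := i + 1) (by omega)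
  have h3 := Y.deg_le hi
  unfold Layout.Fits at hW
  have hd : Y.st (i + 1) - Y.st i = Y.deg i := rfl
  simp only [rowAddr, List.cons_append, List.nil_append]
  apply wpBlock_of_mk
  simp only [wpBlock, Instr.wp, h40, hs.st, hs.one, WordOp.eval, update_apply, reduceIte,
      Nat.reduceEqDiff, hd]
  refine ⟨by omega, by omega, by omega, by omega, by omega, h _ ⟨⟨?_, ?_, ?_, ?_, hs.st, hs.cl⟩,
    ⟨?_, ?_, ?_, ?_⟩, ?_, ?_, ?_, ?_⟩ ?_ ?_ ?_⟩
  all_goals simp [update_apply, hs.n, hs.one, hs.two, hs.zero]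
  · intro r hr
    grind
  · omega

theorem colOf_wp {Y : Layout} {W : ℕ} (hW : Layout.Fits Y W) {s s' : State} {i : ℕ}
    (hs : AtRow Y i s s') (hi : i ≤ Y.n) {x : ℕ} (hx : Y.IsLeaf i x) (h41 : s'.wreg 41 = x)
    {l : List Instr} {Q : State → Prop}
    (h : ∀ s'', AtRow Y i s s'' → s''.rarr = s'.rarr → s''.rreg = s'.rreg →
      s''.wreg 41 = x → s''.wreg 47 = Y.col i x → wpBlock W l Q s'') :
    wpBlock W (colOf ++ l) Q s' := by
  have h1 := Y.st_add_deg hi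
  have h2 := Y.st_le (i := i + 1) (by omega)
  have h3 := Y.deg_le hi
  have h4 := Y.col_lt hi hx
  obtain ⟨hx1, hx2⟩ := hx
  unfold Layout.Fits at hW
  have hd : Y.cl (Y.st i + (x - Y.deg i)) = Y.col i x := rfl
  simp only [colOf, List.cons_append, List.nil_append]
  apply wpBlock_of_mk
  simp only [wpBlock, Instr.wp, h41, hs.st, hs.deg, hs.stat.cl, WordOp.eval, update_apply,
      reduceIte,
    Nat.reduceEqDiff, hd]
  refine ⟨by omega, by omega, by omega, h _ ⟨⟨?_, ?_, ?_, ?_, hs.stat.st, hs.stat.cl⟩,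
    ⟨?_, ?_, ?_, ?_⟩, ?_, ?_, ?_, ?_⟩ ?_ ?_ ?_ ?_⟩
  all_goals simp [update_apply, hs.stat.n, hs.stat.one, hs.stat.two, hs.stat.zero, hs.keep.wout,
    hs.keep.rout, hs.warr, hs.base, hs.st, hs.deg, h41]
  · intro r hr
    have := hs.keep.wreg r hr
    grind
  · exact hs.keep.rreg

theorem ert_block_le {W : ℕ} {l : List Instr} {s : State} {g : State → ℝ≥0∞} {b : ℝ≥0∞}
    (h : wpBlock W l (fun s' => g s' ≤ b) s) :
    ert W (block l) g s ≤ (2 * l.length + 1 : ℕ) + b :=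
  Spec.block h g b fun _ h => h

/-- The possible final memories of `sample` when it selects the leaf `x`. -/
structure Sampled (Y : Layout) (i x : ℕ) (s s' : State) : Prop where
  keep : Keep 41 10 s s'
  warr : s'.warr = s.warr
  rarr : s'.rarr = s.rarr
  node : s'.wreg 41 = x
  col : s'.wreg 47 = Y.col i x

/-- The memory on the way down the tree. -/
structure Descent (Y : Layout) (i : ℕ) (s : State) (x : ℕ) (s' : State) : Prop where
  row : AtRow Y i s s'
  rarr : s'.rarr = s.rarr
  node : s'.wreg 41 = x
  pos : 1 ≤ x
  lt : x < 2 * Y.deg i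
  weight_pos : 0 < s.rarr 1 (2 * Y.st i + x)

/-- The coin shows the left child with probability the quotient of its weight by that of the node;
by the sum rule at the node, the complementary probability is that quotient for the right child. -/
theorem sampleStep_wp {Y : Layout} {W : ℕ} (hW : Layout.Fits Y W) {s s' : State} {i x : ℕ}
    (hi : i ≤ Y.n) {w : ℕ → ℝ} (hw : Y.Row (s.rarr 1) i w) (hs : Descent Y i s x s')
    (hx : x < Y.deg i) {g : State → ℝ≥0∞} {f : ℕ → ℝ≥0∞}
    (hg : ∀ y s'', (y = 2 * x ∨ y = 2 * x + 1) → Descent Y i s y s'' → g s'' ≤ f y) :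
    ert W sampleStep g s' ≤ 16 +
      (ENNReal.ofReal (s.rarr 1 (2 * Y.st i + 2 * x) / s.rarr 1 (2 * Y.st i + x)) * f (2 * x) +
      ENNReal.ofReal (s.rarr 1 (2 * Y.st i + (2 * x + 1)) / s.rarr 1 (2 * Y.st i + x)) *
        f (2 * x + 1)) := by
  have h1 := Y.st_add_deg hi
  have h2 := Y.st_le (i := i + 1) (by omega)
  have h3 := Y.deg_le hi
  have hpos := hs.pos
  have hT := hs.weight_pos
  have hn := hw.node x hpos hx
  have hl := hw.node_nonneg hi (x := 2 * x) (by omega) (by omega)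
  have hr := hw.node_nonneg hi (x := 2 * x + 1) (by omega) (by omega)
  unfold Layout.Fits at hW
  set T := fun y => s.rarr 1 (2 * Y.st i + y) with hTdef
  set B := (ENNReal.ofReal (T (2 * x) / T x) * f (2 * x) +
      ENNReal.ofReal (T (2 * x + 1) / T x) * f (2 * x + 1)) with hB
  show _ ≤ 16 + B
  have hfin : ∀ s'' : State, AtRow Y i s s'' → s''.rarr = s.rarr → s''.wreg 41 = x →
      s''.wreg 46 = 2 * x → s''.rreg 10 = T x → s''.rreg 11 = T (2 * x) →
      ert W (.ite (.coin 11 10) (block [.wop .add 41 46 5]) (block [.wop .add 41 46 3])) g s'' ≤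
        4 + B := by
    intro s'' hs'' hR hx'' h46 h10 h11
    have hTx : T x = T (2 * x) + T (2 * x + 1) := hn
    have e1 : T x - T (2 * x) = T (2 * x + 1) := by linarith
    simp only [ert, Test.eval, h10, h11]
    have hle : T (2 * x) ≤ T x := hTx ▸ le_add_of_nonneg_right hr
    rw [coinPMF_true hT hle, coinPMF_false hl hT hle, e1]
    -- A child of weight 0 is reached with probability 0, and nothing needs to be known about `g`
    -- there. Hence `Descent` may demand positive weight.
    have key : ∀ (l : List Instr) (y : ℕ), l.length = 1 → (y = 2 * x ∨ y = 2 * x + 1) →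
        (0 < T y → wpBlock W l (Descent Y i s y) s'') →
        ENNReal.ofReal (T y / T x) * ert W (block l) g s'' ≤
          ENNReal.ofReal (T y / T x) * (3 + f y) := by
      intro l y hlen hy hwp
      rcases le_or_gt (T y) 0 with h0 | h0
      · rw [ENNReal.ofReal_of_nonpos (div_nonpos_of_nonpos_of_nonneg h0 hT.le)]
        simp
      · have := Spec.block (hwp h0) g (f y) fun s3 => hg y s3 hy
        rw [hlen] at this
        gcongr
        exact_mod_cast this
    have hD : ∀ y, (y = 2 * x ∨ y = 2 * x + 1) → 0 < T y →
        Descent Y i s y { s'' with wreg := update s''.wreg 41 y } := by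
      intro y hy h0
      refine ⟨⟨⟨?_, ?_, ?_, ?_, hs''.stat.st, hs''.stat.cl⟩, ⟨?_, hs''.keep.rreg, hs''.keep.wout,
        hs''.keep.rout⟩, hs''.warr, ?_, ?_, ?_⟩, hR, ?_, by omega, by omega, h0⟩
      all_goals simp [hs''.stat.n, hs''.stat.one, hs''.stat.two, hs''.stat.zero,
        hs''.base, hs''.st, hs''.deg]
      intro r hr
      rw [update_of_ne (by omega), hs''.keep.wreg r hr]
    have hA := key [.wop .add 41 46 5] (2 * x) rfl (Or.inl rfl) (fun h0 => by
      apply wpBlock_of_mk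
      simp only [wpBlock, Instr.wp, WordOp.eval, h46, hs''.stat.zero, add_zero]
      exact ⟨by omega, hD _ (Or.inl rfl) h0⟩)
    have hB' := key [.wop .add 41 46 3] (2 * x + 1) rfl (Or.inr rfl) (fun h0 => by
      apply wpBlock_of_mk
      simp only [wpBlock, Instr.wp, WordOp.eval, h46, hs''.stat.one]
      exact ⟨by omega, hD _ (Or.inr rfl) h0⟩)
    have hsum : ENNReal.ofReal (T (2 * x) / T x) + ENNReal.ofReal (T (2 * x + 1) / T x) = 1 := by
      rw [← ENNReal.ofReal_add (div_nonneg hl hT.le) (div_nonneg hr hT.le), ← add_div, ← hTx,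
        div_self hT.ne', ENNReal.ofReal_one]
    calc _ ≤ 1 + (ENNReal.ofReal (T (2 * x) / T x) * (3 + f (2 * x)) +
          ENNReal.ofReal (T (2 * x + 1) / T x) * (3 + f (2 * x + 1))) := by gcongr
      _ = 1 + 3 * (ENNReal.ofReal (T (2 * x) / T x) + ENNReal.ofReal (T
          (2 * x + 1) / T x)) + B := by
        rw [hB]; ring
      _ = 4 + B := by rw [hsum]; norm_num
  have hblock : wpBlock W [.wop .add 45 42 41, .rload 10 1 45, .wop .add 46 41 41,
      .wop .add 45 42 46, .rload 11 1 45] (fun s'' =>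
      ert W (.ite (.coin 11 10) (block [.wop .add 41 46 5]) (block [.wop .add 41 46 3])) g s'' ≤
        4 + B) s' := by
    apply wpBlock_of_mk
    simp only [wpBlock, Instr.wp, hs.node, hs.row.base, WordOp.eval, update_apply, reduceIte,
        Nat.reduceEqDiff, hs.rarr]
    refine ⟨by omega, by omega, by omega, hfin _ ⟨⟨?_, ?_, ?_, ?_, hs.row.stat.st,
      hs.row.stat.cl⟩, ⟨?_, ?_, ?_, ?_⟩, hs.row.warr, ?_, ?_, ?_⟩ ?_ ?_ ?_ ?_ ?_⟩
    all_goals simp [update_apply, hs.row.stat.n, hs.row.stat.one, hs.row.stat.two,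
      hs.row.stat.zero, hs.row.keep.wout, hs.row.keep.rout, hs.row.base, hs.row.st, hs.row.deg,
      hs.node]
    · intro r hr
      have := hs.row.keep.wreg r hr
      grind
    · intro r hr
      have := hs.row.keep.rreg r hr
      grind
    · omega
    · rfl
    · rw [hTdef, ← two_mul x]
  have := ert_block_le hblock
  simp only [sampleStep, ert] at this ⊢
  refine (add_le_add_right this 1).trans (le_of_eq ?_)
  norm_num [← add_assoc]

/-- Let `H x` be the sum of weight times `F` over the leaves below `x`. Given that the descent is at
`x`, the expectation of `F` at the selected leaf is `H x` divided by the weight of `x`; at the root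
this is the sum on the right. Each of at most `L` levels costs 17 steps. -/
theorem sample_ert_le {Y : Layout} {W : ℕ} (hW : Layout.Fits Y W) {s : State} (hs : Stat Y s)
    {i : ℕ} (hi : i ≤ Y.n) (h40 : s.wreg 40 = i) {w : ℕ → ℝ} (hw : Y.Row (s.rarr 1) i w)
    {S : ℝ} (hS : ∑ j ∈ Finset.range Y.n, w j = S) (hS0 : 0 < S) {g : State → ℝ≥0∞}
    {F : ℕ → ℝ≥0∞}
    (hg : ∀ x s', Y.IsLeaf i x → 0 < w (Y.col i x) → Sampled Y i x s s' → g s' ≤ F (Y.col i x)) :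
    ert W sample g s ≤ (17 * Y.L + 23 : ℕ) +
      ∑ j ∈ Finset.range Y.n, ENNReal.ofReal (w j / S) * F j := by
  have hd := Y.deg_pos hi
  have hroot := hw.root hi
  rw [hS] at hroot
  set T := fun y => s.rarr 1 (2 * Y.st i + y) with hTdef
  set φ : ℕ → ℝ≥0∞ := fun x => ENNReal.ofReal (T x) * F (Y.col i x)
  set H := heapExtend (Y.deg i) φ with hH
  have hH1 : H 1 = ∑ j ∈ Finset.range Y.n, ENNReal.ofReal (w j) * F j := by
    rw [heap_root_eq_sum (f := H) hd fun x h1 h2 => heapExtend_node φ h1 h2,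
      ← Layout.sum_leaf hi (fun j => ENNReal.ofReal (w j) * F j)
        fun j hj h => by rw [hw.zero j hj h]; simp]
    refine Finset.sum_congr rfl fun x hx => ?_
    have hx := Finset.mem_Ico.1 hx
    rw [hH, heapExtend_leaf φ hx.1]
    simp only [φ, hTdef, hw.leaf x hx]
  have hpre : wpBlock W (rowAddr ++ [.wconst 41 1]) (Descent Y i s 1) s := by
    refine rowAddr_wp hW hs hi h40 fun s' h1 h2 h3 h4 => ?_
    apply wpBlock_of_mk
    simp only [wpBlock, Instr.wp]
    refine ⟨by unfold Layout.Fits at hW; omega, ⟨⟨?_, ?_, ?_, ?_, h1.stat.st, h1.stat.cl⟩,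
      ⟨?_, h1.keep.rreg, h1.keep.wout, h1.keep.rout⟩, h1.warr, ?_, ?_, ?_⟩, h2, ?_, le_rfl,
      by omega, by rw [hroot]; exact hS0⟩
    all_goals simp [h1.stat.n, h1.stat.one, h1.stat.two, h1.stat.zero, h1.base, h1.st, h1.deg]
    intro r hr
    rw [update_of_ne (by omega), h1.keep.wreg r hr]
  have hpost : ∀ x s', Descent Y i s x s' → Y.deg i ≤ x →
      ert W (block colOf) g s' ≤ 7 + F (Y.col i x) := by
    intro x s' h hx
    have hl : Y.IsLeaf i x := ⟨hx, h.lt⟩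
    have := ert_block_le (l := colOf ++ []) (g := g) (b := F (Y.col i x))
      (colOf_wp hW h.row hi hl h.node fun s'' h1 h2 h3 h4 h5 => hg x s'' hl
        (by rw [← hw.leaf x hl]; exact h.weight_pos)
        ⟨h1.keep, h1.warr, h2.trans h.rarr, h4, h5⟩)
    rw [List.append_nil] at this
    exact_mod_cast this
  have hloop : ∀ s', Descent Y i s 1 s' →
      ert W (.loop (.wlt 41 44) sampleStep) (ert W (block colOf) g) s' ≤
        17 * (Y.L : ℝ≥0∞) + 8 + H 1 / ENNReal.ofReal (T 1) := by
    intro s' hs'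
    -- The ghost is the current node `x` together with a bound `q` on the levels that remain: after
    -- `q` doublings `x` has reached the leaves.
    refine ert_loop_le_of_ghost (γ := ℕ × ℕ)
      (fun a s' => Descent Y i s a.1 s' ∧ Y.deg i ≤ a.1 * 2 ^ a.2)
      (fun a => 17 * (a.2 : ℝ≥0∞) + 8 + H a.1 / ENNReal.ofReal (T a.1)) ?_ (a := (1, Y.L))
      ⟨hs', by simpa using (Y.deg_le hi).trans Y.n_le⟩
    rintro ⟨x, q⟩ s'' ⟨h, hq⟩ k hk
    simp only at h hq ⊢
    have hT : 0 < T x := h.weight_pos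
    have hpos := h.pos
    have hT' : ENNReal.ofReal (T x) ≠ 0 := by simpa using hT
    rcases lt_or_ge x (Y.deg i) with hx | hx
    · have hb : Test.eval (.wlt 41 44) s'' = PMF.pure true := by
        simp [Test.eval, h.node, h.row.deg, hx]
      obtain ⟨q, rfl⟩ : ∃ q', q = q' + 1 := by
        refine Nat.exists_eq_succ_of_ne_zero fun h0 => ?_
        rw [h0, pow_zero] at hq
        omega
      have := sampleStep_wp hW hi hw h hx (g := k)
        (f := fun y => 17 * (q : ℝ≥0∞) + 8 + H y / ENNReal.ofReal (T y)) (by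
          intro y s3 hy h3
          refine hk (y, q) s3 ⟨h3, ?_⟩
          rw [pow_succ] at hq
          rcases hy with rfl | rfl <;> nlinarith [Nat.pow_pos (n := q) two_pos])
      have hn : T x = T (2 * x) + T (2 * x + 1) := hw.node x h.pos hx
      have hl : 0 ≤ T (2 * x) := hw.node_nonneg hi (x := 2 * x) (by omega) (by omega)
      have hr : 0 ≤ T (2 * x + 1) := hw.node_nonneg hi (x := 2 * x + 1) (by omega) (by omega)
      have hsum : ENNReal.ofReal (T (2 * x) / T x) + ENNReal.ofReal (T (2 * x + 1) / T x) = 1 := by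
        rw [← ENNReal.ofReal_add (div_nonneg hl hT.le) (div_nonneg hr hT.le), ← add_div, ← hn,
          div_self hT.ne', ENNReal.ofReal_one]
      have hcancel : ∀ y, ENNReal.ofReal (T y / T x) * (H y / ENNReal.ofReal (T y)) ≤
          H y / ENNReal.ofReal (T x) := by
        intro y
        rcases le_or_gt (T y) 0 with h0 | h0
        · rw [ENNReal.ofReal_of_nonpos (div_nonpos_of_nonpos_of_nonneg h0 hT.le)]
          simp
        · rw [ENNReal.ofReal_div_of_pos hT, div_eq_mul_inv, div_eq_mul_inv, div_eq_mul_inv]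
          calc _ = (ENNReal.ofReal (T y) * (ENNReal.ofReal (T y))⁻¹) * (H y *
                (ENNReal.ofReal (T x))⁻¹) := by ring
            _ = _ := by
              rw [ENNReal.mul_inv_cancel (by simpa using h0) ENNReal.ofReal_ne_top, one_mul]
            _ ≤ _ := le_rfl
      rw [hb]
      simp only [PMF.pure_apply, reduceCtorEq, if_false, if_true, zero_mul, one_mul, add_zero]
      calc _ ≤ 1 + (16 + (ENNReal.ofReal (T (2 * x) / T x) *
              (17 * (q : ℝ≥0∞) + 8 + H (2 * x) / ENNReal.ofReal (T (2 * x))) +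
            ENNReal.ofReal (T (2 * x + 1) / T x) *
              (17 * (q : ℝ≥0∞) + 8 + H (2 * x + 1) / ENNReal.ofReal (T (2 * x + 1))))) := by
            gcongr
        _ = 17 + (17 * (q : ℝ≥0∞) + 8) * (ENNReal.ofReal (T (2 * x) / T x) +
              ENNReal.ofReal (T (2 * x + 1) / T x)) +
              (ENNReal.ofReal (T (2 * x) / T x) * (H (2 * x) / ENNReal.ofReal (T (2 * x))) +
              ENNReal.ofReal (T (2 * x + 1) / T x) *
                (H (2 * x + 1) / ENNReal.ofReal (T (2 * x + 1)))) := by ring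
        _ ≤ 17 + (17 * (q : ℝ≥0∞) + 8) * 1 + (H (2 * x) / ENNReal.ofReal (T x) +
              H (2 * x + 1) / ENNReal.ofReal (T x)) := by
            rw [hsum]
            gcongr
            · exact hcancel _
            · exact hcancel _
        _ = 17 * ((q + 1 : ℕ) : ℝ≥0∞) + 8 + H x / ENNReal.ofReal (T x) := by
            rw [hH, heapExtend_node φ h.pos hx, ENNReal.add_div]
            push_cast
            ring
    · have hb : Test.eval (.wlt 41 44) s'' = PMF.pure false := by
        simp [Test.eval, h.node, h.row.deg, hx.not_gt]
      rw [hb]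
      simp only [PMF.pure_apply, reduceCtorEq, if_false, if_true, zero_mul, one_mul, zero_add]
      calc _ ≤ 1 + (7 + F (Y.col i x)) := by gcongr; exact hpost x s'' h hx
        _ = 8 + F (Y.col i x) := by rw [← add_assoc]; norm_num
        _ ≤ _ := by
          rw [hH, heapExtend_leaf φ hx, show φ x = F (Y.col i x) * ENNReal.ofReal (T x) from
            mul_comm _ _, ENNReal.mul_div_cancel_right hT' ENNReal.ofReal_ne_top]
          gcongr
          exact le_add_self
  have h1 := Spec.block hpre (ert W (.seq (.loop (.wlt 41 44) sampleStep) (block colOf)) g)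
    (1 + (17 * (Y.L : ℝ≥0∞) + 8 + H 1 / ENNReal.ofReal (T 1))) fun s' hs' => by
      simp only [ert]
      gcongr
      exact hloop s' hs'
  have hT1 : T 1 = S := hroot
  have hfin : H 1 / ENNReal.ofReal (T 1) =
      ∑ j ∈ Finset.range Y.n, ENNReal.ofReal (w j / S) * F j := by
    rw [hH1, hT1, ENNReal.div_eq_inv_mul, Finset.mul_sum]
    refine Finset.sum_congr rfl fun j _ => ?_
    rw [ENNReal.ofReal_div_of_pos hS0, ENNReal.div_eq_inv_mul, mul_assoc]
  rw [← hfin]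
  rw [sample, ert]
  refine (add_le_add_right h1 1).trans (le_of_eq ?_)
  simp [rowAddr]
  ring

/-- All rows of the memory hold binary trees, with the weights `A`. -/
def Layout.Rows (Y : Layout) (R : ℕ → ℝ) (A : ℕ → ℕ → ℝ) : Prop := ∀ i ≤ Y.n, Y.Row R i (A i)

/-- The memory on the way up the tree, when only the sum at node `x` has still to be corrected. -/
structure Ascent (Y : Layout) (i : ℕ) (w : ℕ → ℝ) (s : State) (x : ℕ) (s' : State) : Prop where
  row : AtRow Y i s s'
  node : s'.wreg 41 = x
  lt : x < Y.deg i
  arr : ∀ A ≠ 1, s'.rarr A = s.rarr A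
  sum : ∀ y, 1 ≤ y → y < Y.deg i → y ≠ x → s'.rarr 1 (2 * Y.st i + y) =
    s'.rarr 1 (2 * Y.st i + 2 * y) + s'.rarr 1 (2 * Y.st i + (2 * y + 1))
  leaf : ∀ y, Y.IsLeaf i y → s'.rarr 1 (2 * Y.st i + y) = w (Y.col i y)
  other : ∀ p, (∀ y, 1 ≤ y → y < 2 * Y.deg i → p ≠ 2 * Y.st i + y) →
    s'.rarr 1 p = s.rarr 1 p

/-- The memory `s'` after writing the weight `v` to column `j` of row `i` in memory `s`. -/
structure LeafSet (Y : Layout) (A : ℕ → ℕ → ℝ) (i j : ℕ) (v : ℝ) (s s' : State) : Prop where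
  keep : Keep 41 10 s s'
  warr : s'.warr = s.warr
  arr : ∀ B ≠ 1, s'.rarr B = s.rarr B
  rows : Layout.Rows Y (s'.rarr 1) (update A i (update (A i) j v))

theorem ascent_step {Y : Layout} {W : ℕ} (hW : Layout.Fits Y W) {s s' : State} {i x : ℕ}
    (hi : i ≤ Y.n) {w : ℕ → ℝ} (hs : Ascent Y i w s x s') (hx : 1 ≤ x) :
    wpBlock W [.wop .add 46 41 41, .wop .add 45 42 46, .rload 10 1 45,
      .wop .add 45 45 3, .rload 11 1 45, .radd 10 10 11, .wop .add 45 42 41, .rstore 1 45 10,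
      .wop .div 41 41 4] (Ascent Y i w s (x / 2)) s' := by
  have h1 := Y.st_add_deg hi
  have h2 := Y.st_le (i := i + 1) (by omega)
  have h3 := Y.deg_le hi
  have hlt := hs.lt
  unfold Layout.Fits at hW
  apply wpBlock_of_mk
  simp only [wpBlock, Instr.wp, hs.node, hs.row.base, WordOp.eval, update_apply, reduceIte,
      Nat.reduceEqDiff,
    hs.row.stat.one, hs.row.stat.two]
  refine ⟨by omega, by omega, by omega, by omega, by omega, ⟨⟨⟨?_, ?_, ?_, ?_, hs.row.stat.st,
      hs.row.stat.cl⟩, ⟨?_, ?_, ?_, ?_⟩, hs.row.warr, ?_, ?_, ?_⟩, ?_, ?_, ?_, ?_, ?_, ?_⟩⟩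
  all_goals try simp [update_apply, hs.row.stat.n, hs.row.stat.one, hs.row.stat.two,
      hs.row.stat.zero, hs.row.keep.wout, hs.row.keep.rout, hs.row.base, hs.row.st, hs.row.deg]
  · intro r hr
    have := hs.row.keep.wreg r hr
    grind
  · intro r hr
    have := hs.row.keep.rreg r hr
    grind
  · omega
  · intro A hA
    rw [if_neg hA, hs.arr A hA]
  · intro y hy1 hy2 hy3
    rw [if_neg (by omega : ¬ 2 * y = x), if_neg (by omega : ¬ 2 * y + 1 = x)]
    by_cases hyx : y = x
    · rw [if_pos hyx, hyx, two_mul x, add_assoc (2 * Y.st i)]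
    · rw [if_neg hyx, hs.sum y hy1 hy2 hyx]
  · intro y hy
    rw [if_neg (by have := hy.1; omega), hs.leaf y hy]
  · intro p hp
    rw [if_neg (hp x hx (by omega)), hs.other p hp]

/-- Once the leaf is overwritten, only the sum at its parent can be wrong, and correcting the sum at
`x` shifts the only possible error to `x / 2`. At 0, which is not a node, all sums are right. -/
theorem setLeaf_spec {Y : Layout} {W : ℕ} (hW : Layout.Fits Y W) {s : State} (hs : Stat Y s)
    {i x : ℕ} (hi : i ≤ Y.n) (h40 : s.wreg 40 = i) (h41 : s.wreg 41 = x) (hx : Y.IsLeaf i x)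
    {v : ℝ} (h12 : s.rreg 12 = v) (hv : 0 ≤ v) {A : ℕ → ℕ → ℝ} (hA : Layout.Rows Y (s.rarr 1) A) :
    Spec W setLeaf s (20 * Y.L + 19 : ℕ) (LeafSet Y A i (Y.col i x) v s) := by
  have h1 := Y.st_add_deg hi
  have h2 := Y.st_le (i := i + 1) (by omega)
  have h3 := Y.deg_le hi
  have hL := Y.n_le
  have hd := Y.deg_pos hi
  have hw := hA i hi
  obtain ⟨hx1, hx2⟩ := id hx
  set w := update (A i) (Y.col i x) v with hw'
  have hpre : wpBlock W (rowAddr ++ [.wop .add 45 42 41, .rstore 1 45 12, .wop .div 41 41 4])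
      (Ascent Y i w s (x / 2)) s := by
    refine rowAddr_wp hW hs hi h40 fun s' h1 h2 h3 h4 => ?_
    unfold Layout.Fits at hW
    apply wpBlock_of_mk
    simp only [wpBlock, Instr.wp, h41, h3, h12, h4, h1.base, WordOp.eval, update_apply,
        reduceIte, Nat.reduceEqDiff,
      h1.stat.two]
    refine ⟨by omega, by omega, ⟨⟨⟨?_, ?_, ?_, ?_, h1.stat.st,
      h1.stat.cl⟩, ⟨?_, ?_, ?_, ?_⟩, h1.warr, ?_, ?_, ?_⟩, ?_, ?_, ?_, ?_, ?_, ?_⟩⟩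
    all_goals try simp [update_apply, h1.stat.n, h1.stat.one, h1.stat.two, h1.stat.zero,
        h1.base, h1.st,
      h1.deg, h2, h1.keep.wout, h1.keep.rout]
    · intro r hr
      have := h1.keep.wreg r hr
      grind
    · omega
    · intro B hB hB'
      exact absurd hB' hB
    · intro y hy1 hy2 hy3
      rw [if_neg (by omega), if_neg (by omega), if_neg (by omega)]
      exact hw.node y hy1 hy2
    · intro y hy
      by_cases hyx : y = x
      · rw [if_pos hyx, hyx, hw', update_self]
      · rw [if_neg hyx, hw', update_of_ne fun h => hyx (Y.col_inj hi hy hx h), hw.leaf y hy]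
    · intro p hp
      exact fun h => absurd h (hp x (by omega) hx2)
  have hloop : ∀ s', Ascent Y i w s (x / 2) s' →
      Spec W (.loop (.wlt 5 41) (block [.wop .add 46 41 41, .wop .add 45 42 46, .rload 10 1 45,
      .wop .add 45 45 3, .rload 11 1 45, .radd 10 10 11, .wop .add 45 42 41, .rstore 1 45 10,
      .wop .div 41 41 4])) s' (20 * Y.L + 1 : ℕ) (Ascent Y i w s 0) := by
    intro s' hs'
    -- A leaf is below `2 * n ≤ 2 ^ (L + 1)`, so the parent is below `2 ^ L`, and each round halves
    -- it.
    refine Spec.loop_nat (fun q s' => ∃ x, x < 2 ^ q ∧ Ascent Y i w s x s')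
      (fun q => 20 * q + 1) ?_ (i := Y.L) ⟨x / 2, by omega, hs'⟩
    rintro q s'' ⟨y, hy, h⟩
    rcases Nat.eq_zero_or_pos y with rfl | hpos
    · exact Or.inl ⟨by simp [Test.holds, h.node], h, by omega⟩
    · refine Or.inr ⟨by simp [Test.holds, h.node, h.row.stat.zero, hpos], ?_⟩
      obtain ⟨q, rfl⟩ : ∃ q', q = q' + 1 := by
        refine Nat.exists_eq_succ_of_ne_zero fun h0 => ?_
        rw [h0, pow_zero] at hy
        omega
      exact ⟨q, by omega, 19, by omega, Spec.block
        (by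
          have := ascent_step hW hi h hpos
          refine (wpBlock_mono ?_ this)
          exact fun s3 h3 => ⟨y / 2, by omega, h3⟩)⟩
  refine (Spec.seq_nat (Spec.block hpre) hloop).mono_nat (by simp [rowAddr]; omega) fun s' h => ?_
  refine ⟨h.row.keep, h.row.warr, h.arr, fun j hj => ?_⟩
  by_cases hji : j = i
  · subst hji
    rw [update_self]
    refine ⟨fun y hy1 hy2 => h.sum y hy1 hy2 (by omega), h.leaf, fun k hk hkx => ?_,
      fun k hk => ?_⟩
    · rw [update_of_ne (fun h => hkx x hx h.symm), hw.zero k hk hkx]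
    · by_cases hkx : k = Y.col j x
      · rw [hkx, update_self]
        exact hv
      · rw [update_of_ne hkx]
        exact hw.nonneg k hk
  · rw [update_of_ne hji]
    refine (hA j hj).congr (fun y hy1 hy2 => h.other _ fun z hz1 hz2 heq => ?_) hj
    exact hji (Y.tree_disjoint hj hi hy1 hy2 hz1 hz2 heq).1

end RandomRAM

/-! ### Hitting times, paths and partial matchings -/

open Function

/-- The expected number of steps, counting at most `T`, of the walk that moves from row `u` to
column `v` with probability `p u v` and on to the row matched with `v`, and stops at the first free
column. A column `v` is free if `mt v = 0` and matched with `mt v - 1` otherwise. -/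
noncomputable def hitWithin (n : ℕ) (p : ℕ → ℕ → ℝ≥0∞) (mt : ℕ → ℕ) : ℕ → ℕ → ℝ≥0∞
  | 0, _ => 0
  | T + 1, u => 1 + ∑ v ∈ Finset.range n,
      p u v * if mt v = 0 then 0 else hitWithin n p mt T (mt v - 1)

/-- The expected number of steps of the walk. -/
noncomputable def hit (n : ℕ) (p : ℕ → ℕ → ℝ≥0∞) (mt : ℕ → ℕ) (u : ℕ) : ℝ≥0∞ :=
  ⨆ T, hitWithin n p mt T u

section Hit

variable {n : ℕ} {p : ℕ → ℕ → ℝ≥0∞} {mt : ℕ → ℕ}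

theorem hitWithin_le_succ (T u : ℕ) : hitWithin n p mt T u ≤ hitWithin n p mt (T + 1) u := by
  induction T generalizing u with
  | zero => simp [hitWithin]
  | succ T ih =>
    simp only [hitWithin]
    gcongr with v _
    split_ifs
    · exact le_rfl
    · exact ih _

theorem monotone_hitWithin (u : ℕ) : Monotone fun T => hitWithin n p mt T u :=
  monotone_nat_of_le_succ fun T => hitWithin_le_succ T u

/-- Monotone convergence moves the supremum out of the finite sum. This inequality of the recursion
is what the potential of the walk needs. -/
theorem le_hit (u : ℕ) :
    1 + ∑ v ∈ Finset.range n, p u v * (if mt v = 0 then 0 else hit n p mt (mt v - 1)) ≤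
      hit n p mt u := by
  have h : ∑ v ∈ Finset.range n, p u v * (if mt v = 0 then 0 else hit n p mt (mt v - 1)) =
      ⨆ T, ∑ v ∈ Finset.range n, p u v *
        (if mt v = 0 then 0 else hitWithin n p mt T (mt v - 1)) := by
    rw [← ENNReal.finsetSum_iSup_of_monotone]
    · refine Finset.sum_congr rfl fun v _ => ?_
      rw [← ENNReal.mul_iSup]
      congr 1
      split_ifs
      · simp
      · rfl
    · intro v T T' hT
      dsimp only
      gcongr
      split_ifs
      · exact le_rfl
      · exact monotone_hitWithin _ hT
  rw [h, ENNReal.add_iSup]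
  exact iSup_le fun T => le_iSup (fun T => hitWithin n p mt T u) (T + 1)

/-- Finiteness of the truncated times is what permits the cancellation in `sum_hit_le`; for `hit` it
is not known beforehand. -/
theorem hitWithin_le (hrow : ∀ u < n, ∑ v ∈ Finset.range n, p u v ≤ 1)
    (hlt : ∀ v < n, mt v ≠ 0 → mt v - 1 < n) (T : ℕ) {u : ℕ} (hu : u < n) :
    hitWithin n p mt T u ≤ T := by
  induction T generalizing u with
  | zero => simp [hitWithin]
  | succ T ih =>
    simp only [hitWithin]
    calc _ ≤ 1 + ∑ v ∈ Finset.range n, p u v * T := by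
          gcongr with v hv
          split_ifs with h
          · exact zero_le
          · exact ih (hlt v (Finset.mem_range.1 hv) h)
      _ ≤ 1 + 1 * (T : ℝ≥0∞) := by
          rw [← Finset.sum_mul]
          gcongr
          exact hrow u hu
      _ = _ := by push_cast; ring

/-- Sum the one-step recursion over all rows. Since columns of `p` sum to at most 1, the second term
is at most the sum over the mates of the matched columns, that is, over `R`. Cancelling the rows in
`R` leaves `n` for the free rows. The argument is run for truncated times, followed by the supremum.
-/
theorem sum_hit_le (hrow : ∀ u < n, ∑ v ∈ Finset.range n, p u v ≤ 1)
    (hcol : ∀ v < n, ∑ u ∈ Finset.range n, p u v ≤ 1)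
    (hlt : ∀ v < n, mt v ≠ 0 → mt v - 1 < n)
    (hinj : ∀ v < n, ∀ v' < n, mt v ≠ 0 → mt v = mt v' → v = v') {R : Finset ℕ}
    (hR : ∀ u, u ∈ R ↔ ∃ v < n, mt v = u + 1) :
    ∑ u ∈ Finset.range n \ R, hit n p mt u ≤ n := by
  have hRn : R ⊆ Finset.range n := by
    intro u hu
    obtain ⟨v, hv, h⟩ := (hR u).1 hu
    have := hlt v hv (by omega)
    rw [Finset.mem_range]
    omega
  have hT : ∀ T, ∑ u ∈ Finset.range n \ R, hitWithin n p mt (T + 1) u ≤ n := by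
    intro T
    have hfin : ∑ u ∈ R, hitWithin n p mt (T + 1) u ≠ ⊤ := by
      refine ENNReal.sum_ne_top.2 fun u hu => ne_top_of_le_ne_top (b := ((T + 1 : ℕ) : ℝ≥0∞))
        (ENNReal.natCast_ne_top _) (hitWithin_le hrow hlt _ (Finset.mem_range.1 (hRn hu)))
    rw [← ENNReal.add_le_add_iff_right hfin, Finset.sum_sdiff hRn]
    calc ∑ u ∈ Finset.range n, hitWithin n p mt (T + 1) u
        = n + ∑ v ∈ Finset.range n, (∑ u ∈ Finset.range n, p u v) *
            (if mt v = 0 then 0 else hitWithin n p mt T (mt v - 1)) := by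
          simp only [hitWithin, Finset.sum_add_distrib, Finset.sum_mul]
          rw [Finset.sum_comm]
          simp
      _ ≤ n + ∑ v ∈ Finset.range n, 1 *
            (if mt v = 0 then 0 else hitWithin n p mt T (mt v - 1)) := by
          gcongr with v hv
          exact hcol v (Finset.mem_range.1 hv)
      _ = n + ∑ v ∈ (Finset.range n).filter (fun v => mt v ≠ 0),
            hitWithin n p mt T (mt v - 1) := by
          simp only [one_mul, Finset.sum_filter, ne_eq, ite_not]
      _ = n + ∑ u ∈ R, hitWithin n p mt T u := by
          congr 1
          -- Passing from a matched column to its mate is a bijection onto `R`: injective by `hinj`,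
          -- surjective by `hR`.
          refine Finset.sum_nbij (fun v => mt v - 1) ?_ ?_ ?_ fun _ _ => rfl
          · intro v hv
            rw [Finset.mem_filter, Finset.mem_range] at hv
            exact (hR _).2 ⟨v, hv.1, by omega⟩
          · intro v hv v' hv' h
            rw [Finset.mem_coe, Finset.mem_filter, Finset.mem_range] at hv hv'
            exact hinj v hv.1 v' hv'.1 hv.2 (by simp only at h; omega)
          · intro u hu
            obtain ⟨v, hv, h⟩ := (hR u).1 hu
            exact ⟨v, by simp [hv, h], by simp [h]⟩
      _ ≤ n + ∑ u ∈ R, hitWithin n p mt (T + 1) u := by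
          gcongr with u _
          exact hitWithin_le_succ T u
  have h : ∑ u ∈ Finset.range n \ R, hit n p mt u =
      ⨆ T, ∑ u ∈ Finset.range n \ R, hitWithin n p mt T u :=
    ENNReal.finsetSum_iSup_of_monotone fun u => monotone_hitWithin u
  rw [h]
  refine iSup_le fun T => le_trans ?_ (hT T)
  gcongr with u _
  exact hitWithin_le_succ T u

end Hit

/-- Starting with `w`, following `nx` passes through the list `P` and ends with `w'`. Here the
number `u + 1` stands for `u`, and `0` for the end of the path. -/
def Seg (nx : ℕ → ℕ) : ℕ → List ℕ → ℕ → Prop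
  | w, [], w' => w = w'
  | w, u :: P, w' => w = u + 1 ∧ Seg nx (nx u) P w'

namespace Seg

variable {nx nx' : ℕ → ℕ} {w w' w'' : ℕ} {P Q : List ℕ}

theorem congr (h : ∀ a ∈ P, nx a = nx' a) (hs : Seg nx w P w') : Seg nx' w P w' := by
  induction P generalizing w with
  | nil => exact hs
  | cons u P ih =>
    refine ⟨hs.1, ?_⟩
    rw [← h u (by simp)]
    exact ih (fun a ha => h a (by simp [ha])) hs.2

theorem append_iff :
    Seg nx w (P ++ Q) w'' ↔ ∃ w', Seg nx w P w' ∧ Seg nx w' Q w'' := by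
  induction P generalizing w with
  | nil => simp [Seg]
  | cons u P ih =>
    simp only [List.cons_append, Seg, ih]
    constructor
    · rintro ⟨h, w', h1, h2⟩
      exact ⟨w', ⟨h, h1⟩, h2⟩
    · rintro ⟨w', ⟨h, h1⟩, h2⟩
      exact ⟨h, w', h1, h2⟩

/-- A node that led back to the start would close a cycle, but the path ends and has no repetition.
Applied to the rest of a path, it shows that no later row leaves through the same column as the row
before. -/
theorem next_ne (hs : Seg nx w P 0) (hP : P.Nodup) {a : ℕ} (ha : a ∈ P) : nx a ≠ w := by
  obtain ⟨X, Z, rfl⟩ := List.append_of_mem ha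
  obtain ⟨w', h1, h2, h3⟩ := append_iff.1 hs
  rcases Z with _ | ⟨b, Z⟩
  · have h3 : nx a = 0 := h3
    rcases X with _ | ⟨x, X⟩
    · have h1 : w = w' := h1
      omega
    · have := h1.1
      omega
  · have h3 : nx a = b + 1 := h3.1
    rcases X with _ | ⟨x, X⟩
    · have h1 : w = w' := h1
      simp at hP
      grind
    · have := h1.1
      simp at hP
      grind

end Seg

/-- The arrays `mt` and `rp` hold a partial matching that matches the set `R` of rows: a matched
column `v` has `mt v = u + 1` for the matched row `u`, and a matched row `u` has in `rp u` the
leaf of its column, which has positive weight in `A`. -/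
structure Layout.IsMatching (Y : Layout) (A : ℕ → ℕ → ℝ) (mt rp : ℕ → ℕ) (R : Finset ℕ) :
    Prop where
  row : ∀ v < Y.n, ∀ u, mt v = u + 1 →
    u < Y.n ∧ Y.IsLeaf u (rp u) ∧ Y.col u (rp u) = v ∧ 0 < A u v
  mem : ∀ u, u ∈ R ↔ ∃ v < Y.n, mt v = u + 1

namespace Layout.IsMatching

variable {Y : Layout} {A : ℕ → ℕ → ℝ} {mt rp : ℕ → ℕ} {R : Finset ℕ}

theorem lt (h : Y.IsMatching A mt rp R) : ∀ v < Y.n, mt v ≠ 0 → mt v - 1 < Y.n :=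
  fun v hv h0 => (h.row v hv (mt v - 1) (by omega)).1

theorem inj (h : Y.IsMatching A mt rp R) :
    ∀ v < Y.n, ∀ v' < Y.n, mt v ≠ 0 → mt v = mt v' → v = v' := by
  intro v hv v' hv' h0 heq
  rw [← (h.row v hv (mt v - 1) (by omega)).2.2.1, ← (h.row v' hv' (mt v - 1) (by omega)).2.2.1]

theorem subset (h : Y.IsMatching A mt rp R) : R ⊆ Finset.range Y.n := by
  intro u hu
  obtain ⟨v, hv, h'⟩ := (h.mem u).1 hu
  exact Finset.mem_range.2 (h.row v hv u h').1

/-- Matching the row `u` with the column `v`, whatever `v` was matched with before. -/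
theorem insert {u x v : ℕ} (h : Y.IsMatching A mt rp R) (hu : u < Y.n) (huR : u ∉ R)
    (hx : Y.IsLeaf u x) (hv : Y.col u x = v) (hA : 0 < A u v) :
    ∃ R', Y.IsMatching A (update mt v (u + 1)) (update rp u x) R' ∧
      ((mt v = 0 ∧ R' = Insert.insert u R) ∨ ∃ u', mt v = u' + 1 ∧ u' ∉ R' ∧
        Insert.insert u' R' = Insert.insert u R) := by
  have hvn : v < Y.n := hv ▸ Y.col_lt hu.le hx
  have hrow : ∀ v' < Y.n, ∀ u', update mt v (u + 1) v' = u' + 1 →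
      u' < Y.n ∧ Y.IsLeaf u' (update rp u x u') ∧ Y.col u' (update rp u x u') = v' ∧
        0 < A u' v' := by
    intro v' hv' u' hu'
    by_cases hvv : v' = v
    · subst hvv
      rw [update_self] at hu'
      obtain rfl : u = u' := by omega
      rw [update_self]
      exact ⟨hu, hx, hv, hA⟩
    · rw [update_of_ne hvv] at hu'
      have huu : u' ≠ u := by
        rintro rfl
        exact huR ((h.mem _).2 ⟨v', hv', hu'⟩)
      rw [update_of_ne huu]
      exact h.row v' hv' u' hu'
  rcases Nat.eq_zero_or_pos (mt v) with h0 | h0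
  · refine ⟨Insert.insert u R, ⟨hrow, fun u' => ?_⟩, Or.inl ⟨h0, rfl⟩⟩
    rw [Finset.mem_insert, h.mem]
    constructor
    · rintro (rfl | ⟨v', hv', hu'⟩)
      · exact ⟨v, hvn, by simp⟩
      · refine ⟨v', hv', ?_⟩
        rw [update_of_ne (by rintro rfl; omega), hu']
    · rintro ⟨v', hv', hu'⟩
      by_cases hvv : v' = v
      · subst hvv
        rw [update_self] at hu'
        left
        omega
      · rw [update_of_ne hvv] at hu'
        exact Or.inr ⟨v', hv', hu'⟩
  · obtain ⟨w, hw⟩ : ∃ w, mt v = w + 1 := ⟨mt v - 1, by omega⟩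
    have hwR : w ∈ R := (h.mem w).2 ⟨v, hvn, hw⟩
    have hwu : w ≠ u := by
      rintro rfl
      exact huR hwR
    -- Row `w` loses its column to `u`. Still `insert w R' = insert u R`, so the set to be matched
    -- in the end does not change while the displaced row waits.
    refine ⟨Insert.insert u (R.erase w), ⟨hrow, fun u' => ?_⟩, Or.inr ⟨w, hw, ?_, ?_⟩⟩
    · rw [Finset.mem_insert, Finset.mem_erase, h.mem]
      constructor
      · rintro (rfl | ⟨hne, v', hv', hu'⟩)
        · exact ⟨v, hvn, by simp⟩
        · refine ⟨v', hv', ?_⟩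
          rw [update_of_ne (by rintro rfl; omega), hu']
      · rintro ⟨v', hv', hu'⟩
        by_cases hvv : v' = v
        · subst hvv
          rw [update_self] at hu'
          left
          omega
        · rw [update_of_ne hvv] at hu'
          refine Or.inr ⟨?_, v', hv', hu'⟩
          rintro rfl
          exact hvv (h.inj v' hv' v hvn (by omega) (hu'.trans hw.symm))
    · simp [hwu]
    · rw [Finset.insert_comm, Finset.insert_erase hwR]

end Layout.IsMatching

/-! ### Augmenting along a random walk -/

namespace RandomRAM

open Function

/-- Move from the row `u`, where word register `20` holds `u + 1`, to a random column, remember the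
leaf in word array `3`, and move on to the row matched with the column. -/
def walkStep : Prog :=
  .seq (block [.wop .sub 40 20 3]) (.seq sample (block [.wstore 3 40 41, .wload 20 2 47]))

/-- Walk until a free column is reached. -/
def walk : Prog := .loop (.wlt 5 20) walkStep

/-- Match the row `u`, where word register `20` holds `u + 1`, with the column at which the walk
left `u` last, and move on to the row that was matched with this column. -/
def augmentStep : Prog :=
  block ([.wop .sub 40 20 3, .wload 41 3 40, .wstore 4 40 41] ++ (rowAddr ++ (colOf ++
    [.wload 46 2 47, .wstore 2 47 20, .wop .add 20 46 5])))

/-- Match the rows along the path that the walk has left. -/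
def augment : Prog := .loop (.wlt 5 20) augmentStep

/-- Match one more row. -/
def phase : Prog :=
  .seq (block [.wop .add 40 0 5]) <| .seq sample <|
  .seq (block [.wop .add 9 47 3, .wop .add 20 47 3, .rzero 12]) <| .seq setLeaf <|
  .seq walk <| .seq (block [.wop .add 20 9 5]) <| .seq augment (block [.wop .add 7 7 3])

/-- The column at which the walk left row `u` last. -/
def exitCol (Y : Layout) (s : State) (u : ℕ) : ℕ := Y.col u (s.warr 3 u)

/-- The rows in the list `P` have been left through entries of positive weight. -/
def Exits (Y : Layout) (A : ℕ → ℕ → ℝ) (s : State) (P : List ℕ) : Prop :=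
  ∀ a ∈ P, a < Y.n ∧ Y.IsLeaf a (s.warr 3 a) ∧ 0 < A a (exitCol Y s a)

/-- The memory during the walk from row `u₀`, where `P` is the path that is left of the walk after
cycles have been removed. -/
structure Walking (Y : Layout) (A : ℕ → ℕ → ℝ) (u₀ : ℕ) (s : State) (P : List ℕ) (s' : State) :
    Prop where
  stat : Stat Y s'
  keep : Keep 20 10 s s'
  rarr : s'.rarr = s.rarr
  warr : ∀ B ≠ 3, s'.warr B = s.warr B
  seg : Seg (fun u => s.warr 2 (exitCol Y s' u)) (u₀ + 1) P (s'.wreg 20)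
  nodup : P.Nodup
  notMem : ∀ u, s'.wreg 20 = u + 1 → u ∉ P ∧ u < Y.n
  exits : Exits Y A s' P

/-- Loop erasure comes for free, because only the last exit of each row is stored. When the walk
returns to a row of the path, the path is cut before that row; otherwise it grows by `u`. As each
step adds at most one row, a cost per row of the path can be charged to the steps of the walk. -/
theorem Walking.step {Y : Layout} {A : ℕ → ℕ → ℝ} {rp : ℕ → ℕ} {R : Finset ℕ}
    {u₀ u x : ℕ} {s s' s'' : State} {P : List ℕ} (hm : Y.IsMatching A (s.warr 2) rp R)
    (h : Walking Y A u₀ s P s') (hu : s'.wreg 20 = u + 1)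
    (hx : Y.IsLeaf u x) (hA : 0 < A u (Y.col u x))
    (hstat : Stat Y s'') (hkeep : Keep 20 10 s s'') (hrarr : s''.rarr = s'.rarr)
    (hwarr : ∀ B ≠ 3, s''.warr B = s'.warr B) (h3 : s''.warr 3 = update (s'.warr 3) u x)
    (h20 : s''.wreg 20 = s.warr 2 (Y.col u x)) :
    ∃ P', P'.length ≤ P.length + 1 ∧ Walking Y A u₀ s P' s'' := by
  obtain ⟨huP, hun⟩ := h.notMem u hu
  have hex : ∀ a ≠ u, exitCol Y s'' a = exitCol Y s' a := by
    intro a ha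
    rw [exitCol, exitCol, h3, update_of_ne ha]
  have hexu : exitCol Y s'' u = Y.col u x := by rw [exitCol, h3, update_self]
  have hneP : ∀ a ∈ P, a ≠ u := fun a ha hau => huP (hau ▸ ha)
  have hseg : Seg (fun u => s.warr 2 (exitCol Y s'' u)) (u₀ + 1) (P ++ [u]) (s''.wreg 20) := by
    refine Seg.append_iff.2 ⟨u + 1, ?_, rfl, ?_⟩
    · rw [← hu]
      exact h.seg.congr fun a ha => by simp only [hex a (hneP a ha)]
    · simp only [hexu]
      exact h20.symm
  have hnodup : (P ++ [u]).Nodup := by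
    rw [List.nodup_append]
    refine ⟨h.nodup, by simp, ?_⟩
    rintro a ha b hb rfl
    rw [List.mem_singleton] at hb
    exact hneP a ha hb
  have hexits : Exits Y A s'' (P ++ [u]) := by
    intro a ha
    by_cases hau : a = u
    · subst hau
      rw [hexu, h3, update_self]
      exact ⟨hun, hx, hA⟩
    · rw [hex a hau, h3, update_of_ne hau]
      refine h.exits a ?_
      simpa [hau] using ha
  -- A return to a row of the path, possibly to `u` itself: `X` is the part before that row, and `Z`
  -- together with the row is the erased cycle.
  by_cases hmem : ∃ u', s''.wreg 20 = u' + 1 ∧ u' ∈ P ++ [u]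
  · obtain ⟨u', h20', hu'⟩ := hmem
    obtain ⟨X, Z, hXZ⟩ := List.append_of_mem hu'
    rw [hXZ] at hseg hnodup hexits
    have hlen : X.length + (Z.length + 1) = P.length + 1 := by
      simpa using (congrArg List.length hXZ).symm
    obtain ⟨w, h1, h2, -⟩ := Seg.append_iff.1 hseg
    refine ⟨X, by omega, hstat, hkeep, hrarr.trans h.rarr,
      fun B hB => (hwarr B hB).trans (h.warr B hB), by rw [h20', ← h2]; exact h1,
      hnodup.of_append_left, fun a ha => ?_, fun a ha => hexits a (by simp [ha])⟩
    obtain rfl : a = u' := by omega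
    refine ⟨fun haX => ?_, (hexits a (by simp)).1⟩
    rw [List.nodup_append] at hnodup
    exact hnodup.2.2 a haX a (by simp) rfl
  · refine ⟨P ++ [u], by simp, hstat, hkeep, hrarr.trans h.rarr,
      fun B hB => (hwarr B hB).trans (h.warr B hB), hseg, hnodup, fun a ha => ⟨fun haP =>
        hmem ⟨a, ha, haP⟩, ?_⟩, hexits⟩
    exact (hm.row _ (Y.col_lt hun.le hx) a (h20.symm.trans ha)).1

/-- The potential is `K` times the hitting time of the current row plus `D` times the length of the
current path. Here `D` is the cost per row of the later augmentation, prepaid inside `K` by the step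
that lengthens the path; the remainder of `K` is one step of the walk. -/
theorem walk_ert_le {Y : Layout} {W : ℕ} (hW : Layout.Fits Y W) {A : ℕ → ℕ → ℝ} {S : ℝ}
    (hS : 0 < S) (hrow : ∀ i < Y.n, ∑ j ∈ Finset.range Y.n, A i j = S) {rp : ℕ → ℕ} {R : Finset ℕ}
    {u₀ : ℕ} (hu₀ : u₀ < Y.n) {s : State} (hs : Stat Y s) (hA : ∀ i < Y.n, Y.Row (s.rarr 1) i (A i))
    (hm : Y.IsMatching A (s.warr 2) rp R) (h20 : s.wreg 20 = u₀ + 1) {g : State → ℝ≥0∞} {b : ℝ≥0∞}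
    {D : ℕ} (hg : ∀ P s', Walking Y A u₀ s P s' → s'.wreg 20 = 0 → g s' ≤ D * (P.length : ℕ) + b) :
    ert W walk g s ≤ (17 * Y.L + 34 + D : ℕ) *
      hit Y.n (fun u v => ENNReal.ofReal (A u v / S)) (s.warr 2) u₀ + (1 + b) := by
  set h := hit Y.n (fun u v => ENNReal.ofReal (A u v / S)) (s.warr 2) with hh
  set K : ℝ≥0∞ := ((17 * Y.L + 34 + D : ℕ) : ℝ≥0∞) with hK
  refine (ert_loop_le_of_ghost (γ := List ℕ × ℕ)
    (fun a s' => Walking Y A u₀ s a.1 s' ∧ s'.wreg 20 = a.2)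
    (fun a => K * (if a.2 = 0 then 0 else h (a.2 - 1)) + (D * (a.1.length : ℕ) + (1 + b))) ?_
    (a := ([], u₀ + 1)) ?_).trans (le_of_eq (by simp))
  · rintro ⟨P, w⟩ s' ⟨hP, hw⟩ k hk
    simp only at hP hw ⊢
    rcases Nat.eq_zero_or_pos w with rfl | hpos
    · have hb : Test.eval (.wlt 5 20) s' = PMF.pure false := by
        simp [Test.eval, hw]
      rw [hb]
      simp only [PMF.pure_apply, reduceCtorEq, if_false, if_true, zero_mul, one_mul, zero_add,
        mul_zero]
      calc _ ≤ 1 + (D * (P.length : ℕ) + b) := by gcongr; exact hg P s' hP hw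
        _ = _ := by ring
    · have hb : Test.eval (.wlt 5 20) s' = PMF.pure true := by
        simp [Test.eval, hw, hP.stat.zero, hpos]
      rw [hb, if_neg hpos.ne']
      simp only [PMF.pure_apply, reduceCtorEq, if_false, if_true, zero_mul, one_mul, add_zero]
      obtain ⟨u, rfl⟩ : ∃ u, w = u + 1 := ⟨w - 1, by omega⟩
      obtain ⟨huP, hun⟩ := hP.notMem u hw
      set F : ℕ → ℝ≥0∞ := fun v => 5 + (K * (if s.warr 2 v = 0 then 0 else h (s.warr 2 v - 1)) +
        (D * (P.length + 1 : ℕ) + (1 + b))) with hF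
      have hsample : ∀ s₁, Stat Y s₁ → Keep 20 10 s' s₁ → s₁.warr = s'.warr → s₁.rarr = s'.rarr →
          s₁.wreg 40 = u → ert W (.seq sample (block [.wstore 3 40 41, .wload 20 2 47])) k s₁ ≤
          1 + ((17 * Y.L + 23 : ℕ) +
            ∑ v ∈ Finset.range Y.n, ENNReal.ofReal (A u v / S) * F v) := by
        intro s₁ h₁ hk₁ hwa hra h40
        simp only [ert]
        gcongr
        refine sample_ert_le hW h₁ hun.le h40 (by rw [hra, hP.rarr]; exact hA u hun)
          (hrow u hun) hS fun x s₂ hx hAx h₂ => ?_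
        have hv := Y.col_lt hun.le hx
        refine ert_block_le (b := K * (if s.warr 2 (Y.col u x) = 0 then 0 else
          h (s.warr 2 (Y.col u x) - 1)) + (D * (P.length + 1 : ℕ) + (1 + b))) ?_
        have hmt : s₂.warr 2 = s.warr 2 := by
          rw [h₂.warr, hwa, hP.warr 2 (by norm_num)]
        have hbound : s.warr 2 (Y.col u x) ≤ W := by
          unfold Layout.Fits at hW
          have := hm.lt _ hv
          omega
        apply wpBlock_of_mk
        simp only [wpBlock, Instr.wp, h₂.keep.wreg 40 (by norm_num), h40, h₂.node, h₂.col,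
          update_apply, Nat.reduceEqDiff, reduceIte, hmt]
        refine ⟨hbound, ?_⟩
        obtain ⟨P', hlen, hP'⟩ := hP.step (s'' := ⟨update s₂.wreg 20 (s.warr 2 (Y.col u x)),
            s₂.rreg, update s₂.warr 3 (update (s₂.warr 3) u x), s₂.rarr, s₂.wout, s₂.rout⟩)
          hm hw hx hAx (by
            have := h₁.of_keep h₂.keep (by norm_num) (congrFun h₂.warr 0) (congrFun h₂.warr 1)
            refine ⟨?_, ?_, ?_, ?_, ?_, ?_⟩ <;>
              simp [this.n, this.one, this.two, this.zero, this.st, this.cl]) (by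
            have := (hP.keep.trans hk₁ le_rfl le_rfl).trans h₂.keep (by norm_num) le_rfl
            refine ⟨fun r hr => ?_, this.rreg, this.wout, this.rout⟩
            simp only
            rw [update_of_ne (by omega), this.wreg r hr]) (h₂.rarr.trans hra) (by
            intro B hB
            simp only
            rw [update_of_ne hB, h₂.warr, hwa]) (by simp [h₂.warr, hwa]) (by simp)
        refine (hk (P', s.warr 2 (Y.col u x)) _ ⟨hP', by simp⟩).trans ?_
        exact add_le_add le_rfl (add_le_add (mul_le_mul' le_rfl (by exact_mod_cast hlen)) le_rfl)
      have hblock : ert W walkStep k s' ≤ 1 + (3 + (1 + ((17 * Y.L + 23 : ℕ) +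
            ∑ v ∈ Finset.range Y.n, ENNReal.ofReal (A u v / S) * F v))) := by
        rw [walkStep, ert_seq]
        gcongr
        refine ert_block_le ?_
        apply wpBlock_of_mk
        simp only [wpBlock, Instr.wp, hw, hP.stat.one, WordOp.eval, Nat.add_sub_cancel]
        refine ⟨by unfold Layout.Fits at hW; omega, hsample _ ?_ ⟨fun r hr => ?_, fun _ _ => rfl,
          rfl, rfl⟩ rfl rfl (by simp)⟩
        · refine ⟨?_, ?_, ?_, ?_, ?_, ?_⟩ <;> simp [hP.stat.n, hP.stat.one, hP.stat.two,
            hP.stat.zero, hP.stat.st, hP.stat.cl]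
        · simp only
          rw [update_of_ne (by omega)]
      have hsum : ∑ v ∈ Finset.range Y.n, ENNReal.ofReal (A u v / S) = 1 := by
        rw [← ENNReal.ofReal_sum_of_nonneg fun v hv => div_nonneg
          ((hA u hun).nonneg v (Finset.mem_range.1 hv)) hS.le, ← Finset.sum_div, hrow u hun,
          div_self hS.ne', ENNReal.ofReal_one]
      have hFsum : ∑ v ∈ Finset.range Y.n, ENNReal.ofReal (A u v / S) * F v =
          (5 + (D * (P.length + 1 : ℕ) + (1 + b))) + K * ∑ v ∈ Finset.range Y.n,
            ENNReal.ofReal (A u v / S) * (if s.warr 2 v = 0 then 0 else h (s.warr 2 v - 1)) := by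
        rw [Finset.mul_sum, ← one_mul (5 + (_ : ℝ≥0∞))]
        nth_rw 1 [← hsum]
        rw [Finset.sum_mul, ← Finset.sum_add_distrib]
        refine Finset.sum_congr rfl fun v _ => ?_
        rw [hF]
        ring
      calc 1 + ert W walkStep k s' ≤ 1 + (1 + (3 + (1 + ((17 * Y.L + 23 : ℕ) +
            ∑ v ∈ Finset.range Y.n, ENNReal.ofReal (A u v / S) * F v)))) := by gcongr
        _ = K * (1 + ∑ v ∈ Finset.range Y.n, ENNReal.ofReal (A u v / S) *
              (if s.warr 2 v = 0 then 0 else h (s.warr 2 v - 1))) +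
              (D * (P.length : ℕ) + (1 + b)) := by
            rw [hFsum, hK]
            push_cast
            ring
        _ ≤ K * h u + (D * (P.length : ℕ) + (1 + b)) := by
            gcongr
            exact le_hit u
        _ = _ := by simp
  · refine ⟨⟨hs, Keep.refl _ _ _, rfl, fun _ _ => rfl, h20.symm, List.nodup_nil, ?_, ?_⟩, h20⟩
    · intro u hu
      refine ⟨by simp, ?_⟩
      omega
    · intro a ha
      simp at ha

/-- The memory while the rows along the path are matched; `w` is the content of word register `20`,
and `R` is the set of the rows that are matched in the end. -/
structure Augmenting (Y : Layout) (A : ℕ → ℕ → ℝ) (R : Finset ℕ) (s : State) (P : List ℕ) (w : ℕ)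
    (R' : Finset ℕ) (s' : State) : Prop where
  stat : Stat Y s'
  keep : Keep 20 10 s s'
  rarr : s'.rarr = s.rarr
  reg : s'.wreg 20 = w
  seg : Seg (fun u => s'.warr 2 (exitCol Y s' u)) w P 0
  nodup : P.Nodup
  exits : Exits Y A s' P
  matching : Y.IsMatching A (s'.warr 2) (s'.warr 4) R'
  rows : (w = 0 ∧ R' = R) ∨ ∃ u, w = u + 1 ∧ u ∉ R' ∧ insert u R' = R

/-- Row `u` takes the column `v` at which the walk left it, and the old mate of `v` is the next row
of the path. The pending row together with the matched rows always makes up `R`. -/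
theorem augmentStep_spec {Y : Layout} {W : ℕ} (hW : Layout.Fits Y W) {A : ℕ → ℕ → ℝ}
    {R R' : Finset ℕ} {s s' : State} {P : List ℕ} {u : ℕ}
    (h : Augmenting Y A R s (u :: P) (u + 1) R' s') :
    Spec W augmentStep s' (29 : ℕ) fun s'' => ∃ w R', Augmenting Y A R s P w R' s'' := by
  obtain ⟨hu, hx, hAu⟩ := h.exits u (by simp)
  have hnodup := List.nodup_cons.1 h.nodup
  obtain ⟨huR, hins⟩ : u ∉ R' ∧ insert u R' = R := by
    rcases h.rows with ⟨h0, -⟩ | ⟨u', hu', h1, h2⟩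
    · omega
    · obtain rfl : u = u' := by omega
      exact ⟨h1, h2⟩
  set x := s'.warr 3 u with hxdef
  have hv : Y.col u x = exitCol Y s' u := rfl
  set v := exitCol Y s' u with hvdef
  have hvn : v < Y.n := Y.col_lt hu.le hx
  have hd := Y.deg_le hu.le
  have hmv : s'.warr 2 v ≤ Y.n := by
    have := h.matching.lt v hvn
    omega
  have hwp : wpBlock W ([.wop .sub 40 20 3, .wload 41 3 40, .wstore 4 40 41] ++ (rowAddr ++
      (colOf ++ [.wload 46 2 47, .wstore 2 47 20, .wop .add 20 46 5])))
      (fun s'' => ∃ w R', Augmenting Y A R s P w R' s'') s' := by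
    have hW' := hW
    unfold Layout.Fits at hW'
    have hx2 := hx.2
    rw [List.cons_append, List.cons_append, List.cons_append, List.nil_append]
    apply wpBlock_of_mk
    rw [wpBlock, wpBlock, wpBlock]
    simp only [Instr.wp, h.reg, h.stat.one, WordOp.eval, Nat.add_sub_cancel, update_apply,
      Nat.reduceEqDiff, reduceIte, ← hxdef]
    refine ⟨by omega, by omega, ?_⟩
    refine rowAddr_wp hW (i := u) ?_ hu.le (by simp) fun s₁ h₁ hra hrr h41 => ?_
    · refine ⟨?_, ?_, ?_, ?_, ?_, ?_⟩ <;>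
        simp [h.stat.n, h.stat.one, h.stat.two, h.stat.zero, h.stat.st, h.stat.cl]
    refine colOf_wp hW h₁ hu.le hx (by rw [h41]; simp) fun s₂ h₂ hra₂ hrr₂ h41₂ h47₂ => ?_
    have hk : ∀ r < 40, s₂.wreg r = s'.wreg r := by
      intro r hr
      rw [h₂.keep.wreg r (by omega)]
      simp only
      rw [update_of_ne (by omega), update_of_ne (by omega)]
    have hwa : s₂.warr = update s'.warr 4 (update (s'.warr 4) u x) := h₂.warr
    have h2 : s₂.warr 2 = s'.warr 2 := by rw [hwa, update_of_ne (by norm_num)]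
    have h4 : s₂.warr 4 = update (s'.warr 4) u x := by rw [hwa, update_self]
    have h3 : s₂.warr 3 = s'.warr 3 := by rw [hwa, update_of_ne (by norm_num)]
    apply wpBlock_of_mk
    simp only [wpBlock, Instr.wp, h47₂, hv, hk 20 (by norm_num), h.reg, h2, WordOp.eval,
      update_apply, Nat.reduceEqDiff, reduceIte, h₂.stat.zero, add_zero]
    refine ⟨by omega, by omega, s'.warr 2 v, ?_⟩
    obtain ⟨R'', hm, hR''⟩ := h.matching.insert hu huR hx hv hAu
    refine ⟨R'', ⟨?_, ⟨?_, ?_, ?_, ?_⟩, ?_, ?_, ?_, hnodup.2, ?_, ?_, ?_⟩⟩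
    · refine ⟨?_, ?_, ?_, ?_, ?_, ?_⟩ <;>
        simp [h₂.stat.n, h₂.stat.one, h₂.stat.two, h₂.stat.zero, h₂.stat.st, h₂.stat.cl]
    · intro r hr
      simp only
      rw [update_of_ne (by omega), update_of_ne (by omega), hk r (by omega), h.keep.wreg r hr]
    · intro r hr
      simp only
      rw [hrr₂, hrr]
      exact h.keep.rreg r hr
    · exact h₂.keep.wout.trans h.keep.wout
    · exact h₂.keep.rout.trans h.keep.rout
    · exact (hra₂.trans hra).trans h.rarr
    · simp
    · refine h.seg.2.congr fun a ha => ?_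
      -- Overwriting the mate of `v` must not disturb the rest of the path. If a later row `a` also
      -- left through `v`, it would lead back to the first of these rows.
      have hne : exitCol Y s' a ≠ v := by
        intro heq
        refine h.seg.2.next_ne hnodup.2 ha ?_
        simp only [heq, ← hvdef]
      simp only [exitCol, update_self, update_of_ne (show (3 : ℕ) ≠ 2 by norm_num), h3]
      exact (update_of_ne hne _ _).symm
    · intro a ha
      have := h.exits a (by simp [ha])
      simpa only [exitCol, update_of_ne (show (3 : ℕ) ≠ 2 by norm_num), h3] using this
    · simpa [h4] using hm
    · rcases hR'' with ⟨h0, h1⟩ | ⟨u', h0, h1, h2⟩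
      · exact Or.inl ⟨h0, h1.trans hins⟩
      · exact Or.inr ⟨u', h0, h1, h2.trans hins⟩
  exact Spec.block hwp

/-- A round costs 29 steps plus the test of the loop. The path ends with a free column, and then no
row is pending. -/
theorem augment_spec {Y : Layout} {W : ℕ} (hW : Layout.Fits Y W) {A : ℕ → ℕ → ℝ}
    {R R' : Finset ℕ} {s s' : State} {P : List ℕ} {w : ℕ} (h : Augmenting Y A R s P w R' s') :
    Spec W augment s' (30 * P.length + 1 : ℕ)
      (fun s'' => Augmenting Y A R s [] 0 R s'') := by
  refine Spec.loop_nat (fun q s' => ∃ P w R', P.length = q ∧ Augmenting Y A R s P w R' s')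
    (fun q => 30 * q + 1) ?_ ⟨P, w, R', rfl, h⟩
  rintro q s₁ ⟨P, w, R', hlen, h⟩
  rcases P with _ | ⟨u, P⟩
  · obtain rfl : w = 0 := h.seg
    obtain ⟨-, rfl⟩ : 0 = 0 ∧ R' = R := h.rows.resolve_right fun ⟨u, hu, _⟩ => by omega
    exact Or.inl ⟨by simp [Test.holds, h.reg], h, by omega⟩
  · obtain rfl := h.seg.1
    refine Or.inr ⟨by simp [Test.holds, h.reg, h.stat.zero], P.length, ?_, 29, ?_, ?_⟩
    · simp at hlen
      omega
    · simp at hlen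
      omega
    · refine (augmentStep_spec hW h).mono_nat le_rfl ?_
      rintro s₂ ⟨w, R', h'⟩
      exact ⟨P, w, R', rfl, h'⟩

/-- The weights of the rows outside `R`. -/
noncomputable def freeWeight (R : Finset ℕ) (u : ℕ) : ℝ := if u ∈ R then 0 else 1

/-- The memory when the rows in `R` are matched. -/
structure Matched (Y : Layout) (A : ℕ → ℕ → ℝ) (R : Finset ℕ) (s : State) : Prop where
  stat : Stat Y s
  rows : Layout.Rows Y (s.rarr 1) (update A Y.n (freeWeight R))
  matching : Y.IsMatching A (s.warr 2) (s.warr 4) R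

/-- The rows and columns of `A` have sum `S`. -/
structure Layout.Balanced (Y : Layout) (A : ℕ → ℕ → ℝ) (S : ℝ) : Prop where
  pos : 0 < S
  nonneg : ∀ i < Y.n, ∀ j < Y.n, 0 ≤ A i j
  row : ∀ i < Y.n, ∑ j ∈ Finset.range Y.n, A i j = S
  col : ∀ j < Y.n, ∑ i ∈ Finset.range Y.n, A i j = S

theorem sum_freeWeight_mul (n : ℕ) (R : Finset ℕ) (f : ℕ → ℝ) :
    ∑ u ∈ Finset.range n, freeWeight R u * f u = ∑ u ∈ Finset.range n \ R, f u := by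
  rw [Finset.sdiff_eq_filter, Finset.sum_filter]
  refine Finset.sum_congr rfl fun u _ => ?_
  by_cases h : u ∈ R <;> simp [freeWeight, h]

/-- The expected number of steps of the walk from a random free row. -/
theorem sum_freeWeight_hit_le {Y : Layout} {A : ℕ → ℕ → ℝ} {S : ℝ} (hA : Layout.Balanced Y A S)
    {mt rp : ℕ → ℕ} {R : Finset ℕ} (hm : Y.IsMatching A mt rp R) {q : ℕ} (hq : 0 < q) :
    ∑ u ∈ Finset.range Y.n, ENNReal.ofReal (freeWeight R u / q) *
      hit Y.n (fun u v => ENNReal.ofReal (A u v / S)) mt u ≤ (Y.n : ℝ≥0∞) / q := by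
  have h := sum_hit_le (n := Y.n) (p := fun u v => ENNReal.ofReal (A u v / S)) (mt := mt)
    (fun u hu => by
      rw [← ENNReal.ofReal_sum_of_nonneg fun v hv => div_nonneg
        (hA.nonneg u hu v (Finset.mem_range.1 hv)) hA.pos.le, ← Finset.sum_div, hA.row u hu,
        div_self hA.pos.ne', ENNReal.ofReal_one])
    (fun v hv => by
      rw [← ENNReal.ofReal_sum_of_nonneg fun u hu => div_nonneg
        (hA.nonneg u (Finset.mem_range.1 hu) v hv) hA.pos.le, ← Finset.sum_div, hA.col v hv,
        div_self hA.pos.ne', ENNReal.ofReal_one])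
    hm.lt hm.inj hm.mem
  refine le_trans (le_of_eq ?_) (ENNReal.div_le_div_right h q)
  rw [ENNReal.div_eq_inv_mul, Finset.mul_sum, Finset.sdiff_eq_filter, Finset.sum_filter]
  refine Finset.sum_congr rfl fun u _ => ?_
  by_cases hu : u ∈ R
  · simp [freeWeight, hu]
  · simp only [freeWeight, hu, if_false, not_false_eq_true, if_true]
    rw [one_div, ENNReal.ofReal_inv_of_pos (by exact_mod_cast hq), ENNReal.ofReal_natCast]

/-- The set of matched rows only gains the sampled free row, whose weight in row `n` is set to 0.
The expected cost depends on that row through its hitting time, whose average over the free rows is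
at most the number of rows divided by the number of free rows. -/
theorem phase_spec {Y : Layout} {W : ℕ} (hW : Layout.Fits Y W) {A : ℕ → ℕ → ℝ} {S : ℝ}
    (hA : Layout.Balanced Y A S) {R : Finset ℕ} (hR : R.card < Y.n) {s : State}
        (hs : Matched Y A R s)
    (h7 : s.wreg 7 = R.card) :
    Spec W phase s ((37 * Y.L + 67 : ℕ) + (17 * Y.L + 64 : ℕ) * ((Y.n : ℝ≥0∞) / (Y.n - R.card : ℕ)))
      (fun s' => Keep 7 10 s s' ∧ ∃ R' : Finset ℕ, R'.card = R.card + 1 ∧ Matched Y A R' s' ∧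
        s'.wreg 7 = R'.card) := by
  intro g b hg
  have hW' := hW
  unfold Layout.Fits at hW'
  have hRn := hs.matching.subset
  set q := Y.n - R.card with hq
  have hqpos : 0 < q := by omega
  have hsum : ∑ j ∈ Finset.range Y.n, freeWeight R j = q := by
    have := sum_freeWeight_mul Y.n R fun _ => 1
    simp only [mul_one] at this
    rw [this, Finset.sum_const, Finset.card_sdiff_of_subset hRn, Finset.card_range]
    simp [hq]
  set K : ℝ≥0∞ := ((17 * Y.L + 64 : ℕ) : ℝ≥0∞) with hK
  set h := hit Y.n (fun u v => ENNReal.ofReal (A u v / S)) (s.warr 2) with hh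
  have hAn : ∀ R' : Finset ℕ, ∀ u < Y.n, update A Y.n (freeWeight R') u = A u :=
    fun R' u hu => update_of_ne hu.ne _ _
  have hafter : ∀ u s₄, u < Y.n → u ∉ R → Stat Y s₄ → Keep 7 10 s s₄ → s₄.wreg 7 = s.wreg 7 →
      s₄.wreg 9 = u + 1 → s₄.warr 2 = s.warr 2 → s₄.warr 4 = s.warr 4 →
      Layout.Rows Y (s₄.rarr 1) (update A Y.n (freeWeight (insert u R))) →
      ∀ P s₅, Walking Y A u s₄ P s₅ → s₅.wreg 20 = 0 →
      ert W (.seq (block [.wop .add 20 9 5]) <| .seq augment (block [.wop .add 7 7 3])) g s₅ ≤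
        (30 : ℕ) * (P.length : ℕ) + (9 + b) := by
    intro u s₄ hu huR hst hk h7' h9 h2 h4 hrows P s₅ hP h20
    have hu9 : s₅.wreg 9 = u + 1 := by rw [hP.keep.wreg 9 (by norm_num), h9]
    -- The walk has brought register 20 to 0; register 9 still names the start, from which the path
    -- is now followed a second time.
    have hA1 : wpBlock W [.wop .add 20 9 5] (Augmenting Y A (insert u R) s₅ P (u + 1) R) s₅ := by
      apply wpBlock_of_mk
      simp only [wpBlock, Instr.wp, WordOp.eval, hP.stat.zero, hu9, add_zero]
      refine ⟨by omega, ⟨?_, ⟨?_, fun _ _ => rfl, rfl, rfl⟩, rfl, by simp, ?_, hP.nodup, hP.exits,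
        ?_, Or.inr ⟨u, rfl, huR, rfl⟩⟩⟩
      · refine ⟨?_, ?_, ?_, ?_, ?_, ?_⟩ <;> simp [hP.stat.n, hP.stat.one, hP.stat.two,
          hP.stat.zero, hP.stat.st, hP.stat.cl]
      · intro r hr
        simp only
        rw [update_of_ne (by omega)]
      · have := hP.seg
        rw [h20] at this
        exact this.congr fun a _ => congrFun (hP.warr 2 (by norm_num)).symm _
      · simpa only [hP.warr 2 (by norm_num), hP.warr 4 (by norm_num), h2, h4] using hs.matching
    have hspec := Spec.seq_nat (Spec.block hA1) fun s' hs' => Spec.seq_nat (augment_spec hW hs')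
      (c₂ := 3) (q := block [.wop .add 7 7 3]) (Q := fun s' => Keep 7 10 s s' ∧
        ∃ R' : Finset ℕ, R'.card = R.card + 1 ∧ Matched Y A R' s' ∧ s'.wreg 7 = R'.card)
        fun s₆ h₆ => by
      have hcard := Finset.card_insert_of_notMem huR
      refine Spec.block (l := [.wop .add 7 7 3]) ?_
      have e7 : s₆.wreg 7 = R.card := by
        rw [h₆.keep.wreg 7 (by norm_num), hP.keep.wreg 7 (by norm_num), h7', h7]
      apply wpBlock_of_mk
      simp only [wpBlock, Instr.wp, WordOp.eval, e7, h₆.stat.one]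
      have hkk := hk.trans (hP.keep.trans h₆.keep le_rfl le_rfl) (by norm_num) le_rfl
      refine ⟨by omega, ⟨⟨fun r hr => ?_, hkk.rreg, hkk.wout, hkk.rout⟩, insert u R, hcard,
        ⟨?_, ?_, h₆.matching⟩, by simp [hcard]⟩⟩
      · simp only
        rw [update_of_ne (by omega), hkk.wreg r hr]
      · refine ⟨?_, ?_, ?_, ?_, ?_, ?_⟩ <;> simp [h₆.stat.n, h₆.stat.one, h₆.stat.two,
          h₆.stat.zero, h₆.stat.st, h₆.stat.cl]
      · simp only [h₆.rarr, hP.rarr]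
        exact hrows
    refine (hspec g b hg).trans (le_of_eq ?_)
    simp
    ring
  have hrest : ∀ x s₂, Y.IsLeaf Y.n x → 0 < freeWeight R (Y.col Y.n x) → Stat Y s₂ →
      Keep 7 10 s s₂ → s₂.wreg 7 = s.wreg 7 → s₂.warr = s.warr → s₂.rarr = s.rarr →
      s₂.wreg 40 = Y.n → s₂.wreg 41 = x → s₂.wreg 47 = Y.col Y.n x →
      ert W (.seq (block [.wop .add 9 47 3, .wop .add 20 47 3, .rzero 12]) <| .seq setLeaf <|
        .seq walk <| .seq (block [.wop .add 20 9 5]) <| .seq augment (block [.wop .add 7 7 3]))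
        g s₂ ≤ (20 * Y.L + 39 : ℕ) + b + K * h (Y.col Y.n x) := by
    intro x s₂ hx hpos hst hk h7' hwa hra h40 h41 h47
    have hu : Y.col Y.n x < Y.n := Y.col_lt le_rfl hx
    set u := Y.col Y.n x with hudef
    have huR : u ∉ R := by
      intro huR
      simp [freeWeight, huR] at hpos
    have hwalk : ∀ s₄, Stat Y s₄ → Keep 7 10 s s₄ → s₄.wreg 7 = s.wreg 7 →
        s₄.wreg 9 = u + 1 → s₄.wreg 20 = u + 1 → s₄.warr = s.warr →
        Layout.Rows Y (s₄.rarr 1) (update A Y.n (freeWeight (insert u R))) →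
        ert W walk (ert W (.seq (block [.wop .add 20 9 5]) <|
          .seq augment (block [.wop .add 7 7 3])) g) s₄ ≤ K * h u + (1 + (9 + b)) := by
      intro s₄ hst hk h7' h9 h20 hwa hrows
      -- `D = 30` is the cost of one round of `augment`.
      refine (walk_ert_le hW hA.pos hA.row hu hst (fun i hi => hAn _ i hi ▸ hrows i hi.le)
        (by rw [hwa]; exact hs.matching) h20 (D := 30) (b := 9 + b)
        (hafter u s₄ hu huR hst hk h7' h9 (by rw [hwa]) (by rw [hwa]) hrows)).trans (le_of_eq ?_)
      rw [hwa]
    have hb : wpBlock W [.wop .add 9 47 3, .wop .add 20 47 3, .rzero 12]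
        (fun s₃ => s₃ = ⟨update (update s₂.wreg 9 (u + 1)) 20 (u + 1), update s₂.rreg 12 0,
          s₂.warr, s₂.rarr, s₂.wout, s₂.rout⟩) s₂ := by
      apply wpBlock_of_mk
      simp only [wpBlock, Instr.wp, WordOp.eval, h47, hst.one, update_apply, Nat.reduceEqDiff,
        reduceIte]
      exact ⟨by omega, by omega, trivial⟩
    refine (ert_seq_le (b := 1 + (20 * Y.L + 19 : ℕ) + (1 + (K * h u + (1 + (9 + b)))))
      (Spec.block hb) ?_).trans (le_of_eq ?_)
    · rintro s₃ rfl
      have hst₃ : Stat Y ⟨update (update s₂.wreg 9 (u + 1)) 20 (u + 1), update s₂.rreg 12 0,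
          s₂.warr, s₂.rarr, s₂.wout, s₂.rout⟩ := by
        refine ⟨?_, ?_, ?_, ?_, ?_, ?_⟩ <;>
          simp [hst.n, hst.one, hst.two, hst.zero, hst.st, hst.cl]
      refine ert_seq_le (setLeaf_spec hW hst₃ le_rfl (x := x) (v := 0) (by simp [h40])
        (by simp [h41]) hx (by simp) le_rfl (A := update A Y.n (freeWeight R))
        (by simp only [hra]; exact hs.rows)) fun s₄ h₄ => ?_
      rw [ert_seq]
      gcongr
      refine hwalk s₄ (hst₃.of_keep h₄.keep (by norm_num) (congrFun h₄.warr 0)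
        (congrFun h₄.warr 1)) ⟨fun r hr => ?_, fun r hr => ?_, h₄.keep.wout.trans hk.wout,
          h₄.keep.rout.trans hk.rout⟩ ?_ ?_ ?_ (h₄.warr.trans hwa) ?_
      · rw [h₄.keep.wreg r (by omega)]
        simp only
        rw [update_of_ne (by omega), update_of_ne (by omega), hk.wreg r hr]
      · rw [h₄.keep.rreg r (by omega)]
        simp only
        rw [update_of_ne (by omega), hk.rreg r hr]
      · rw [h₄.keep.wreg 7 (by norm_num)]
        simp [h7']
      · rw [h₄.keep.wreg 9 (by norm_num)]
        simp
      · rw [h₄.keep.wreg 20 (by norm_num)]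
        simp
      · have := h₄.rows
        rw [update_self, update_idem] at this
        convert this using 2
        ext k
        simp only [freeWeight, update_apply, Finset.mem_insert, ← hudef]
        grind
    · simp
      ring
  have hb : wpBlock W [.wop .add 40 0 5] (fun s₁ => s₁ = ⟨update s.wreg 40 Y.n, s.rreg, s.warr,
      s.rarr, s.wout, s.rout⟩) s := by
    apply wpBlock_of_mk
    simp only [wpBlock, Instr.wp, WordOp.eval, hs.stat.n, hs.stat.zero, add_zero]
    exact ⟨by omega, trivial⟩
  refine (ert_seq_le (b := 1 + ((17 * Y.L + 23 : ℕ) + ((20 * Y.L + 39 : ℕ) + b +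
    K * ((Y.n : ℝ≥0∞) / q)))) (Spec.block hb) ?_).trans (le_of_eq ?_)
  · rintro s₁ rfl
    have hst₁ : Stat Y ⟨update s.wreg 40 Y.n, s.rreg, s.warr, s.rarr, s.wout, s.rout⟩ := by
      refine ⟨?_, ?_, ?_, ?_, ?_, ?_⟩ <;> simp [hs.stat.n, hs.stat.one, hs.stat.two,
        hs.stat.zero, hs.stat.st, hs.stat.cl]
    rw [ert_seq]
    gcongr
    -- The cost after sampling is kept as a function of the sampled row, so that the hitting times
    -- are averaged and not bounded by their maximum.
    refine (sample_ert_le hW hst₁ le_rfl (w := freeWeight R) (by simp)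
      (by simpa using hs.rows Y.n le_rfl) hsum (by exact_mod_cast hqpos)
      (F := fun v => (20 * Y.L + 39 : ℕ) + b + K * h v) fun x s₂ hx hpos h₂ => ?_).trans ?_
    · refine hrest x s₂ hx hpos (hst₁.of_keep h₂.keep (by norm_num) (congrFun h₂.warr 0)
        (congrFun h₂.warr 1)) ⟨fun r hr => ?_, h₂.keep.rreg, h₂.keep.wout, h₂.keep.rout⟩ ?_ h₂.warr
        h₂.rarr ?_ h₂.node h₂.col
      · rw [h₂.keep.wreg r (by omega)]
        simp only
        rw [update_of_ne (by omega)]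
      · rw [h₂.keep.wreg 7 (by norm_num)]
        simp
      · rw [h₂.keep.wreg 40 (by norm_num)]
        simp
    · gcongr
      have hp1 : ∑ v ∈ Finset.range Y.n, ENNReal.ofReal (freeWeight R v / q) = 1 := by
        rw [← ENNReal.ofReal_sum_of_nonneg, ← Finset.sum_div, hsum, div_self, ENNReal.ofReal_one]
        · exact_mod_cast hqpos.ne'
        · intro v _
          unfold freeWeight
          positivity
      calc _ = (∑ v ∈ Finset.range Y.n, ENNReal.ofReal (freeWeight R v / q)) *
              ((20 * Y.L + 39 : ℕ) + b) + K * ∑ v ∈ Finset.range Y.n,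
              ENNReal.ofReal (freeWeight R v / q) * h v := by
            rw [Finset.sum_mul, Finset.mul_sum, ← Finset.sum_add_distrib]
            refine Finset.sum_congr rfl fun v _ => ?_
            ring
        _ ≤ 1 * ((20 * Y.L + 39 : ℕ) + b) + K * ((Y.n : ℝ≥0∞) / q) := by
            rw [hp1]
            gcongr
            exact sum_freeWeight_hit_le hA hs.matching hqpos
        _ = _ := by rw [one_mul]
  · simp
    ring

/-! ### Perfect matchings -/

/-- The rule for loops that count up word register `7` to `n`. -/
theorem Spec.for {W : ℕ} {p : Prog} {n : ℕ} (Inv : ℕ → State → Prop) (c : ℕ → ℝ≥0∞)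
    (hreg : ∀ i s, Inv i s → s.wreg 7 = i ∧ s.wreg 0 = n)
    (h : ∀ i < n, ∀ s, Inv i s → Spec W p s (c i) (Inv (i + 1))) {s : State} (hs : Inv 0 s) :
    Spec W (.loop (.wlt 7 0) p) s (∑ i ∈ Finset.range n, (1 + c i) + 1) (Inv n) := by
  have := Spec.loop (W := W) (b := .wlt 7 0) (p := p) (Q := Inv n)
    (fun q s => q ≤ n ∧ Inv (n - q) s) (fun q => ∑ i ∈ Finset.Ico (n - q) n, (1 + c i) + 1)
    (fun q s hs => by
      obtain ⟨hq, hs⟩ := hs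
      obtain ⟨h7, h0⟩ := hreg _ _ hs
      rcases Nat.eq_zero_or_pos q with rfl | hpos
      · exact Or.inl ⟨by simp [Test.holds, h7, h0], by simpa using hs, le_add_self⟩
      · refine Or.inr ⟨by simp [Test.holds, h7, h0]; omega, q - 1, by omega, c (n - q), ?_,
          (h (n - q) (by omega) s hs).mono le_rfl fun s' hs' => ⟨by omega, ?_⟩⟩
        · rw [Finset.sum_eq_sum_Ico_succ_bot (by omega : n - q < n),
            show n - (q - 1) = n - q + 1 by omega]
          exact le_of_eq (by ring)
        · rwa [show n - (q - 1) = n - q + 1 by omega])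
    (i := n) (s := s) ⟨le_rfl, by simpa using hs⟩
  simpa using this

theorem Spec.for_nat {W : ℕ} {p : Prog} {n : ℕ} (Inv : ℕ → State → Prop) (c : ℕ)
    (hreg : ∀ i s, Inv i s → s.wreg 7 = i ∧ s.wreg 0 = n)
    (h : ∀ i < n, ∀ s, Inv i s → Spec W p s c (Inv (i + 1))) {s : State} (hs : Inv 0 s) :
    Spec W (.loop (.wlt 7 0) p) s ((c + 1) * n + 1 : ℕ) (Inv n) := by
  refine (Spec.for Inv (fun _ => c) hreg h hs).mono (le_of_eq ?_) fun _ h => h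
  simp
  ring

/-- Unmatch all rows and columns. -/
def reset : Prog :=
  .seq (block [.wconst 7 0]) <| .loop (.wlt 7 0) <|
    .seq (block [.wstore 2 7 5, .wop .add 40 0 5, .wop .add 41 0 7, .rone 12]) <|
    .seq setLeaf (block [.wop .add 7 7 3])

/-- Find a perfect matching. -/
def perfectMatching : Prog :=
  .seq reset <| .seq (block [.wconst 7 0]) (.loop (.wlt 7 0) phase)

theorem Matched.subset_all {Y : Layout} {A : ℕ → ℕ → ℝ} {R : Finset ℕ} {s : State}
    (h : Matched Y A R s) (hR : R.card = Y.n) : R = Finset.range Y.n :=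
  Finset.eq_of_subset_of_card_le h.matching.subset (by simp [hR])

/-- The precondition, all free weights 0, is what a perfect matching leaves behind. Array 4 may keep
old entries: `IsMatching` looks only at rows named by array 2, which is cleared. -/
theorem reset_spec {Y : Layout} {W : ℕ} (hW : Layout.Fits Y W) {A : ℕ → ℕ → ℝ} {s : State}
    (hs : Stat Y s)
    (hA : Layout.Rows Y (s.rarr 1) (update A Y.n (freeWeight (Finset.range Y.n)))) :
    Spec W reset s ((20 * Y.L + 34) * Y.n + 5 : ℕ)
      (fun s' => Keep 7 10 s s' ∧ Matched Y A ∅ s') := by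
  have hW' := hW
  unfold Layout.Fits at hW'
  set Inv : ℕ → State → Prop := fun i s' => Stat Y s' ∧ Keep 7 10 s s' ∧ s'.wreg 7 = i ∧
    (∀ v < i, s'.warr 2 v = 0) ∧
    Layout.Rows Y (s'.rarr 1) (update A Y.n (freeWeight (Finset.Ico i Y.n))) with hInv
  have hb : wpBlock W [.wconst 7 0] (Inv 0) s := by
    apply wpBlock_of_mk
    simp only [wpBlock, Instr.wp, hInv]
    refine ⟨by omega, ?_, ⟨fun r hr => ?_, fun _ _ => rfl, rfl, rfl⟩, by simp, by simp,
      by simpa using hA⟩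
    · refine ⟨?_, ?_, ?_, ?_, ?_, ?_⟩ <;> simp [hs.n, hs.one, hs.two, hs.zero, hs.st, hs.cl]
    · simp only
      rw [update_of_ne (by omega)]
  refine (Spec.seq_nat (Spec.block hb) fun s₁ hs₁ => Spec.for_nat (n := Y.n) Inv
    (20 * Y.L + 33) (fun i s h => ⟨h.2.2.1, h.1.n⟩) ?_ hs₁).mono_nat ?_ ?_
  · rintro i hi s₂ ⟨h1, h2, h3, h4, h5⟩
    have hb2 : wpBlock W [.wstore 2 7 5, .wop .add 40 0 5, .wop .add 41 0 7, .rone 12]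
        (fun s₃ => s₃ = ⟨update (update s₂.wreg 40 Y.n) 41 (Y.n + i), update s₂.rreg 12 1,
          update s₂.warr 2 (update (s₂.warr 2) i 0), s₂.rarr, s₂.wout, s₂.rout⟩) s₂ := by
      apply wpBlock_of_mk
      simp only [wpBlock, Instr.wp, WordOp.eval, h1.n, h1.zero, h3, update_apply,
        Nat.reduceEqDiff, reduceIte, add_zero]
      exact ⟨by omega, by omega, trivial⟩
    refine (Spec.seq_nat (Spec.block hb2) fun s₃ hs₃ => Spec.seq_nat (c₁ := 20 * Y.L + 19)
      (R := LeafSet Y (update A Y.n (freeWeight (Finset.Ico i Y.n))) Y.n i 1 s₃) ?_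
      fun s₄ h₄ => Spec.block (l := [.wop .add 7 7 3]) (Q := Inv (i + 1)) ?_).mono_nat ?_
      fun _ h => h
    · subst hs₃
      have := setLeaf_spec hW (s := ⟨update (update s₂.wreg 40 Y.n) 41 (Y.n + i),
        update s₂.rreg 12 1, update s₂.warr 2 (update (s₂.warr 2) i 0), s₂.rarr, s₂.wout,
        s₂.rout⟩) ?_ le_rfl (by simp) (by simp) (Y.isLeaf_n hi) (v := 1) (by simp) zero_le_one
        (by simpa using h5)
      · rwa [Y.col_n hi] at this
      refine ⟨?_, ?_, ?_, ?_, ?_, ?_⟩ <;> simp [h1.n, h1.one, h1.two, h1.zero, h1.st, h1.cl]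
    · subst hs₃
      have hk := h₄.keep
      have hwa := h₄.warr
      apply wpBlock_of_mk
      simp only [wpBlock, Instr.wp, WordOp.eval, hk.wreg 7 (by norm_num), hk.wreg 3 (by norm_num),
        update_apply, Nat.reduceEqDiff, reduceIte, h3, h1.one]
      refine ⟨by omega, ?_, ⟨fun r hr => ?_, fun r hr => ?_, hk.wout.trans h2.wout,
        hk.rout.trans h2.rout⟩, by simp, ?_, ?_⟩
      · refine ⟨?_, ?_, ?_, ?_, ?_, ?_⟩ <;> simp [hk.wreg, hwa, h1.n, h1.one, h1.two, h1.zero,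
          h1.st, h1.cl]
      · simp only
        rw [update_of_ne (by omega), hk.wreg r (by omega)]
        simp only
        rw [update_of_ne (by omega), update_of_ne (by omega), h2.wreg r hr]
      · simp only
        rw [hk.rreg r hr]
        simp only
        rw [update_of_ne (by omega), h2.rreg r hr]
      · intro v hv
        simp only [hwa, update_self, update_apply]
        split_ifs with hvi
        · rfl
        · exact h4 v (by omega)
      · have := h₄.rows
        rw [update_self, update_idem] at this
        convert this using 2
        ext k
        simp only [freeWeight, update_apply, Finset.mem_Ico]
        grind
    · simp
      omega
  · simp
    nlinarith
  · rintro s' ⟨h1, h2, h3, h4, h5⟩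
    refine ⟨h2, h1, by simpa using h5, ⟨fun v hv u hu => ?_, fun u => ?_⟩⟩
    · rw [h4 v hv] at hu
      omega
    · simp only [Finset.notMem_empty, false_iff, not_exists, not_and]
      intro v hv hu
      rw [h4 v hv] at hu
      omega

/-- A bound for the expected time of `perfectMatching`. -/
noncomputable def matchingTime (Y : Layout) : ℝ≥0∞ :=
  ((20 * Y.L + 34) * Y.n + 11 : ℕ) + ∑ i ∈ Finset.range Y.n, (1 + ((37 * Y.L + 67 : ℕ) +
    (17 * Y.L + 64 : ℕ) * ((Y.n : ℝ≥0∞) / (Y.n - i : ℕ))))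

/-- Each of the `n` phases matches one more row, and a set of `n` rows is all of them. That a
perfect matching exists is a by-product and is not assumed. -/
theorem perfectMatching_spec {Y : Layout} {W : ℕ} (hW : Layout.Fits Y W) {A : ℕ → ℕ → ℝ} {S : ℝ}
    (hAS : Layout.Balanced Y A S) {s : State} (hs : Stat Y s)
    (hA : Layout.Rows Y (s.rarr 1) (update A Y.n (freeWeight (Finset.range Y.n)))) :
    Spec W perfectMatching s (matchingTime Y)
      (fun s' => Keep 7 10 s s' ∧ Matched Y A (Finset.range Y.n) s') := by
  set Inv : ℕ → State → Prop := fun i s' => Keep 7 10 s s' ∧ s'.wreg 7 = i ∧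
    ∃ R : Finset ℕ, R.card = i ∧ Matched Y A R s' with hInv
  refine (Spec.seq (reset_spec hW hs hA) fun s₁ h₁ => Spec.seq (R := Inv 0)
    (Spec.block (l := [.wconst 7 0]) ?_) fun s₂ h₂ => Spec.for (n := Y.n) Inv
    (fun i => (37 * Y.L + 67 : ℕ) + (17 * Y.L + 64 : ℕ) * ((Y.n : ℝ≥0∞) / (Y.n - i : ℕ)))
    ?_ ?_ h₂).mono ?_ ?_
  · obtain ⟨hk, hm⟩ := h₁
    apply wpBlock_of_mk
    simp only [wpBlock, Instr.wp, hInv]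
    refine ⟨by unfold Layout.Fits at hW; omega, ⟨fun r hr => ?_, hk.rreg, hk.wout, hk.rout⟩,
      by simp, ∅, rfl, ?_, hm.rows, hm.matching⟩
    · simp only
      rw [update_of_ne (by omega), hk.wreg r hr]
    · refine ⟨?_, ?_, ?_, ?_, ?_, ?_⟩ <;> simp [hm.stat.n, hm.stat.one, hm.stat.two, hm.stat.zero,
        hm.stat.st, hm.stat.cl]
  · rintro i s' ⟨hk, h7, R, -, hm⟩
    exact ⟨h7, hm.stat.n⟩
  · rintro i hi s' ⟨hk, h7, R, rfl, hm⟩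
    refine (phase_spec hW hAS hi hm h7).mono le_rfl ?_
    rintro s'' ⟨hk', R', hc, hm', h7'⟩
    exact ⟨hk.trans hk' le_rfl le_rfl, h7'.trans hc, R', hc, hm'⟩
  · unfold matchingTime
    simp
    ring_nf
    exact le_rfl
  · rintro s' ⟨hk, -, R, hc, hm⟩
    exact ⟨hk, hm.subset_all hc ▸ hm⟩

/-! ### Extracting one weighted matching -/

/-- Load the address of the leaf at which the row in word register `7` is matched. -/
def matchedLeaf : List Instr := [.wop .add 40 7 5, .wload 41 4 40] ++ rowAddr

/-- Put the least weight along the matching into weight register `5`. -/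
def minEntry : Prog :=
  .seq (block [.rload 5 1 3, .rzero 6, .wconst 7 0]) <| .loop (.wlt 7 0) <|
    .seq (block (matchedLeaf ++ [.wop .add 45 42 41, .rload 13 1 45])) <|
    .seq (.ite (.rlt 13 5) (block [.radd 5 13 6]) (block [])) (block [.wop .add 7 7 3])

/-- Output the matching with the weight in weight register `5`, and subtract it. -/
def subtract : Prog :=
  .seq (block [.remit 5, .wconst 7 0]) <| .loop (.wlt 7 0) <|
    .seq (block (matchedLeaf ++ (colOf ++
      [.wemit 47, .wop .add 45 42 41, .rload 13 1 45, .rsub 12 13 5]))) <|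
    .seq setLeaf (block [.wop .add 7 7 3])

/-- Count the matching, and set the limit `2` to `0` if nothing is left of the matrix. -/
def finish : Prog :=
  .seq (block [.wop .add 6 6 3, .rload 13 1 3, .rzero 14])
    (.ite (.rlt 14 13) (block []) (block [.wconst 2 0]))

/-- Find, output and subtract one weighted matching. -/
def extract : Prog := .seq perfectMatching <| .seq minEntry <| .seq subtract finish

theorem matchedLeaf_wp {Y : Layout} {W : ℕ} (hW : Layout.Fits Y W) {s : State} (hs : Stat Y s)
    {i : ℕ} (hi : i < Y.n) (h7 : s.wreg 7 = i) {x : ℕ} (h4 : s.warr 4 i = x) (hx : Y.IsLeaf i x)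
    {l : List Instr} {Q : State → Prop}
    (h : ∀ s', AtRow Y i s' s' → Keep 40 10 s s' → s'.warr = s.warr → s'.rarr = s.rarr →
      s'.wreg 40 = i → s'.wreg 41 = x → wpBlock W l Q s') : wpBlock W (matchedLeaf ++ l) Q s := by
  have hd := Y.deg_le hi.le
  have hx2 := hx.2
  have hW' := hW
  unfold Layout.Fits at hW'
  rw [matchedLeaf, List.append_assoc, List.cons_append, List.cons_append, List.nil_append]
  apply wpBlock_of_mk
  rw [wpBlock, wpBlock]
  simp only [Instr.wp, WordOp.eval, h7, hs.zero, update_apply, reduceIte, h4, add_zero]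
  refine ⟨by omega, by omega, rowAddr_wp hW (i := i) ?_ hi.le (by simp) fun s' h₁ hra hrr h41 => ?_⟩
  · refine ⟨?_, ?_, ?_, ?_, ?_, ?_⟩ <;> simp [hs.n, hs.one, hs.two, hs.zero, hs.st, hs.cl]
  refine h s' ⟨h₁.stat, Keep.refl _ _ _, rfl, h₁.base, h₁.st, h₁.deg⟩ ⟨fun r hr => ?_,
    h₁.keep.rreg, h₁.keep.wout, h₁.keep.rout⟩ h₁.warr hra ?_ ?_
  · rw [h₁.keep.wreg r (by omega)]
    simp only
    rw [update_of_ne (by omega), update_of_ne (by omega)]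
  · rw [h₁.keep.wreg 40 (by norm_num)]
    simp
  · rw [h41]
    simp

/-- The column with which a row is matched. -/
def partner (Y : Layout) (s : State) (i : ℕ) : ℕ := Y.col i (s.warr 4 i)

theorem Matched.leaf {Y : Layout} {A : ℕ → ℕ → ℝ} {s : State}
    (h : Matched Y A (Finset.range Y.n) s) {i : ℕ} (hi : i < Y.n) :
    Y.IsLeaf i (s.warr 4 i) ∧ 0 < A i (partner Y s i) ∧ s.warr 2 (partner Y s i) = i + 1 := by
  obtain ⟨v, hv, h'⟩ := (h.matching.mem i).1 (Finset.mem_range.2 hi)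
  obtain ⟨-, h1, h2, h3⟩ := h.matching.row v hv i h'
  have hp : partner Y s i = v := h2
  exact ⟨h1, hp ▸ h3, hp ▸ h'⟩

theorem Matched.entry {Y : Layout} {A : ℕ → ℕ → ℝ} {s : State}
    (h : Matched Y A (Finset.range Y.n) s) {i : ℕ} (hi : i < Y.n) :
    s.rarr 1 (2 * Y.st i + s.warr 4 i) = A i (partner Y s i) := by
  rw [(h.rows i hi.le).leaf _ (h.leaf hi).1, update_of_ne hi.ne]
  rfl

/-- The running minimum starts from the row sum `S`, an upper bound for every entry, so that no
first entry has to be treated separately. -/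
theorem minEntry_spec {Y : Layout} {W : ℕ} (hW : Layout.Fits Y W) {A : ℕ → ℕ → ℝ} {S : ℝ}
    (hAS : Layout.Balanced Y A S) {s : State} (hs : Matched Y A (Finset.range Y.n) s) :
    Spec W minEntry s (32 * Y.n + 9 : ℕ) (fun s' => Stat Y s' ∧ Keep 7 5 s s' ∧
      s'.warr = s.warr ∧ s'.rarr = s.rarr ∧ (∀ i < Y.n, s'.rreg 5 ≤ A i (partner Y s i)) ∧
      ∃ i < Y.n, s'.rreg 5 = A i (partner Y s i)) := by
  have hW' := hW
  unfold Layout.Fits at hW'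
  have hn := Y.n_pos
  set Inv : ℕ → State → Prop := fun i s' => Stat Y s' ∧ Keep 7 5 s s' ∧ s'.wreg 7 = i ∧
    s'.warr = s.warr ∧ s'.rarr = s.rarr ∧ s'.rreg 6 = 0 ∧
    (∀ r < i, s'.rreg 5 ≤ A r (partner Y s r)) ∧
    (s'.rreg 5 = S ∨ ∃ r < i, s'.rreg 5 = A r (partner Y s r)) with hInv
  -- Row 0 starts at position 0, so position 1 is the root of its tree.
  have hroot : s.rarr 1 1 = S := by
    have := (hs.rows 0 (by omega)).root (by omega)
    rw [update_of_ne (by omega), hAS.row 0 (by omega), Y.st_zero] at this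
    simpa using this
  have hb : wpBlock W [.rload 5 1 3, .rzero 6, .wconst 7 0] (Inv 0) s := by
    apply wpBlock_of_mk
    simp only [wpBlock, Instr.wp, hs.stat.one, hInv, hroot]
    refine ⟨by omega, ?_, ⟨fun r hr => ?_, fun r hr => ?_, rfl, rfl⟩, by simp, trivial, trivial,
      by simp, by simp, by simp⟩
    · refine ⟨?_, ?_, ?_, ?_, ?_, ?_⟩ <;> simp [hs.stat.n, hs.stat.one, hs.stat.two, hs.stat.zero,
        hs.stat.st, hs.stat.cl]
    · simp only
      rw [update_of_ne (by omega)]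
    · simp only
      rw [update_of_ne (by omega), update_of_ne (by omega)]
  refine (Spec.seq_nat (Spec.block hb) fun s₁ hs₁ => Spec.for_nat (n := Y.n) Inv 31
    (fun i s h => ⟨h.2.2.1, h.1.n⟩) ?_ hs₁).mono_nat ?_ ?_
  · rintro i hi s₂ ⟨h1, h2, h3, h4, h5, h6, h7, h8⟩
    have hleaf := hs.leaf hi
    have hb2 : wpBlock W (matchedLeaf ++ [.wop .add 45 42 41, .rload 13 1 45])
        (fun s₃ => s₃.rreg 13 = A i (partner Y s i) ∧ Stat Y s₃ ∧ Keep 40 10 s₂ s₃ ∧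
          s₃.warr = s₂.warr ∧ s₃.rarr = s₂.rarr) s₂ := by
      refine matchedLeaf_wp hW h1 hi h3 rfl (by rw [h4]; exact hleaf.1) fun s₃ a b c d e f => ?_
      have hx2 := hleaf.1.2
      have hd := Y.deg_le hi.le
      have hst := Y.st_le (i := i) (by omega)
      apply wpBlock_of_mk
      simp only [wpBlock, Instr.wp, WordOp.eval, a.base, f, update_self, h4]
      refine ⟨by omega, ?_, ?_, ⟨fun r hr => ?_, fun r hr => ?_, b.wout, b.rout⟩, c.trans h4, d⟩
      · rw [d, h5, hs.entry hi]
      · refine ⟨?_, ?_, ?_, ?_, ?_, ?_⟩ <;> simp [a.stat.n, a.stat.one, a.stat.two, a.stat.zero,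
          a.stat.st, a.stat.cl]
      · simp only
        rw [update_of_ne (by omega), b.wreg r hr]
      · simp only
        rw [update_of_ne (by omega), b.rreg r hr]
    refine (Spec.seq_nat (Spec.block hb2) fun s₃ ⟨e13, hst, hk, hwa, hra⟩ => Spec.seq_nat
      (R := fun s₄ => Stat Y s₄ ∧ Keep 7 5 s s₄ ∧ s₄.wreg 7 = i ∧ s₄.warr = s.warr ∧
        s₄.rarr = s.rarr ∧ s₄.rreg 6 = 0 ∧ s₄.rreg 5 = min (s₂.rreg 5) (A i (partner Y s i)))
      (Spec.ite_nat (c := 3) ?_) fun s₄ ⟨a1, a2, a3, a4, a5, a6, a7⟩ =>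
      Spec.block (l := [.wop .add 7 7 3]) ?_).mono_nat ?_ fun _ h => h
    · have e5 := hk.rreg 5 (by norm_num)
      have e6 := hk.rreg 6 (by norm_num)
      have e7 := hk.wreg 7 (by norm_num)
      have hkk := h2.trans hk (by norm_num) (by norm_num)
      by_cases hlt : s₃.rreg 13 < s₃.rreg 5
      · refine Or.inl ⟨by simp [Test.holds, hlt], Spec.block (l := [.radd 5 13 6]) ?_⟩
        rw [e13, e5] at hlt
        apply wpBlock_of_mk
        simp only [wpBlock, Instr.wp, e13, e6, h6, add_zero]
        refine ⟨?_, ⟨hkk.wreg, fun r hr => ?_, hkk.wout, hkk.rout⟩, by rw [e7, h3], by rw [hwa, h4],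
          by rw [hra, h5], by simp [e6, h6], ?_⟩
        · refine ⟨?_, ?_, ?_, ?_, ?_, ?_⟩ <;> simp [hst.n, hst.one, hst.two, hst.zero, hst.st,
            hst.cl]
        · simp only
          rw [update_of_ne (by omega), hkk.rreg r hr]
        · rw [update_self, min_eq_right hlt.le]
      · refine Or.inr ⟨by simp [Test.holds, hlt], (Spec.block (l := []) ?_).mono_nat
          (by norm_num) fun _ h => h⟩
        rw [e13, e5] at hlt
        exact ⟨hst, hkk, by rw [e7, h3], by rw [hwa, h4], by rw [hra, h5], by rw [e6, h6],
          by rw [e5, min_eq_left (not_lt.1 hlt)]⟩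
    · apply wpBlock_of_mk
      simp only [wpBlock, Instr.wp, WordOp.eval, a3, a1.one, hInv]
      refine ⟨by omega, ?_, ⟨fun r hr => ?_, a2.rreg, a2.wout, a2.rout⟩, by simp, a4, a5, a6,
          ?_, ?_⟩
      · refine ⟨?_, ?_, ?_, ?_, ?_, ?_⟩ <;> simp [a1.n, a1.one, a1.two, a1.zero, a1.st, a1.cl]
      · simp only
        rw [update_of_ne (by omega), a2.wreg r hr]
      · intro r hr
        rw [a7]
        rcases Nat.lt_succ_iff_lt_or_eq.1 hr with hr | rfl
        · exact (min_le_left _ _).trans (h7 r hr)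
        · exact min_le_right _ _
      · rw [a7]
        rcases min_choice (s₂.rreg 5) (A i (partner Y s i)) with hc | hc
        · rw [hc]
          exact h8.imp_right fun ⟨r, hr, h⟩ => ⟨r, by omega, h⟩
        · exact Or.inr ⟨i, by omega, hc⟩
    · simp [matchedLeaf, rowAddr]
  · simp
    omega
  · rintro s' ⟨h1, h2, h3, h4, h5, h6, h7, h8⟩
    refine ⟨h1, h2, h4, h5, h7, ?_⟩
    rcases h8 with h8 | h8
    -- If the minimum is still `S`, it is attained in row 0: that entry is at least the minimum, and
    -- at most the row sum `S`.
    · refine ⟨0, hn, le_antisymm (h7 0 hn) ?_⟩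
      rw [h8, ← hAS.row 0 hn]
      exact Finset.single_le_sum (f := A 0) (fun j hj => hAS.nonneg 0 hn j (Finset.mem_range.1 hj))
        (Finset.mem_range.2 (Y.col_lt (Nat.zero_le _) (hs.leaf hn).1))
    · exact h8

/-- The matrix `A` after `c` has been subtracted along `τ` in the rows before `i`. -/
def subMatching (A : ℕ → ℕ → ℝ) (τ : ℕ → ℕ) (c : ℝ) (i : ℕ) (r j : ℕ) : ℝ :=
  if r < i ∧ j = τ r then A r j - c else A r j

theorem subMatching_succ (A : ℕ → ℕ → ℝ) (τ : ℕ → ℕ) (c : ℝ) (i : ℕ) :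
    update (subMatching A τ c i) i (update (subMatching A τ c i i) (τ i) (A i (τ i) - c)) =
      subMatching A τ c (i + 1) := by
  ext r j
  rcases eq_or_ne r i with rfl | hr
  · rw [update_self]
    rcases eq_or_ne j (τ r) with rfl | hj
    · simp [subMatching]
    · simp [subMatching, hj]
  · rw [update_of_ne hr]
    have : r < i + 1 ↔ r < i := by omega
    simp [subMatching, this]

/-- A row is unchanged until its turn, so the value read is still that of `A`. By `hle` the new
value is nonnegative, as the trees require. -/
theorem subtract_spec {Y : Layout} {W : ℕ} (hW : Layout.Fits Y W) {A : ℕ → ℕ → ℝ} {s : State}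
    {c : ℝ} {τ : ℕ → ℕ} (hs : Stat Y s) (hc : s.rreg 5 = c) (hτ : ∀ i, partner Y s i = τ i)
    (hrows : Layout.Rows Y (s.rarr 1) (update A Y.n (freeWeight (Finset.range Y.n))))
    (hleaf : ∀ i < Y.n, Y.IsLeaf i (s.warr 4 i)) (hle : ∀ i < Y.n, c ≤ A i (τ i)) :
    Spec W subtract s ((20 * Y.L + 54) * Y.n + 7 : ℕ) (fun s' => Stat Y s' ∧
      (∀ r < 7, s'.wreg r = s.wreg r) ∧ s'.rout = s.rout ++ [c] ∧
      s'.wout = s.wout ++ (List.range Y.n).map τ ∧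
      Layout.Rows Y (s'.rarr 1)
        (update (subMatching A τ c Y.n) Y.n (freeWeight (Finset.range Y.n)))) := by
  have hW' := hW
  unfold Layout.Fits at hW'
  set Inv : ℕ → State → Prop := fun i s' => Stat Y s' ∧ (∀ r < 7, s'.wreg r = s.wreg r) ∧
    s'.wreg 7 = i ∧ s'.rreg 5 = c ∧ s'.warr = s.warr ∧ s'.rout = s.rout ++ [c] ∧
    s'.wout = s.wout ++ (List.range i).map τ ∧
    Layout.Rows Y (s'.rarr 1)
      (update (subMatching A τ c i) Y.n (freeWeight (Finset.range Y.n))) with hInv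
  have hb : wpBlock W [.remit 5, .wconst 7 0] (Inv 0) s := by
    apply wpBlock_of_mk
    simp only [wpBlock, Instr.wp, hc, hInv]
    refine ⟨by omega, ?_, fun r hr => ?_, by simp, trivial, trivial, trivial, by simp, ?_⟩
    · refine ⟨?_, ?_, ?_, ?_, ?_, ?_⟩ <;> simp [hs.n, hs.one, hs.two, hs.zero, hs.st, hs.cl]
    · rw [update_of_ne (by omega)]
    · convert hrows using 2
      ext r j
      simp [subMatching]
  refine (Spec.seq_nat (Spec.block hb) fun s₁ hs₁ => Spec.for_nat (n := Y.n) Inv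
    (20 * Y.L + 53) (fun i s h => ⟨h.2.2.1, h.1.n⟩) ?_ hs₁).mono_nat ?_ ?_
  · rintro i hi s₂ ⟨h1, h2, h3, h4, h5, h6, h7, h8⟩
    have hx := hleaf i hi
    have hcol : Y.col i (s.warr 4 i) = τ i := hτ i
    have hb2 : wpBlock W (matchedLeaf ++ (colOf ++
        [.wemit 47, .wop .add 45 42 41, .rload 13 1 45, .rsub 12 13 5]))
        (fun s₃ => Stat Y s₃ ∧ (∀ r < 40, s₃.wreg r = s₂.wreg r) ∧
          (∀ r < 10, s₃.rreg r = s₂.rreg r) ∧ s₃.warr = s₂.warr ∧ s₃.rarr = s₂.rarr ∧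
          s₃.rout = s₂.rout ∧ s₃.wout = s₂.wout ++ [τ i] ∧ s₃.wreg 40 = i ∧
          s₃.wreg 41 = s.warr 4 i ∧ s₃.rreg 12 = A i (τ i) - c) s₂ := by
      refine matchedLeaf_wp hW h1 hi h3 (by rw [h5]) hx fun s₃ a b hwa hra e f => ?_
      refine colOf_wp hW a hi.le hx f fun s₄ a' hra' hrr' f' e47 => ?_
      have hx2 := hx.2
      have hd := Y.deg_le hi.le
      have hst := Y.st_le (i := i) (by omega)
      have hentry : s₄.rarr 1 (2 * Y.st i + s.warr 4 i) = A i (τ i) := by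
        rw [hra', hra, (h8 i hi.le).leaf _ hx, update_of_ne hi.ne, hcol]
        simp [subMatching]
      have e5 : s₄.rreg 5 = c := by rw [hrr', b.rreg 5 (by norm_num), h4]
      apply wpBlock_of_mk
      simp only [wpBlock, Instr.wp, WordOp.eval, a'.base, f', e47, update_apply,
        Nat.reduceEqDiff, reduceIte, hentry, e5]
      refine ⟨by omega, ?_, fun r hr => ?_, fun r hr => ?_, ?_, ?_, ?_, ?_, ?_, trivial, trivial⟩
      · refine ⟨?_, ?_, ?_, ?_, ?_, ?_⟩ <;> simp [a'.stat.n, a'.stat.one, a'.stat.two, a'.stat.zero,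
          a'.stat.st, a'.stat.cl]
      · rw [if_neg (by omega), a'.keep.wreg r (by omega), b.wreg r hr]
      · rw [if_neg (by omega), if_neg (by omega), hrr', b.rreg r hr]
      · rw [a'.warr, hwa]
      · rw [hra', hra]
      · rw [a'.keep.rout, b.rout]
      · rw [a'.keep.wout, b.wout, hcol]
      · rw [a'.keep.wreg 40 (by norm_num), e]
    refine (Spec.seq_nat (Spec.block hb2) fun s₃ ⟨b1, b2, b3, b4, b5, b6, b7, b8, b9, b10⟩ =>
      Spec.seq_nat (setLeaf_spec hW b1 hi.le b8 b9 hx b10 (sub_nonneg.2 (hle i hi))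
        (by rw [b5]; exact h8)) fun s₄ h₄ => Spec.block (l := [.wop .add 7 7 3]) ?_).mono_nat ?_
      fun _ h => h
    · have hk := h₄.keep
      have hst₄ := b1.of_keep hk (by norm_num) (congrFun h₄.warr 0) (congrFun h₄.warr 1)
      have e7 : s₄.wreg 7 = i := by rw [hk.wreg 7 (by norm_num), b2 7 (by norm_num), h3]
      apply wpBlock_of_mk
      simp only [wpBlock, Instr.wp, WordOp.eval, e7, hst₄.one, hInv]
      refine ⟨by omega, ?_, fun r hr => ?_, by simp, ?_, ?_, ?_, ?_, ?_⟩
      · refine ⟨?_, ?_, ?_, ?_, ?_, ?_⟩ <;> simp [hst₄.n, hst₄.one, hst₄.two, hst₄.zero, hst₄.st,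
          hst₄.cl]
      · rw [update_of_ne (by omega), hk.wreg r (by omega), b2 r (by omega), h2 r hr]
      · rw [hk.rreg 5 (by norm_num), b3 5 (by norm_num), h4]
      · rw [h₄.warr, b4, h5]
      · rw [hk.rout, b6, h6]
      · rw [hk.wout, b7, h7, List.range_succ]
        simp
      · have := h₄.rows
        rw [update_of_ne hi.ne, update_comm hi.ne'] at this
        rwa [hcol, subMatching_succ] at this
    · simp [matchedLeaf, rowAddr, colOf]
      omega
  · simp
    nlinarith
  · rintro s' ⟨h1, h2, h3, h4, h5, h6, h7, h8⟩
    exact ⟨h1, h2, h6, h7, h8⟩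

/-- A bound for the expected time of `extract`. -/
noncomputable def extractTime (Y : Layout) : ℝ≥0∞ :=
  matchingTime Y + ((20 * Y.L + 86) * Y.n + 31 : ℕ)

/-- The memory between two extractions, when the rest of the matrix is `A`. -/
structure Ready (Y : Layout) (A : ℕ → ℕ → ℝ) (s : State) : Prop where
  stat : Stat Y s
  rows : Layout.Rows Y (s.rarr 1) (update A Y.n (freeWeight (Finset.range Y.n)))

/-- The memory `s'` after the extraction of the matching `τ` with weight `c` in memory `s`. -/
structure Extracted (Y : Layout) (A : ℕ → ℕ → ℝ) (S : ℝ) (τ : ℕ → ℕ) (c : ℝ) (s s' : State) :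
    Prop where
  lt : ∀ i < Y.n, τ i < Y.n
  inj : ∀ i < Y.n, ∀ j < Y.n, τ i = τ j → i = j
  pos : ∀ i < Y.n, 0 < A i (τ i)
  le : ∀ i < Y.n, c ≤ A i (τ i)
  attained : ∃ i < Y.n, c = A i (τ i)
  ready : Ready Y (subMatching A τ c Y.n) s'
  rout : s'.rout = s.rout ++ [c]
  wout : s'.wout = s.wout ++ (List.range Y.n).map τ
  count : s'.wreg 6 = s.wreg 6 + 1
  limit : s'.wreg 2 = if c < S then s.wreg 2 else 0

/-- The root of row 0 now holds `S - c`. If this is not positive, nothing is left, and the limit 0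
makes the test of `extractAll` fail. -/
theorem finish_spec {Y : Layout} {W : ℕ} (hW : Layout.Fits Y W) {A : ℕ → ℕ → ℝ} {S : ℝ}
    (hAS : Layout.Balanced Y A S) {s s' : State} {τ : ℕ → ℕ} {c : ℝ}
    (lt : ∀ i < Y.n, τ i < Y.n) (inj : ∀ i < Y.n, ∀ j < Y.n, τ i = τ j → i = j)
    (pos : ∀ i < Y.n, 0 < A i (τ i)) (le : ∀ i < Y.n, c ≤ A i (τ i))
    (attained : ∃ i < Y.n, c = A i (τ i)) (ready : Ready Y (subMatching A τ c Y.n) s')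
    (rout : s'.rout = s.rout ++ [c]) (wout : s'.wout = s.wout ++ (List.range Y.n).map τ)
    (h6 : s'.wreg 6 = s.wreg 6) (h2 : s'.wreg 2 = s.wreg 2) (h6W : s.wreg 6 + 1 ≤ W) :
    Spec W finish s' (12 : ℕ) (Extracted Y A S τ c s) := by
  have hn := Y.n_pos
  have hW' := hW
  unfold Layout.Fits at hW'
  have hst := ready.stat
  have hroot : s'.rarr 1 1 = S - c := by
    have := (ready.rows 0 (by omega)).root (by omega)
    rw [update_of_ne (by omega), Y.st_zero] at this
    rw [mul_zero, zero_add] at this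
    rw [this, ← hAS.row 0 hn]
    have hj : ∀ j ∈ Finset.range Y.n, subMatching A τ c Y.n 0 j =
        A 0 j - if j = τ 0 then c else 0 := by
      intro j _
      have hn' : 0 < Y.n := hn
      simp only [subMatching, hn', true_and]
      split_ifs <;> simp
    rw [Finset.sum_congr rfl hj, Finset.sum_sub_distrib, Finset.sum_ite_eq', if_pos]
    exact Finset.mem_range.2 (lt 0 hn)
  have hb : wpBlock W [.wop .add 6 6 3, .rload 13 1 3, .rzero 14] (fun s₁ => s₁ =
      ⟨update s'.wreg 6 (s.wreg 6 + 1), update (update s'.rreg 13 (S - c)) 14 0, s'.warr, s'.rarr,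
        s'.wout, s'.rout⟩) s' := by
    apply wpBlock_of_mk
    simp only [wpBlock, Instr.wp, WordOp.eval, h6, hst.one, hroot, update_apply, Nat.reduceEqDiff,
      reduceIte]
    exact ⟨h6W, trivial⟩
  refine Spec.seq_nat (c₂ := 4) (Spec.block hb) fun s₁ hs₁ => Spec.ite_nat (c := 3) ?_
  subst hs₁
  by_cases hc : c < S
  · refine Or.inl ⟨by simp [Test.holds, hc], (Spec.block (l := []) ?_).mono_nat (by simp)
      fun _ h => h⟩
    refine ⟨lt, inj, pos, le, attained, ⟨?_, ready.rows⟩, rout, wout, by simp, by simp [hc, h2]⟩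
    refine ⟨?_, ?_, ?_, ?_, ?_, ?_⟩ <;> simp [hst.n, hst.one, hst.two, hst.zero, hst.st, hst.cl]
  · refine Or.inr ⟨by simpa [Test.holds] using hc, Spec.block (l := [.wconst 2 0]) ?_⟩
    apply wpBlock_of_mk
    simp only [wpBlock, Instr.wp]
    refine ⟨by omega, lt, inj, pos, le, attained, ⟨?_, ready.rows⟩, rout, wout, by simp,
      by simp [hc]⟩
    refine ⟨?_, ?_, ?_, ?_, ?_, ?_⟩ <;> simp [hst.n, hst.one, hst.two, hst.zero, hst.st, hst.cl]

theorem extract_spec {Y : Layout} {W : ℕ} (hW : Layout.Fits Y W) {A : ℕ → ℕ → ℝ} {S : ℝ}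
    (hAS : Layout.Balanced Y A S) {s : State} (hs : Ready Y A s) (h6 : s.wreg 6 + 1 ≤ W) :
    Spec W extract s (extractTime Y) (fun s' => ∃ τ c, Extracted Y A S τ c s s') := by
  refine (Spec.seq (perfectMatching_spec hW hAS hs.stat hs.rows) fun s₁ ⟨hk₁, hm⟩ =>
    Spec.seq (minEntry_spec hW hAS hm) fun s₂ ⟨hst₂, hk₂, hwa₂, hra₂, hle, hatt⟩ =>
    Spec.seq (c₂ := 12) (subtract_spec hW (A := A) (c := s₂.rreg 5) (τ := partner Y s₁) hst₂ rfl
      (fun i => by rw [partner, hwa₂]; rfl) (by rw [hra₂]; exact hm.rows)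
      (fun i hi => by rw [hwa₂]; exact (hm.leaf hi).1) hle)
      fun s₃ ⟨hst₃, hk₃, hro, hwo, hrows⟩ => ?_).mono ?_ fun _ h => h
  · refine (finish_spec hW hAS (s := s) (τ := partner Y s₁) (c := s₂.rreg 5)
      (fun i hi => Y.col_lt hi.le (hm.leaf hi).1) ?_ (fun i hi => (hm.leaf hi).2.1) hle hatt
      ⟨hst₃, hrows⟩ ?_ ?_ ?_ ?_ h6).mono (by norm_num) fun s' h => ⟨_, _, h⟩
    -- Array 2 stores one mate for each column, so equal partners force equal rows.
    · intro i hi j hj hij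
      have h1 := (hm.leaf hi).2.2
      have h2 := (hm.leaf hj).2.2
      rw [hij] at h1
      omega
    · rw [hro, hk₂.rout, hk₁.rout]
    · rw [hwo, hk₂.wout, hk₁.wout]
    · rw [hk₃ 6 (by norm_num), hk₂.wreg 6 (by norm_num), hk₁.wreg 6 (by norm_num)]
    · rw [hk₃ 2 (by norm_num), hk₂.wreg 2 (by norm_num), hk₁.wreg 2 (by norm_num)]
  · unfold extractTime
    push_cast
    ring_nf
    exact le_rfl

end RandomRAM

/-! ### Partial Birkhoff–von Neumann decompositions -/

namespace BirkhoffVonNeumann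

variable {n : ℕ}

theorem permMatrix_apply (σ : Equiv.Perm (Fin n)) (i j : Fin n) :
    σ.permMatrix ℝ i j = if σ i = j then 1 else 0 := by
  simp [Equiv.Perm.permMatrix, PEquiv.toMatrix_apply, Equiv.toPEquiv_apply]

theorem weightedSum_append (l l' : List (ℝ × Equiv.Perm (Fin n))) :
    weightedSum (l ++ l') = weightedSum l + weightedSum l' := by
  simp [weightedSum]

theorem weightedSum_singleton (c : ℝ) (σ : Equiv.Perm (Fin n)) :
    weightedSum [(c, σ)] = c • σ.permMatrix ℝ := by
  simp [weightedSum]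

theorem sum_row_weightedSum (l : List (ℝ × Equiv.Perm (Fin n))) (i : Fin n) :
    ∑ j, weightedSum l i j = (l.map Prod.fst).sum := by
  induction l with
  | nil => simp [weightedSum]
  | cons p l ih =>
    rw [← List.singleton_append, weightedSum_append, weightedSum_singleton]
    simp [Finset.sum_add_distrib, ih]

theorem sum_col_weightedSum (l : List (ℝ × Equiv.Perm (Fin n))) (j : Fin n) :
    ∑ i, weightedSum l i j = (l.map Prod.fst).sum := by
  induction l with
  | nil => simp [weightedSum]
  | cons p l ih =>
    rw [← List.singleton_append, weightedSum_append, weightedSum_singleton]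
    have : ∀ i, (p.2 i = j ↔ i = p.2.symm j) := fun i => by rw [Equiv.eq_symm_apply]
    simp [Finset.sum_add_distrib, ih, this]

/-- The beginning of a Birkhoff-von Neumann decomposition. -/
structure IsPartial (M : Matrix (Fin n) (Fin n) ℝ) (l : List (ℝ × Equiv.Perm (Fin n))) : Prop where
  nodup : (l.map Prod.snd).Nodup
  pos : ∀ p ∈ l, 0 < p.1
  least : ∀ (t : ℕ) (h : t < l.length),
    IsLeast (Set.range fun i => (M - weightedSum (l.take t)) i (l[t].2 i)) l[t].1
  nonneg : ∀ i j, 0 ≤ (M - weightedSum l) i j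
  exhausted : ∀ p ∈ l, ∃ i, (M - weightedSum l) i (p.2 i) = 0

variable {M : Matrix (Fin n) (Fin n) ℝ} {l : List (ℝ × Equiv.Perm (Fin n))}

theorem isPartial_nil (hM : M ∈ doublyStochastic ℝ (Fin n)) : IsPartial M [] where
  nodup := by simp
  pos := by simp
  least := by simp
  nonneg i j := by simpa [weightedSum] using nonneg_of_mem_doublyStochastic hM
  exhausted := by simp

theorem sub_weightedSum_concat (c : ℝ) (σ : Equiv.Perm (Fin n)) (i j : Fin n) :
    (M - weightedSum (l ++ [(c, σ)])) i j =
      (M - weightedSum l) i j - if σ i = j then c else 0 := by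
  rw [weightedSum_append, weightedSum_singleton, ← sub_sub]
  simp

/-- The new matching is positive on the rest, whereas every earlier one meets a 0 there; hence it is
new. Zeros stay zeros, since entries only decrease and remain nonnegative, and the new matching is
exhausted where its minimum is attained. -/
theorem IsPartial.concat (h : IsPartial M l) {c : ℝ} {σ : Equiv.Perm (Fin n)} (hc : 0 < c)
    (hl : IsLeast (Set.range fun i => (M - weightedSum l) i (σ i)) c) :
    IsPartial M (l ++ [(c, σ)]) := by
  obtain ⟨⟨i₀, hi₀⟩, hle⟩ := hl
  have hle : ∀ i, c ≤ (M - weightedSum l) i (σ i) := fun i => hle ⟨i, rfl⟩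
  have hnonneg : ∀ i j, 0 ≤ (M - weightedSum (l ++ [(c, σ)])) i j := by
    intro i j
    rw [sub_weightedSum_concat]
    split_ifs with hij
    · subst hij
      linarith [hle i]
    · simpa using h.nonneg i j
  refine ⟨?_, ?_, ?_, hnonneg, ?_⟩
  · rw [List.map_append, List.nodup_append]
    refine ⟨h.nodup, by simp, ?_⟩
    rintro τ hτ τ' hτ' rfl
    obtain ⟨p, hp, rfl⟩ := List.mem_map.1 hτ
    obtain ⟨i, hi⟩ := h.exhausted p hp
    simp only [List.map_cons, List.map_nil, List.mem_singleton] at hτ'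
    rw [hτ'] at hi
    linarith [hle i]
  · intro p hp
    rcases List.mem_append.1 hp with hp | hp
    · exact h.pos p hp
    · rw [List.mem_singleton] at hp
      subst hp
      exact hc
  · intro t ht
    rw [List.length_append, List.length_singleton] at ht
    rcases Nat.lt_succ_iff_lt_or_eq.1 ht with ht' | rfl
    · rw [List.take_append_of_le_length ht'.le]
      simp only [List.getElem_append_left ht']
      exact h.least t ht'
    · rw [List.take_left']
      · simp only [List.getElem_concat_length]
        exact ⟨⟨i₀, hi₀⟩, fun _ ⟨i, hi⟩ => hi ▸ hle i⟩
      · rfl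
  · intro p hp
    rcases List.mem_append.1 hp with hp | hp
    · obtain ⟨i, hi⟩ := h.exhausted p hp
      refine ⟨i, le_antisymm ?_ (hnonneg _ _)⟩
      rw [sub_weightedSum_concat, hi]
      split_ifs <;> linarith
    · rw [List.mem_singleton] at hp
      subst hp
      refine ⟨i₀, ?_⟩
      rw [sub_weightedSum_concat, if_pos rfl]
      simp only at hi₀
      rw [hi₀, sub_self]

theorem sum_row_sub_weightedSum (hM : M ∈ doublyStochastic ℝ (Fin n)) (i : Fin n) :
    ∑ j, (M - weightedSum l) i j = 1 - (l.map Prod.fst).sum := by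
  simp [Finset.sum_sub_distrib, sum_row_weightedSum, sum_row_of_mem_doublyStochastic hM]

theorem sum_col_sub_weightedSum (hM : M ∈ doublyStochastic ℝ (Fin n)) (j : Fin n) :
    ∑ i, (M - weightedSum l) i j = 1 - (l.map Prod.fst).sum := by
  simp [Finset.sum_sub_distrib, sum_col_weightedSum, sum_col_of_mem_doublyStochastic hM]

/-- A decomposition is complete when the weights add up to `1`. -/
theorem IsPartial.isDecomposition (hM : M ∈ doublyStochastic ℝ (Fin n)) (h : IsPartial M l)
    (hl : 1 ≤ (l.map Prod.fst).sum) : IsDecomposition M l where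
  sum_eq := by
    ext i j
    have h1 := sum_row_sub_weightedSum (l := l) hM i
    have h2 := Finset.single_le_sum (f := fun j => (M - weightedSum l) i j)
      (fun j _ => h.nonneg i j) (Finset.mem_univ j)
    have h3 := h.nonneg i j
    simp only [Matrix.sub_apply] at h1 h2 h3
    linarith
  nodup := h.nodup
  pos := h.pos
  least := h.least

/-- By Birkhoff's theorem `S⁻¹ • N` is a convex combination of permutation matrices. Some
coefficient is positive, and its permutation lies in the support. -/
theorem exists_perm_pos {N : Matrix (Fin n) (Fin n) ℝ} {S : ℝ} (hS : 0 < S)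
    (h0 : ∀ i j, 0 ≤ N i j) (hrow : ∀ i, ∑ j, N i j = S) (hcol : ∀ j, ∑ i, N i j = S) :
    ∃ σ : Equiv.Perm (Fin n), ∀ i, 0 < N i (σ i) := by
  obtain ⟨w, hw0, hw1, hw⟩ := exists_eq_sum_perm_of_mem_doublyStochastic (M := S⁻¹ • N) (by
    rw [mem_doublyStochastic_iff_sum]
    refine ⟨fun i j => mul_nonneg (inv_nonneg.2 hS.le) (h0 i j), fun i => ?_, fun j => ?_⟩
    · simp [← Finset.mul_sum, hrow, hS.ne']
    · simp [← Finset.mul_sum, hcol, hS.ne'])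
  obtain ⟨σ, hσ⟩ : ∃ σ, 0 < w σ := by
    by_contra! hcon
    have : ∑ σ, w σ ≤ 0 := Finset.sum_nonpos fun σ _ => hcon σ
    linarith
  refine ⟨σ, fun i => ?_⟩
  have h1 : S⁻¹ * N i (σ i) = ∑ τ, w τ * (τ.permMatrix ℝ) i (σ i) := by
    have := congrFun (congrFun hw i) (σ i)
    simp only [Matrix.sum_apply, Matrix.smul_apply, smul_eq_mul] at this
    exact this.symm
  have h2 : w σ ≤ ∑ τ, w τ * (τ.permMatrix ℝ) i (σ i) := by
    refine le_trans ?_ (Finset.single_le_sum (f := fun τ => w τ * (τ.permMatrix ℝ) i (σ i))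
      (fun τ _ => mul_nonneg (hw0 τ) ?_) (Finset.mem_univ σ))
    · simp
    · rw [permMatrix_apply]
      positivity
  have h3 : 0 < S⁻¹ * N i (σ i) := by linarith
  exact pos_of_mul_pos_right h3 (inv_nonneg.2 hS.le)

/-- As long as something is left, a least entry along a positive permutation can be subtracted,
which lowers the number of nonzero entries. This is what makes a list cut off after `k` matchings
the beginning of a complete decomposition. -/
theorem IsPartial.exists_append (hn : 1 ≤ n) (hM : M ∈ doublyStochastic ℝ (Fin n))
    (h : IsPartial M l) : ∃ l', IsDecomposition M (l ++ l') := by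
  classical
  induction hd : (Finset.univ.filter fun p : Fin n × Fin n =>
    (M - weightedSum l) p.1 p.2 ≠ 0).card using Nat.strong_induction_on generalizing l with
  | _ d ih =>
    rcases le_or_gt 1 (l.map Prod.fst).sum with hs | hs
    · exact ⟨[], by simpa using h.isDecomposition hM hs⟩
    · have : NeZero n := ⟨by omega⟩
      obtain ⟨σ, hσ⟩ := exists_perm_pos (sub_pos.2 hs) h.nonneg
        (fun i => sum_row_sub_weightedSum hM i) (fun j => sum_col_sub_weightedSum hM j)
      obtain ⟨i₀, -, hi₀⟩ := Finset.exists_min_image Finset.univ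
        (fun i => (M - weightedSum l) i (σ i)) Finset.univ_nonempty
      have hstep := h.concat (hσ i₀) (σ := σ) ⟨⟨i₀, rfl⟩, by
        rintro _ ⟨i, rfl⟩
        exact hi₀ i (Finset.mem_univ i)⟩
      obtain ⟨l', hl'⟩ := ih _ (by
        rw [← hd]
        refine Finset.card_lt_card ((Finset.ssubset_iff_of_subset ?_).2
          ⟨(i₀, σ i₀), Finset.mem_filter.2 ⟨Finset.mem_univ _, (hσ i₀).ne'⟩, ?_⟩)
        · intro p hp
          simp only [Finset.mem_filter, Finset.mem_univ, true_and] at hp ⊢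
          intro h0
          apply hp
          refine le_antisymm ?_ (hstep.nonneg _ _)
          rw [sub_weightedSum_concat, h0]
          split_ifs
          · linarith [hσ i₀]
          · simp
        · simp only [Finset.mem_filter, Finset.mem_univ, true_and, not_not]
          rw [sub_weightedSum_concat, if_pos rfl, sub_self]) hstep rfl
      exact ⟨_, by rwa [List.append_assoc] at hl'⟩

/-- The entries of a matrix as a function on the natural numbers. -/
noncomputable def entry (N : Matrix (Fin n) (Fin n) ℝ) (i j : ℕ) : ℝ :=
  if h : i < n ∧ j < n then N ⟨i, h.1⟩ ⟨j, h.2⟩ else 0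

theorem entry_val (N : Matrix (Fin n) (Fin n) ℝ) (i j : Fin n) : entry N i j = N i j := by
  simp [entry]

theorem sum_row_entry (N : Matrix (Fin n) (Fin n) ℝ) (i : Fin n) :
    ∑ j ∈ Finset.range n, entry N i j = ∑ j, N i j := by
  rw [Finset.sum_range]
  simp only [entry_val]

theorem sum_col_entry (N : Matrix (Fin n) (Fin n) ℝ) (j : Fin n) :
    ∑ i ∈ Finset.range n, entry N i j = ∑ i, N i j := by
  rw [Finset.sum_range]
  simp only [entry_val]

end BirkhoffVonNeumann

/-! ### Extracting all matchings -/

namespace RandomRAM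

open Function BirkhoffVonNeumann

/-- Extract matchings until their number reaches the limit. -/
def extractAll : Prog := .loop (.wlt 6 2) extract

theorem balanced_entry {Y : Layout} {N : Matrix (Fin Y.n) (Fin Y.n) ℝ} {S : ℝ} (hS : 0 < S)
    (h0 : ∀ i j, 0 ≤ N i j) (hrow : ∀ i, ∑ j, N i j = S) (hcol : ∀ j, ∑ i, N i j = S) :
    Layout.Balanced Y (entry N) S where
  pos := hS
  nonneg i hi j hj := by
    rw [entry, dif_pos ⟨hi, hj⟩]
    exact h0 _ _
  row i hi := (sum_row_entry N ⟨i, hi⟩).trans (hrow _)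
  col j hj := (sum_col_entry N ⟨j, hj⟩).trans (hcol _)

/-- The permutation given by the matching. -/
theorem Extracted.exists_perm {Y : Layout} {A : ℕ → ℕ → ℝ} {S : ℝ} {τ : ℕ → ℕ} {c : ℝ}
    {s s' : State} (h : Extracted Y A S τ c s s') :
    ∃ σ : Equiv.Perm (Fin Y.n), ∀ i, (σ i : ℕ) = τ i := by
  let f : Fin Y.n → Fin Y.n := fun i => ⟨τ i, h.lt i i.2⟩
  have hf : Injective f := fun i j hij => Fin.ext (h.inj i i.2 j j.2 (congrArg Fin.val hij))
  exact ⟨Equiv.ofBijective f (Finite.injective_iff_bijective.1 hf), fun i => rfl⟩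

theorem subMatching_entry {n : ℕ} {M : Matrix (Fin n) (Fin n) ℝ}
    {l : List (ℝ × Equiv.Perm (Fin n))} {τ : ℕ → ℕ} {c : ℝ} {σ : Equiv.Perm (Fin n)}
    (hσ : ∀ i, (σ i : ℕ) = τ i) :
    subMatching (entry (M - weightedSum l)) τ c n = entry (M - weightedSum (l ++ [(c, σ)])) := by
  ext i j
  by_cases hi : i < n
  · by_cases hj : j < n
    · have := hσ ⟨i, hi⟩
      have hiff : σ ⟨i, hi⟩ = ⟨j, hj⟩ ↔ j = τ i := by
        rw [← this, Fin.ext_iff]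
        exact eq_comm
      rw [entry, dif_pos ⟨hi, hj⟩, sub_weightedSum_concat]
      simp only [subMatching, entry, hi, true_and, hiff]
      split_ifs <;> simp
    · have : j ≠ τ i := by
        rintro rfl
        exact hj (hσ ⟨i, hi⟩ ▸ (σ ⟨i, hi⟩).2)
      simp [subMatching, entry, hj, this]
  · simp [subMatching, entry, hi]

/-- The rest has row and column sums 1 minus the sum of the weights output so far. The invariant has
two modes: either that is positive and the limit is still `k`, or the decomposition is complete and
the limit is 0. -/
theorem extractAll_spec {Y : Layout} {W : ℕ} (hW : Layout.Fits Y W)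
    {M : Matrix (Fin Y.n) (Fin Y.n) ℝ} (hM : M ∈ doublyStochastic ℝ (Fin Y.n)) {s : State}
    {k : ℕ} (hkW : k ≤ W) (hs : Ready Y (entry M) s) (h6 : s.wreg 6 = 0)
    (h2 : s.wreg 2 = k) (hw : s.wout = []) (hr : s.rout = []) :
    Spec W extractAll s (k * (1 + extractTime Y) + 1) (fun s' =>
      ∃ l : List (ℝ × Equiv.Perm (Fin Y.n)), IsDecomposition M l ∧ Outputs s' (l.take k)) := by
  have hn := Y.n_pos
  refine (Spec.loop (fun q s' => ∃ l : List (ℝ × Equiv.Perm (Fin Y.n)), IsPartial M l ∧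
    Ready Y (entry (M - weightedSum l)) s' ∧ Outputs s' l ∧ s'.wreg 6 = l.length ∧
    l.length ≤ k ∧ ((s'.wreg 2 = k ∧ (l.map Prod.fst).sum < 1 ∧ k ≤ q + l.length) ∨
      (s'.wreg 2 = 0 ∧ 1 ≤ (l.map Prod.fst).sum)))
    (fun q => q * (1 + extractTime Y) + 1) ?_ (i := k) ?_).mono le_rfl fun _ h => h
  · rintro q s' ⟨l, hl, hready, hout, h6, hlen, hcase⟩
    rcases hcase with ⟨h2, hsum, hq⟩ | ⟨h2, hsum⟩
    · rcases lt_or_ge l.length k with hlt | hge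
      · refine Or.inr ⟨by simp [Test.holds, h6, h2, hlt], q - 1, by omega, extractTime Y, ?_,
          (extract_spec hW (balanced_entry (sub_pos.2 hsum) hl.nonneg
            (fun i => sum_row_sub_weightedSum hM i) (fun j => sum_col_sub_weightedSum hM j))
            hready (by omega)).mono le_rfl ?_⟩
        · obtain ⟨q, rfl⟩ : ∃ q', q = q' + 1 := ⟨q - 1, by omega⟩
          rw [Nat.add_sub_cancel]
          push_cast
          exact le_of_eq (by ring)
        · rintro s'' ⟨τ, c, h⟩
          obtain ⟨σ, hσ⟩ := h.exists_perm
          have hentry : ∀ i : Fin Y.n, (M - weightedSum l) i (σ i) =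
              entry (M - weightedSum l) i (τ i) := by
            intro i
            rw [← hσ i, entry_val]
          have hc : 0 < c := by
            obtain ⟨i, hi, hc⟩ := h.attained
            rw [hc]
            exact h.pos i hi
          have hleast : IsLeast (Set.range fun i => (M - weightedSum l) i (σ i)) c := by
            constructor
            · obtain ⟨i, hi, hc⟩ := h.attained
              exact ⟨⟨i, hi⟩, by simp only; rw [hentry, hc]⟩
            · rintro _ ⟨i, rfl⟩
              simp only
              rw [hentry]
              exact h.le i i.2
          refine ⟨l ++ [(c, σ)], hl.concat hc hleast, by
            rw [← subMatching_entry hσ]; exact h.ready, ⟨?_, ?_⟩, ?_, ?_, ?_⟩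
          · rw [h.rout, hout.1]
            simp
          · rw [h.wout, hout.2, List.flatMap_append]
            congr 1
            simp only [List.flatMap_cons, List.flatMap_nil, List.append_nil, hσ]
            apply List.ext_getElem <;> simp
          · rw [h.count, h6]
            simp
          · simp
            omega
          · rw [h.limit]
            simp only [List.map_append, List.map_cons, List.map_nil, List.sum_append,
              List.sum_singleton, List.length_append, List.length_singleton]
            split_ifs with hcS
            · exact Or.inl ⟨h2, by linarith, by omega⟩
            · exact Or.inr ⟨rfl, by linarith⟩
      -- The limit `k` is reached with something left; the later matchings are chosen arbitrarily
      -- and dropped by `take k`.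
      · obtain ⟨l', hl'⟩ := hl.exists_append hn hM
        refine Or.inl ⟨by simp [Test.holds, h6, h2, hge], ⟨l ++ l', hl', ?_⟩, le_add_self⟩
        rwa [List.take_append_of_le_length hge, List.take_of_length_le hlen]
    · refine Or.inl ⟨by simp [Test.holds, h2], ⟨l, hl.isDecomposition hM hsum, ?_⟩, le_add_self⟩
      rwa [List.take_of_length_le hlen]
  · refine ⟨[], isPartial_nil hM, ?_, ⟨hr, hw⟩, h6, Nat.zero_le k, Or.inl ⟨h2, by simp, le_rfl⟩⟩
    simpa [weightedSum] using hs

/-! ### Building the trees -/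

/-- Compute the content of the node `41` of the tree. -/
def buildStep : Prog :=
  .seq (.ite (.wlt 41 44)
    (block [.wop .add 46 41 41, .wop .add 45 42 46, .rload 10 1 45, .wop .add 45 45 3,
      .rload 11 1 45, .radd 10 10 11, .wop .add 45 42 41, .rstore 1 45 10])
    (block [.wop .sub 45 41 44, .wop .add 45 43 45, .rload 10 0 45, .wop .add 45 42 41,
      .rstore 1 45 10]))
    (block [.wop .sub 41 41 3])

/-- Build the tree of the row in word register `7`. -/
def buildRow : Prog :=
  .seq (block [.wop .add 40 7 5]) <|
  .seq (block (rowAddr ++ [.wop .add 41 44 44, .wop .sub 41 41 3])) <|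
  .seq (.loop (.wlt 5 41) buildStep) (block [.wop .add 7 7 3])

/-- Add a row that contains all columns, and build the trees of the rows of the matrix. -/
def setup : Prog :=
  .seq (block [.wconst 3 1, .wop .add 40 0 3, .wop .add 41 1 0, .wstore 0 40 41, .wconst 7 0]) <|
  .seq (.loop (.wlt 7 0) (block [.wop .add 40 1 7, .wstore 1 40 7, .wop .add 7 7 3])) <|
  .seq (block [.wconst 7 0]) (.loop (.wlt 7 0) buildRow)

/-- The memory while the tree of row `i` is built, when the nodes after `x` are in place. -/
structure Building (Y : Layout) (i : ℕ) (s : State) (x : ℕ) (s' : State) : Prop where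
  row : AtRow Y i s s'
  node : s'.wreg 41 = x
  lt : x < 2 * Y.deg i
  input : s'.rarr 0 = s.rarr 0
  tree : ∀ y, x < y → y < 2 * Y.deg i → s'.rarr 1 (2 * Y.st i + y) =
    heapExtend (Y.deg i) (fun y => s.rarr 0 (Y.st i + (y - Y.deg i))) y
  other : ∀ p, (∀ y, 1 ≤ y → y < 2 * Y.deg i → p ≠ 2 * Y.st i + y) → s'.rarr 1 p = s.rarr 1 p

/-- Nodes are filled in decreasing order, so the children `2 * x` and `2 * x + 1` of an inner node
are in place when it is computed. -/
theorem buildStep_spec {Y : Layout} {W : ℕ} (hW : Layout.Fits Y W) {s s' : State} {i x : ℕ}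
    (hi : i ≤ Y.n) (h : Building Y i s x s') (hx : 1 ≤ x) :
    Spec W buildStep s' (22 : ℕ) (Building Y i s (x - 1)) := by
  have h1 := Y.st_add_deg hi
  have h2 := Y.st_le (i := i + 1) (by omega)
  have h3 := Y.deg_le hi
  have hlt := h.lt
  have hW' := hW
  unfold Layout.Fits at hW'
  set φ : ℕ → ℝ := fun y => s.rarr 0 (Y.st i + (y - Y.deg i)) with hφ
  refine Spec.seq_nat (R := fun s₁ => AtRow Y i s s₁ ∧ s₁.wreg 41 = x ∧ s₁.rarr =
    update s'.rarr 1 (update (s'.rarr 1) (2 * Y.st i + x) (heapExtend (Y.deg i) φ x)))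
    (Spec.ite_nat (c := 17) ?_) fun s₁ ⟨a1, a2, a3⟩ =>
    Spec.block (l := [.wop .sub 41 41 3]) ?_
  · rcases lt_or_ge x (Y.deg i) with hxd | hxd
    · refine Or.inl ⟨by simp [Test.holds, h.node, h.row.deg, hxd], (Spec.block
        (l := [.wop .add 46 41 41, .wop .add 45 42 46, .rload 10 1 45, .wop .add 45 45 3,
        .rload 11 1 45, .radd 10 10 11, .wop .add 45 42 41,
            .rstore 1 45 10]) ?_).mono_nat (by simp) fun _ h => h⟩
      have e1 := h.tree (2 * x) (by omega) (by omega)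
      have e2 := h.tree (2 * x + 1) (by omega) (by omega)
      rw [two_mul x] at e1 e2
      rw [← add_assoc (2 * Y.st i)] at e2
      apply wpBlock_of_mk
      simp only [wpBlock, Instr.wp, h.node, h.row.base, WordOp.eval, update_apply, reduceIte,
        Nat.reduceEqDiff, h.row.stat.one, e1, e2]
      refine ⟨by omega, by omega, by omega, by omega, ⟨⟨?_, ?_, ?_, ?_, h.row.stat.st,
        h.row.stat.cl⟩, ⟨?_, ?_, h.row.keep.wout, h.row.keep.rout⟩, h.row.warr, ?_, ?_, ?_⟩,
        trivial, ?_⟩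
      all_goals try simp [update_apply, h.row.stat.n, h.row.stat.one, h.row.stat.two,
        h.row.stat.zero, h.row.base, h.row.st, h.row.deg]
      · intro r hr
        have := h.row.keep.wreg r hr
        grind
      · intro r hr
        have := h.row.keep.rreg r hr
        grind
      · rw [heapExtend_node φ hx hxd, two_mul x]
    · refine Or.inr ⟨by simpa [Test.holds, h.node, h.row.deg] using hxd, (Spec.block
        (l := [.wop .sub 45 41 44, .wop .add 45 43 45, .rload 10 0 45, .wop .add 45 42 41,
        .rstore 1 45 10]) ?_).mono_nat (by simp) fun _ h => h⟩
      apply wpBlock_of_mk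
      simp only [wpBlock, Instr.wp, h.node, h.row.base, h.row.st, h.row.deg, WordOp.eval,
        update_apply, reduceIte, Nat.reduceEqDiff, h.input]
      refine ⟨by omega, by omega, by omega, ⟨⟨?_, ?_, ?_, ?_, h.row.stat.st,
        h.row.stat.cl⟩, ⟨?_, ?_, h.row.keep.wout, h.row.keep.rout⟩, h.row.warr, ?_, ?_, ?_⟩,
        trivial, ?_⟩
      all_goals try simp [update_apply, h.row.stat.n, h.row.stat.one, h.row.stat.two,
        h.row.stat.zero, h.row.base, h.row.st, h.row.deg]
      · intro r hr
        have := h.row.keep.wreg r hr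
        grind
      · intro r hr
        have := h.row.keep.rreg r hr
        grind
      · rw [heapExtend_leaf φ hxd]
  · apply wpBlock_of_mk
    simp only [wpBlock, Instr.wp, WordOp.eval, a2, a1.stat.one]
    refine ⟨by omega, ⟨⟨?_, ?_, ?_, ?_, a1.stat.st, a1.stat.cl⟩, ⟨fun r hr => ?_, a1.keep.rreg,
      a1.keep.wout, a1.keep.rout⟩, a1.warr, ?_, ?_, ?_⟩, ?_, by omega, ?_, ?_, ?_⟩
    all_goals try simp [a1.stat.n, a1.stat.one, a1.stat.two, a1.stat.zero, a1.base, a1.st, a1.deg]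
    · rw [update_of_ne (by omega), a1.keep.wreg r hr]
    · rw [a3, update_of_ne (by norm_num), h.input]
    · intro y hy1 hy2
      rw [a3, update_self]
      by_cases hyx : y = x
      · rw [hyx, update_self]
      · rw [update_of_ne (by omega), h.tree y (by omega) hy2]
    · intro p hp
      rw [a3, update_self, update_of_ne (hp x hx hlt), h.other p hp]

/-- The memory after the trees of the rows before `i` have been built. -/
structure Built (Y : Layout) (A : ℕ → ℕ → ℝ) (s : State) (i : ℕ) (s' : State) : Prop where
  stat : Stat Y s'
  keep : Keep 7 10 s s'
  reg : s'.wreg 7 = i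
  input : s'.rarr 0 = s.rarr 0
  rows : ∀ r < i, Y.Row (s'.rarr 1) r (A r)
  rest : ∀ p, 2 * Y.st i ≤ p → s'.rarr 1 p = 0

theorem buildRow_spec {Y : Layout} {W : ℕ} (hW : Layout.Fits Y W) {A : ℕ → ℕ → ℝ}
    {s s' : State} {i : ℕ} (hi : i < Y.n)
    (hval : ∀ x, Y.IsLeaf i x → s.rarr 0 (Y.st i + (x - Y.deg i)) = A i (Y.col i x))
    (hzero : ∀ j < Y.n, (∀ x, Y.IsLeaf i x → Y.col i x ≠ j) → A i j = 0)
    (hnonneg : ∀ j < Y.n, 0 ≤ A i j) (h : Built Y A s i s') :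
    Spec W buildRow s' (46 * Y.deg i + 25 : ℕ) (Built Y A s (i + 1)) := by
  have hd := Y.deg_pos hi.le
  have h1 := Y.st_add_deg hi.le
  have h3 := Y.deg_le hi.le
  have hW' := hW
  unfold Layout.Fits at hW'
  obtain ⟨s₀, hs₀⟩ : ∃ s₀ : State, s₀ =
    ⟨update s'.wreg 40 i, s'.rreg, s'.warr, s'.rarr, s'.wout, s'.rout⟩ := ⟨_, rfl⟩
  have hst₀ : Stat Y s₀ := by
    refine ⟨?_, ?_, ?_, ?_, ?_, ?_⟩ <;> simp [hs₀, h.stat.n, h.stat.one, h.stat.two, h.stat.zero,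
      h.stat.st, h.stat.cl]
  have hb : wpBlock W [.wop .add 40 7 5] (fun s₁ => s₁ = s₀) s' := by
    apply wpBlock_of_mk
    simp only [wpBlock, Instr.wp, WordOp.eval, h.reg, h.stat.zero, add_zero]
    exact ⟨by omega, hs₀.symm⟩
  have hb2 : wpBlock W (rowAddr ++ [.wop .add 41 44 44, .wop .sub 41 41 3])
      (Building Y i s₀ (2 * Y.deg i - 1)) s₀ := by
    refine rowAddr_wp hW hst₀ hi.le (by simp [hs₀]) fun s₁ a hra hrr h41 => ?_
    apply wpBlock_of_mk
    simp only [wpBlock, Instr.wp, WordOp.eval, a.deg, update_apply, reduceIte, Nat.reduceEqDiff,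
      a.stat.one]
    refine ⟨by omega, by omega, ⟨⟨?_, ?_, ?_, ?_, a.stat.st, a.stat.cl⟩, ⟨fun r hr => ?_,
      a.keep.rreg, a.keep.wout, a.keep.rout⟩, a.warr, ?_, ?_, ?_⟩, ?_, by omega, by rw [hra],
      fun y hy1 hy2 => by omega, fun p _ => by rw [hra]⟩
    all_goals try simp [a.stat.n, a.stat.one, a.stat.two, a.stat.zero, a.base, a.st, a.deg]
    · rw [update_of_ne (by omega), a.keep.wreg r hr]
    · omega
  have hloop : ∀ s₂, Building Y i s₀ (2 * Y.deg i - 1) s₂ →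
      Spec W (.loop (.wlt 5 41) buildStep) s₂ (23 * (2 * Y.deg i - 1) + 1 : ℕ)
        (Building Y i s₀ 0) := by
    intro s₂ h₂
    refine Spec.loop_nat (Building Y i s₀) (fun x => 23 * x + 1) (fun x s₃ h₃ => ?_) h₂
    rcases Nat.eq_zero_or_pos x with rfl | hpos
    · exact Or.inl ⟨by simp [Test.holds, h₃.node], h₃, by omega⟩
    · exact Or.inr ⟨by simp [Test.holds, h₃.node, h₃.row.stat.zero, hpos], x - 1, by omega, 22,
        by omega, buildStep_spec hW hi.le h₃ hpos⟩
  refine (Spec.seq_nat (Spec.block hb) fun s₁ hs₁ => Spec.seq_nat (Spec.block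
    (l := rowAddr ++ [.wop .add 41 44 44, .wop .sub 41 41 3])
      (by rw [hs₁]; exact hb2)) fun s₂ h₂ => Spec.seq_nat (hloop s₂ h₂) fun s₃ h₃ =>
      Spec.block (l := [.wop .add 7 7 3]) ?_).mono_nat ?_ fun _ h => h
  · have e7 : s₃.wreg 7 = i := by
      rw [h₃.row.keep.wreg 7 (by norm_num)]
      simp [hs₀, h.reg]
    have ht : ∀ y, 1 ≤ y → y < 2 * Y.deg i → s₃.rarr 1 (2 * Y.st i + y) =
        heapExtend (Y.deg i) (fun y => s.rarr 0 (Y.st i + (y - Y.deg i))) y := by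
      intro y hy1 hy2
      rw [h₃.tree y (by omega) hy2]
      simp only [hs₀, h.input]
    apply wpBlock_of_mk
    simp only [wpBlock, Instr.wp, WordOp.eval, e7, h₃.row.stat.one]
    refine ⟨by omega, ?_, ⟨fun r hr => ?_, fun r hr => ?_, ?_, ?_⟩, by simp, ?_, fun r hr => ?_,
      fun p hp => ?_⟩
    · refine ⟨?_, ?_, ?_, ?_, ?_, ?_⟩ <;> simp [h₃.row.stat.n, h₃.row.stat.one, h₃.row.stat.two,
        h₃.row.stat.zero, h₃.row.stat.st, h₃.row.stat.cl]
    · simp only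
      rw [update_of_ne (by omega), h₃.row.keep.wreg r (by omega)]
      simp only [hs₀]
      rw [update_of_ne (by omega), h.keep.wreg r hr]
    · exact (h₃.row.keep.rreg r hr).trans (by rw [hs₀]; exact h.keep.rreg r hr)
    · exact h₃.row.keep.wout.trans (by rw [hs₀]; exact h.keep.wout)
    · exact h₃.row.keep.rout.trans (by rw [hs₀]; exact h.keep.rout)
    · exact h₃.input.trans (by rw [hs₀]; exact h.input)
    · rcases Nat.lt_succ_iff_lt_or_eq.1 hr with hr | rfl
      · refine (h.rows r hr).congr (fun x hx1 hx2 => (h₃.other _ fun y hy1 hy2 heq => ?_).trans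
          (by rw [hs₀])) (by omega)
        have := (Y.tree_disjoint (by omega) hi.le hx1 hx2 hy1 hy2 heq).1
        omega
      · refine ⟨fun x hx1 hx2 => ?_, fun x hx => ?_, hzero, hnonneg⟩
        · rw [ht x hx1 (by omega), ht (2 * x) (by omega) (by omega),
            ht (2 * x + 1) (by omega) (by omega), heapExtend_node _ hx1 hx2]
        · rw [ht x (hd.trans hx.1) hx.2, heapExtend_leaf _ hx.1, hval x hx]
    · have : s₃.rarr 1 p = s'.rarr 1 p :=
        (h₃.other p fun y _ hy => by omega).trans (by rw [hs₀])
      rw [this, h.rest p (by omega)]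
  · simp [rowAddr]
    omega

/-- The memory `s` holds the matrix `A` as an adjacency array that fits with the layout `Y`. -/
structure Holds (Y : Layout) (A : ℕ → ℕ → ℝ) (s : State) : Prop where
  n : s.wreg 0 = Y.n
  m : s.wreg 1 = Y.m
  two : s.wreg 4 = 2
  zero : s.wreg 5 = 0
  st : update (s.warr 0) (Y.n + 1) (Y.m + Y.n) = Y.st
  cl : ∀ e, Y.cl e = if Y.m ≤ e ∧ e < Y.m + Y.n then e - Y.m else s.warr 1 e
  value : ∀ i < Y.n, ∀ x, Y.IsLeaf i x →
    s.rarr 0 (Y.st i + (x - Y.deg i)) = A i (Y.col i x)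
  support : ∀ i < Y.n, ∀ j < Y.n, (∀ x, Y.IsLeaf i x → Y.col i x ≠ j) → A i j = 0
  nonneg : ∀ i < Y.n, ∀ j < Y.n, 0 ≤ A i j
  tree : s.rarr 1 = 0

/-- The cost of a row is linear in its number of entries, and these numbers add up to `m`. -/
theorem setup_spec {Y : Layout} {W : ℕ} (hW : Layout.Fits Y W) {A : ℕ → ℕ → ℝ} {s : State}
    (hs : Holds Y A s) :
    Spec W setup s (46 * Y.m + 34 * Y.n + 19 : ℕ) (fun s' => Ready Y A s' ∧
      s'.wreg 2 = s.wreg 2 ∧ s'.wreg 6 = s.wreg 6 ∧ s'.wout = s.wout ∧ s'.rout = s.rout) := by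
  have hW' := hW
  unfold Layout.Fits at hW'
  have hn := Y.n_pos
  set Fill : ℕ → State → Prop := fun i s' => s'.wreg 7 = i ∧ s'.wreg 0 = Y.n ∧ s'.wreg 1 = Y.m ∧
    s'.wreg 2 = s.wreg 2 ∧ s'.wreg 3 = 1 ∧ s'.wreg 4 = 2 ∧ s'.wreg 5 = 0 ∧
    s'.wreg 6 = s.wreg 6 ∧ s'.warr 0 = Y.st ∧
    (∀ e, s'.warr 1 e = if Y.m ≤ e ∧ e < Y.m + i then e - Y.m else s.warr 1 e) ∧
    s'.rarr = s.rarr ∧ s'.wout = s.wout ∧ s'.rout = s.rout with hFill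
  have hb : wpBlock W [.wconst 3 1, .wop .add 40 0 3, .wop .add 41 1 0, .wstore 0 40 41,
      .wconst 7 0] (Fill 0) s := by
    apply wpBlock_of_mk
    simp only [wpBlock, Instr.wp, WordOp.eval, update_apply, reduceIte, Nat.reduceEqDiff, hs.n,
      hs.m, OfNat.zero_ne_ofNat, OfNat.one_ne_ofNat]
    refine ⟨by omega, by omega, by omega, by omega, ?_⟩
    refine ⟨by simp, by simp [hs.n], by simp [hs.m], by simp, by simp, by simp [hs.two],
      by simp [hs.zero], by simp, by simp [hs.st], fun e => ?_, rfl, rfl, rfl⟩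
    rw [if_neg (by omega)]
    simp
  have hfill : ∀ i < Y.n, ∀ s', Fill i s' → Spec W (block [.wop .add 40 1 7, .wstore 1 40 7,
      .wop .add 7 7 3]) s' (7 : ℕ) (Fill (i + 1)) := by
    rintro i hi s' ⟨a7, a0, a1, a2, a3, a4, a5, a6, b0, b1, c, d, e⟩
    refine Spec.block (l := [.wop .add 40 1 7, .wstore 1 40 7, .wop .add 7 7 3]) ?_
    apply wpBlock_of_mk
    simp only [wpBlock, Instr.wp, WordOp.eval, update_apply, reduceIte, Nat.reduceEqDiff, a1, a7,
      a3]
    refine ⟨by omega, by omega, ?_⟩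
    refine ⟨by simp, by simp [a0], by simp [a1], by simp [a2], by simp [a3], by simp [a4],
      by simp [a5], by simp [a6], by simp [b0], fun x => ?_, c, d, e⟩
    simp only [update_self, update_apply, b1]
    grind
  have hstat : ∀ s₂, Fill Y.n s₂ → Stat Y s₂ := by
    rintro s₂ ⟨a7, a0, a1, a2, a3, a4, a5, a6, b0, b1, c, d, e⟩
    exact ⟨a0, a3, a4, a5, b0, funext fun x => (b1 x).trans (hs.cl x).symm⟩
  have hbuild : ∀ s₂, Fill Y.n s₂ → Spec W (.seq (block [.wconst 7 0]) (.loop (.wlt 7 0) buildRow))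
      s₂ (46 * Y.m + 26 * Y.n + 5 : ℕ) (Built Y A s₂ Y.n) := by
    intro s₂ h₂
    have hra : s₂.rarr = s.rarr := h₂.2.2.2.2.2.2.2.2.2.2.1
    have hb2 : wpBlock W [.wconst 7 0] (Built Y A s₂ 0) s₂ := by
      have hst := hstat s₂ h₂
      apply wpBlock_of_mk
      simp only [wpBlock, Instr.wp]
      refine ⟨by omega, ?_, ⟨fun r hr => ?_, fun _ _ => rfl, rfl, rfl⟩, by simp, rfl,
        fun r hr => by omega, fun p _ => ?_⟩
      · refine ⟨?_, ?_, ?_, ?_, ?_, ?_⟩ <;> simp [hst.n, hst.one, hst.two, hst.zero, hst.st, hst.cl]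
      · simp only
        rw [update_of_ne (by omega)]
      · simp only [hra, hs.tree, Pi.zero_apply]
    have hsum : ∀ i ≤ Y.n, ∑ r ∈ Finset.range i, Y.deg r = Y.st i := by
      intro i hi
      induction i with
      | zero => simp [Y.st_zero]
      | succ i ih => rw [Finset.sum_range_succ, ih (by omega), Y.st_add_deg (by omega)]
    refine (Spec.seq (Spec.block hb2) fun s₃ h₃ => Spec.for (n := Y.n) (Built Y A s₂)
      (fun i => ((46 * Y.deg i + 25 : ℕ) : ℝ≥0∞)) (fun i s h => ⟨h.reg, h.stat.n⟩)
      (fun i hi s' h => buildRow_spec hW hi (by rw [hra]; exact hs.value i hi) (hs.support i hi)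
        (hs.nonneg i hi) h) h₃).mono ?_ fun s₄ h₄ => h₄
    have h1 : ∑ i ∈ Finset.range Y.n, (1 + (46 * Y.deg i + 25)) = 46 * Y.m + 26 * Y.n := by
      rw [← Y.st_n, ← hsum Y.n le_rfl, Finset.mul_sum, Finset.sum_add_distrib,
        Finset.sum_add_distrib]
      simp
      ring
    have h2 : ∑ i ∈ Finset.range Y.n, (1 + ((46 * Y.deg i + 25 : ℕ) : ℝ≥0∞)) =
        ((46 * Y.m + 26 * Y.n : ℕ) : ℝ≥0∞) := by
      rw [← h1]
      push_cast
      rfl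
    rw [h2]
    exact_mod_cast (by simp; omega : 1 + (2 * [Instr.wconst 7 0].length + 1) +
      (46 * Y.m + 26 * Y.n + 1) ≤ 46 * Y.m + 26 * Y.n + 5)
  refine (Spec.seq_nat (Spec.block hb) fun s₁ h₁ => Spec.seq_nat
    (Spec.for_nat (n := Y.n) Fill 7 (fun i s h => ⟨h.1, h.2.1⟩) hfill h₁) fun s₂ h₂ =>
    (hbuild s₂ h₂).mono_nat le_rfl fun s₄ h₄ => ?_).mono_nat ?_ fun _ h => h
  · obtain ⟨a7, a0, a1, a2, a3, a4, a5, a6, b0, b1, c, d, e⟩ := h₂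
    refine ⟨⟨h₄.stat, fun i hi => ?_⟩, (h₄.keep.wreg 2 (by norm_num)).trans a2,
      (h₄.keep.wreg 6 (by norm_num)).trans a6, h₄.keep.wout.trans d, h₄.keep.rout.trans e⟩
    rcases lt_or_eq_of_le hi with hi | rfl
    · rw [update_of_ne hi.ne]
      exact h₄.rows i hi
    · rw [update_self]
      -- The tree of the additional row need not be built: its memory is still 0, which is the tree
      -- for free weights that all vanish.
      have h0 : ∀ y, s₄.rarr 1 (2 * Y.st Y.n + y) = 0 := fun y => h₄.rest _ (by omega)
      have hw : ∀ j < Y.n, freeWeight (Finset.range Y.n) j = 0 := fun j hj => by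
        simp [freeWeight, hj]
      exact ⟨fun x _ _ => by rw [h0, h0, h0, add_zero],
        fun x hx => by rw [h0, hw _ (Y.col_lt le_rfl hx)], fun j hj _ => hw j hj,
        fun j hj => (hw j hj).ge⟩
  · simp
    omega

end RandomRAM

/-! ### The adjacency array as a layout -/

namespace List

theorem length_flatten_take_succ {α : Type*} {l : List (List α)} {i : ℕ} (hi : i < l.length) :
    (l.take (i + 1)).flatten.length = (l.take i).flatten.length + l[i].length := by
  rw [take_succ_eq_append_getElem hi, flatten_append, length_append]
  simp

theorem getD_flatten_add {α : Type*} {l : List (List α)} {i e : ℕ} (hi : i < l.length)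
    (he : e < l[i].length) (d : α) :
    l.flatten.getD ((l.take i).flatten.length + e) d = l[i][e] := by
  have h : l.flatten = (l.take i).flatten ++ (l[i] ++ (l.drop (i + 1)).flatten) := by
    conv_lhs => rw [← take_append_drop i l, drop_eq_getElem_cons hi]
    rw [flatten_append, flatten_cons]
  rw [h, getD_append_right _ _ _ _ (Nat.le_add_right _ _), Nat.add_sub_cancel_left,
    getD_append _ _ _ _ he, getD_eq_getElem _ _ he]

end List

namespace BirkhoffVonNeumann

variable {n : ℕ} {M : Matrix (Fin n) (Fin n) ℝ} {adj : Fin n → List (Fin n)} {k : ℕ}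

/-- The number of entries stored before row `i`. -/
def rowStart (adj : Fin n → List (Fin n)) (i : ℕ) : ℕ := ((List.ofFn adj).take i).flatten.length

theorem rowStart_succ (adj : Fin n → List (Fin n)) (i : Fin n) :
    rowStart adj (i + 1) = rowStart adj i + (adj i).length := by
  rw [rowStart, List.length_flatten_take_succ (by simp)]
  simp [rowStart]

/-- Columns and values are stored by flattening different lists; as the rows have the same lengths,
the offsets agree. -/
theorem rowStart_eq_map (adj : Fin n → List (Fin n)) {β : Type*} (f : Fin n → Fin n → β)
    {i : ℕ} (hi : i ≤ n) : rowStart adj i =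
      ((List.ofFn fun i => (adj i).map (f i)).take i).flatten.length := by
  induction i with
  | zero => simp [rowStart]
  | succ i ih =>
    rw [rowStart_succ adj ⟨i, hi⟩, List.length_flatten_take_succ (by simpa using hi),
      ← ih (Nat.le_of_succ_le hi)]
    simp

theorem exists_row_of_lt_rowStart {e : ℕ} {i : ℕ} (hi : i ≤ n) (he : e < rowStart adj i) :
    ∃ r : Fin n, rowStart adj r ≤ e ∧ e < rowStart adj (r + 1) := by
  induction i with
  | zero => simp [rowStart] at he
  | succ i ih =>
    rcases lt_or_ge e (rowStart adj i) with h | h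
    · exact ih (by omega) h
    · exact ⟨⟨i, hi⟩, h, he⟩

theorem nnz_eq_rowStart (hadj : IsAdjacencyArray M adj) : nnz M = rowStart adj n := by
  classical
  have h1 : rowStart adj n = ∑ i, (adj i).length := by
    have : ∀ i ≤ n, rowStart adj i = ∑ r ∈ Finset.range i,
        if h : r < n then (adj ⟨r, h⟩).length else 0 := by
      intro i hi
      induction i with
      | zero => simp [rowStart]
      | succ i ih =>
        rw [rowStart_succ adj ⟨i, hi⟩, Finset.sum_range_succ, ← ih (by omega), dif_pos]
    rw [this n le_rfl, Finset.sum_range]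
    simp
  have h2 : {p : Fin n × Fin n | M p.1 p.2 ≠ 0} =
      ((Finset.univ.sigma fun i => (adj i).toFinset).map
        (Equiv.sigmaEquivProd (Fin n) (Fin n)).toEmbedding : Finset (Fin n × Fin n)) := by
    ext ⟨i, j⟩
    simp [(hadj i).2 j]
  rw [nnz, h2, Set.ncard_coe_finset, Finset.card_map, Finset.card_sigma, h1]
  exact Finset.sum_congr rfl fun i _ => List.toFinset_card_of_nodup (hadj i).1

/-- A row with sum 1 is not empty. So every row has a tree with a root. -/
theorem length_pos_of_isAdjacencyArray (hM : M ∈ doublyStochastic ℝ (Fin n))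
    (hadj : IsAdjacencyArray M adj) (i : Fin n) : 1 ≤ (adj i).length := by
  rw [Nat.one_le_iff_ne_zero]
  intro h0
  have hnil := List.eq_nil_of_length_eq_zero h0
  have h := sum_row_of_mem_doublyStochastic hM i
  rw [Finset.sum_eq_zero fun j _ => ?_] at h
  · exact zero_ne_one h
  · by_contra hj
    simpa [hnil] using ((hadj i).2 j).2 hj

theorem length_le_of_isAdjacencyArray (hadj : IsAdjacencyArray M adj) (i : Fin n) :
    (adj i).length ≤ n := by
  simpa using (hadj i).1.length_le_card

theorem inputState_warr_zero (M : Matrix (Fin n) (Fin n) ℝ) (adj : Fin n → List (Fin n)) (k : ℕ)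
    {i : ℕ} (hi : i ≤ n) : (inputState M adj k).warr 0 i = rowStart adj i := by
  simp only [inputState, if_true]
  rw [List.getD_eq_getElem _ _ (by simpa using Nat.lt_succ_of_le hi)]
  simp [rowStart]

theorem inputState_warr_one (M : Matrix (Fin n) (Fin n) ℝ) (adj : Fin n → List (Fin n)) (k : ℕ)
    (i : Fin n) {e : ℕ} (he : e < (adj i).length) :
    (inputState M adj k).warr 1 (rowStart adj i + e) = (adj i)[e] := by
  simp only [inputState, one_ne_zero, if_false, if_true]
  rw [List.map_flatten, List.map_ofFn, rowStart_eq_map adj (fun _ => Fin.val) i.2.le]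
  exact (List.getD_flatten_add (by simp) (by simpa) _).trans (by simp)

theorem inputState_rarr_zero (M : Matrix (Fin n) (Fin n) ℝ) (adj : Fin n → List (Fin n)) (k : ℕ)
    (i : Fin n) {e : ℕ} (he : e < (adj i).length) :
    (inputState M adj k).rarr 0 (rowStart adj i + e) = M i (adj i)[e] := by
  simp only [inputState, if_true]
  rw [rowStart_eq_map adj M i.2.le, List.getD_flatten_add (by simp) (by simpa)]
  simp

end BirkhoffVonNeumann

namespace BirkhoffVonNeumann

open Function RandomRAM

variable {n : ℕ} {M : Matrix (Fin n) (Fin n) ℝ} {adj : Fin n → List (Fin n)} {k : ℕ}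

/-- The starts of the rows, with a row of `n` entries after the rows of the matrix. -/
noncomputable def layoutStart (M : Matrix (Fin n) (Fin n) ℝ) (adj : Fin n → List (Fin n)) (k : ℕ) :
    ℕ → ℕ := update ((inputState M adj k).warr 0) (n + 1) (nnz M + n)

/-- The columns of the entries, with a row that contains all columns after the rows of the
matrix. -/
noncomputable def layoutCol (M : Matrix (Fin n) (Fin n) ℝ) (adj : Fin n → List (Fin n)) (k : ℕ)
    (e : ℕ) : ℕ :=
  if nnz M ≤ e ∧ e < nnz M + n then e - nnz M else (inputState M adj k).warr 1 e

theorem layoutStart_of_le {i : ℕ} (hi : i ≤ n) : layoutStart M adj k i = rowStart adj i := by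
  rw [layoutStart, update_of_ne (by omega), inputState_warr_zero M adj k hi]

theorem layoutStart_last : layoutStart M adj k (n + 1) = nnz M + n := update_self ..

theorem rowStart_succ_of_lt {i : ℕ} (hi : i < n) :
    rowStart adj (i + 1) = rowStart adj i + (adj ⟨i, hi⟩).length := rowStart_succ adj ⟨i, hi⟩

theorem rowStart_le (hadj : IsAdjacencyArray M adj) {i : ℕ} (hi : i ≤ n) :
    rowStart adj i ≤ nnz M := by
  rw [nnz_eq_rowStart hadj]
  induction hi using Nat.decreasingInduction with
  | self => exact le_rfl
  | of_succ i hi ih => exact (rowStart_succ_of_lt hi ▸ Nat.le_add_right _ _).trans ih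

theorem layoutCol_row (hadj : IsAdjacencyArray M adj) (i : Fin n) {e : ℕ}
    (he : e < (adj i).length) : layoutCol M adj k (rowStart adj i + e) = (adj i)[e] := by
  have := rowStart_le hadj (i := i + 1) i.2
  rw [rowStart_succ] at this
  rw [layoutCol, if_neg (by omega), inputState_warr_one M adj k i he]

theorem layoutCol_last {u : ℕ} (hu : u < n) : layoutCol M adj k (nnz M + u) = u := by
  rw [layoutCol, if_pos (by omega), Nat.add_sub_cancel_left]

/-- The layout of the memory for an adjacency array. -/
noncomputable def layout (hn : 1 ≤ n) (hM : M ∈ doublyStochastic ℝ (Fin n))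
    (hadj : IsAdjacencyArray M adj) (k : ℕ) : Layout where
  n := n
  m := nnz M
  L := Nat.clog 2 n
  st := layoutStart M adj k
  cl := layoutCol M adj k
  n_pos := hn
  n_le := Nat.le_pow_clog one_lt_two n
  st_zero := by rw [layoutStart_of_le (Nat.zero_le n)]; simp [rowStart]
  st_n := by rw [layoutStart_of_le le_rfl, nnz_eq_rowStart hadj]
  st_succ := layoutStart_last
  st_lt i hi := by
    rcases hi.lt_or_eq with hi | rfl
    · have := length_pos_of_isAdjacencyArray hM hadj ⟨i, hi⟩
      rw [layoutStart_of_le hi.le, layoutStart_of_le hi, rowStart_succ_of_lt hi]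
      omega
    · rw [layoutStart_of_le le_rfl, layoutStart_last, nnz_eq_rowStart hadj]
      omega
  deg_le' i hi := by
    rcases hi.lt_or_eq with hi | rfl
    · have := length_le_of_isAdjacencyArray hadj ⟨i, hi⟩
      rw [layoutStart_of_le hi.le, layoutStart_of_le hi, rowStart_succ_of_lt hi]
      omega
    · rw [layoutStart_of_le le_rfl, layoutStart_last, nnz_eq_rowStart hadj]
  cl_lt e he := by
    rcases lt_or_ge e (nnz M) with h | h
    · obtain ⟨r, h1, h2⟩ := exists_row_of_lt_rowStart le_rfl (nnz_eq_rowStart hadj ▸ h)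
      rw [rowStart_succ] at h2
      obtain ⟨x, rfl⟩ := Nat.exists_eq_add_of_le h1
      rw [layoutCol_row hadj r (by omega)]
      exact Fin.is_lt _
    · obtain ⟨u, rfl⟩ := Nat.exists_eq_add_of_le h
      rw [layoutCol_last (by omega)]
      omega
  cl_inj i hi e e' h1 h2 h3 h4 heq := by
    rcases hi.lt_or_eq with hi | rfl
    · rw [layoutStart_of_le hi.le] at h1 h3
      rw [layoutStart_of_le hi, rowStart_succ_of_lt hi] at h2 h4
      obtain ⟨x, rfl⟩ := Nat.exists_eq_add_of_le h1
      obtain ⟨y, rfl⟩ := Nat.exists_eq_add_of_le h3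
      rw [layoutCol_row hadj ⟨i, hi⟩ (by omega), layoutCol_row hadj ⟨i, hi⟩ (by omega)] at heq
      rw [(hadj ⟨i, hi⟩).1.getElem_inj_iff.1 (Fin.ext heq)]
    · rw [layoutStart_of_le le_rfl, ← nnz_eq_rowStart hadj] at h1 h3
      rw [layoutStart_last] at h2 h4
      obtain ⟨x, rfl⟩ := Nat.exists_eq_add_of_le h1
      obtain ⟨y, rfl⟩ := Nat.exists_eq_add_of_le h3
      rw [layoutCol_last (by omega), layoutCol_last (by omega)] at heq
      rw [heq]
  cl_source u hu := layoutCol_last hu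

/-- Register 4 is changed because the constant 2 is written for the test on `n`, before the setup.
-/
theorem holds_layout (hn : 1 ≤ n) (hM : M ∈ doublyStochastic ℝ (Fin n))
    (hadj : IsAdjacencyArray M adj) (k : ℕ) {s : State}
    (hreg : s.wreg = update (inputState M adj k).wreg 4 2)
    (hw : s.warr = (inputState M adj k).warr) (hr : s.rarr = (inputState M adj k).rarr) :
    Holds (layout hn hM hadj k) (entry M) s := by
  have hdeg : ∀ i : Fin n, (layout hn hM hadj k).deg i = (adj i).length := by
    intro i
    simp only [Layout.deg, layout]
    rw [layoutStart_of_le i.2, layoutStart_of_le i.2.le, rowStart_succ, Nat.add_sub_cancel_left]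
  have hcol : ∀ (i : Fin n) (e : ℕ) (he : e < (adj i).length),
      (layout hn hM hadj k).col i ((adj i).length + e) = (adj i)[e] := by
    intro i e he
    simp only [Layout.col, hdeg, Nat.add_sub_cancel_left]
    simp only [layout]
    rw [layoutStart_of_le i.2.le, layoutCol_row hadj i he]
  refine ⟨by simp [hreg, layout, inputState], by simp [hreg, layout, inputState],
    by simp [hreg], by simp [hreg, inputState], by rw [hw]; rfl, fun e => by rw [hw]; rfl,
    fun i hi x hx => ?_, fun i hi j hj h => ?_, fun i hi j hj => ?_, ?_⟩
  · obtain ⟨h1, h2⟩ := hx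
    have hd := hdeg ⟨i, hi⟩
    simp only at hd
    rw [hd] at h1 h2 ⊢
    obtain ⟨e, rfl⟩ := Nat.exists_eq_add_of_le h1
    have he : e < (adj ⟨i, hi⟩).length := by omega
    have hc := hcol ⟨i, hi⟩ e he
    simp only at hc
    rw [hc, Nat.add_sub_cancel_left, hr]
    simp only [layout]
    have hst : layoutStart M adj k i = rowStart adj i := layoutStart_of_le (le_of_lt hi)
    rw [hst]
    exact (inputState_rarr_zero M adj k ⟨i, hi⟩ he).trans (entry_val M ⟨i, hi⟩ _).symm
  · by_contra hne
    have hne' : M ⟨i, hi⟩ ⟨j, hj⟩ ≠ 0 := by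
      rwa [← entry_val M ⟨i, hi⟩ ⟨j, hj⟩]
    obtain ⟨e, he, hej⟩ := List.getElem_of_mem (((hadj ⟨i, hi⟩).2 ⟨j, hj⟩).2 hne')
    refine h ((adj ⟨i, hi⟩).length + e) ?_ ?_
    · have hd := hdeg ⟨i, hi⟩
      simp only at hd
      rw [Layout.IsLeaf, hd]
      omega
    · rw [hcol ⟨i, hi⟩ e he, hej]
  · rw [entry, dif_pos ⟨hi, hj⟩]
    exact nonneg_of_mem_doublyStochastic hM
  · rw [hr]
    funext e
    simp [inputState]

end BirkhoffVonNeumann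

/-! ### The running time and the final program -/

namespace RandomRAM

open BirkhoffVonNeumann Function

/-- Every row has an entry. Hence terms linear in `n` are absorbed by `m`. -/
theorem _root_.Layout.n_le_m (Y : Layout) : Y.n ≤ Y.m := by
  have : ∀ i ≤ Y.n, i ≤ Y.st i := by
    intro i hi
    induction i with
    | zero => exact Nat.zero_le _
    | succ i ih => exact (ih (by omega)).trans_lt (Y.st_lt i (by omega))
  exact Y.st_n ▸ this Y.n le_rfl

/-- Read backwards, the sum is `n` times the harmonic number of `n`, as for the coupon collector. -/
theorem sum_div_sub_le (n : ℕ) :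
    ∑ i ∈ Finset.range n, (n : ℝ≥0∞) / (n - i : ℕ) ≤ ENNReal.ofReal (n * (1 + Real.log n)) := by
  have h : ∀ i ∈ Finset.range n, (n : ℝ≥0∞) / (n - i : ℕ) =
      ENNReal.ofReal ((n : ℝ) / (n - i : ℕ)) := by
    intro i hi
    have hi := Finset.mem_range.1 hi
    rw [ENNReal.ofReal_div_of_pos (by exact_mod_cast Nat.sub_pos_of_lt hi), ENNReal.ofReal_natCast,
      ENNReal.ofReal_natCast]
  rw [Finset.sum_congr rfl h, ← ENNReal.ofReal_sum_of_nonneg fun _ _ => by positivity]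
  refine ENNReal.ofReal_le_ofReal ?_
  have h2 : ∑ i ∈ Finset.range n, (n : ℝ) / (n - i : ℕ) = n * (harmonic n : ℝ) := by
    rw [harmonic, Rat.cast_sum, Finset.mul_sum, ← Finset.sum_range_reflect]
    refine Finset.sum_congr rfl fun i hi => ?_
    have hi := Finset.mem_range.1 hi
    rw [show n - (n - 1 - i) = i + 1 by omega]
    push_cast
    rw [div_eq_mul_inv]
  rw [h2]
  gcongr
  exact harmonic_le_one_add_log n

/-- Since `clog 2 n - 1` and 1 are both at most `log n / log 2`, the left side is at most `2 / log 2
< 3` times `log n`. -/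
theorem clog_two_le {n : ℕ} (hn : 2 ≤ n) : (Nat.clog 2 n : ℝ) ≤ 3 * Real.log n := by
  have h1 := Real.log_two_gt_d9
  have h2 : Real.log 2 ≤ Real.log n := Real.log_le_log two_pos (by exact_mod_cast hn)
  have h3 : 2 ^ (Nat.clog 2 n - 1) < n := by
    have := Nat.pow_pred_clog_lt_self one_lt_two (x := n) (by omega)
    simpa using this
  have h4 : ((Nat.clog 2 n - 1 : ℕ) : ℝ) * Real.log 2 ≤ Real.log n := by
    rw [← Real.log_pow]
    exact Real.log_le_log (by positivity) (by exact_mod_cast h3.le)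
  have h5 : 1 ≤ Nat.clog 2 n := Nat.clog_pos one_lt_two hn
  rw [Nat.cast_sub h5] at h4
  push_cast at h4
  nlinarith

theorem matchingTime_le (Y : Layout) : matchingTime Y ≤ ENNReal.ofReal
    ((57 * Y.L + 102) * Y.n + 11 + (17 * Y.L + 64) * (Y.n * (1 + Real.log Y.n))) := by
  have hlog := Real.log_natCast_nonneg Y.n
  calc matchingTime Y = (((57 * Y.L + 102) * Y.n + 11 : ℕ) : ℝ≥0∞) + (17 * Y.L + 64 : ℕ) *
        ∑ i ∈ Finset.range Y.n, (Y.n : ℝ≥0∞) / (Y.n - i : ℕ) := by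
        rw [matchingTime, Finset.sum_add_distrib, Finset.sum_add_distrib, ← Finset.mul_sum]
        simp only [Finset.sum_const, Finset.card_range, nsmul_eq_mul]
        push_cast
        ring
    _ ≤ (((57 * Y.L + 102) * Y.n + 11 : ℕ) : ℝ≥0∞) + (17 * Y.L + 64 : ℕ) *
        ENNReal.ofReal (Y.n * (1 + Real.log Y.n)) := by
        gcongr
        exact sum_div_sub_le Y.n
    _ = _ := by
        rw [← ENNReal.ofReal_natCast, ← ENNReal.ofReal_natCast,
            ← ENNReal.ofReal_mul (by positivity),
          ← ENNReal.ofReal_add (by positivity) (by positivity)]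
        push_cast
        rfl

/-- For `n ≥ 2`, both 1 and the depth `L` are at most constant multiples of `log n`, so every term
is at most a multiple of `n log² n`. -/
theorem one_add_extractTime_le {Y : Layout} (hL : Y.L = Nat.clog 2 Y.n) (hn : 2 ≤ Y.n) :
    1 + extractTime Y ≤ ENNReal.ofReal (1300 * (Y.n * Real.log Y.n ^ 2)) := by
  have hlog := Real.log_natCast_nonneg Y.n
  calc 1 + extractTime Y ≤ 1 + (ENNReal.ofReal ((57 * Y.L + 102) * Y.n + 11 +
        (17 * Y.L + 64) * (Y.n * (1 + Real.log Y.n))) + ((20 * Y.L + 86) * Y.n + 31 : ℕ)) := by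
        rw [extractTime]
        gcongr
        exact matchingTime_le Y
    _ = ENNReal.ofReal (1 + (((57 * Y.L + 102) * Y.n + 11 +
        (17 * Y.L + 64) * (Y.n * (1 + Real.log Y.n))) + ((20 * Y.L + 86) * Y.n + 31))) := by
        rw [← ENNReal.ofReal_natCast, ← ENNReal.ofReal_one,
          ← ENNReal.ofReal_add (by positivity) (by positivity),
          ← ENNReal.ofReal_add (by positivity) (by positivity)]
        push_cast
        rfl
    _ ≤ _ := by
        refine ENNReal.ofReal_le_ofReal ?_
        have h1 := clog_two_le hn
        rw [← hL] at h1
        have h2 : Real.log 2 ≤ Real.log Y.n := Real.log_le_log two_pos (by exact_mod_cast hn)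
        have h3 := Real.log_two_gt_d9
        have h4 : (1 : ℝ) ≤ Y.n := by exact_mod_cast Y.n_pos
        generalize Real.log Y.n = x at *
        generalize (Y.n : ℝ) = y at *
        generalize (Y.L : ℝ) = z at *
        -- From `log 2 > 2 / 3`; this raises the terms of lower order to multiples of `x ^ 2`.
        have h5 : 1 ≤ 3 / 2 * x := by linarith
        have h6 : 77 * z + 231 + (17 * z + 64) * (1 + x) ≤ 1300 * x ^ 2 := by nlinarith
        nlinarith [mul_le_mul_of_nonneg_left h6 (by linarith : 0 ≤ y)]

/-- Write the only matching of a matrix with one row, or else set up the memory and extract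
matchings. -/
def decompose : Prog :=
  .seq (block [.wconst 4 2]) <|
  .ite (.wlt 0 4) (block [.rone 0, .remit 0, .wemit 5]) (.seq setup extractAll)

theorem isDecomposition_one {M : Matrix (Fin 1) (Fin 1) ℝ} (hM : M ∈ doublyStochastic ℝ (Fin 1)) :
    IsDecomposition M [(1, Equiv.refl _)] where
  sum_eq := by
    have h := sum_row_of_mem_doublyStochastic hM 0
    ext i j
    rw [weightedSum_singleton, Subsingleton.elim i 0, Subsingleton.elim j 0]
    simpa [permMatrix_apply] using h.symm
  nodup := by simp
  pos := by simp
  least t ht := by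
    have h := sum_row_of_mem_doublyStochastic hM 0
    obtain rfl : t = 0 := by simpa using ht
    simp at h
    simp [weightedSum, Subsingleton.elim _ (0 : Fin 1), h]

/-- The case `n = 1` is separate because `log 1 = 0`: the claimed time then does not grow with `k`,
while the bound from `extractAll_spec` does. -/
theorem decompose_spec {n k W : ℕ} (hn : 1 ≤ n) (hk : 1 ≤ k) {M : Matrix (Fin n) (Fin n) ℝ}
    (hM : M ∈ doublyStochastic ℝ (Fin n)) {adj : Fin n → List (Fin n)}
    (hadj : IsAdjacencyArray M adj) (hW : 4 * (nnz M + n) + 10 ≤ W) (hkW : k ≤ W) :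
    Spec W decompose (inputState M adj k)
      (ENNReal.ofReal (1300 * ((nnz M : ℝ) + k * n * Real.log n ^ 2)))
      (fun s => ∃ l : List (ℝ × Equiv.Perm (Fin n)),
          IsDecomposition M l ∧ Outputs s (l.take k)) := by
  obtain ⟨s₀, hs₀⟩ : ∃ s₀ : State, s₀ = ⟨update (inputState M adj k).wreg 4 2,
    (inputState M adj k).rreg, (inputState M adj k).warr, (inputState M adj k).rarr,
    (inputState M adj k).wout, (inputState M adj k).rout⟩ := ⟨_, rfl⟩
  have hb : wpBlock W [.wconst 4 2] (fun s => s = s₀) (inputState M adj k) := by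
    apply wpBlock_of_mk
    simp only [wpBlock, Instr.wp]
    exact ⟨by omega, hs₀.symm⟩
  have hnm : n ≤ nnz M := (layout hn hM hadj k).n_le_m
  have h0 : s₀.wreg 0 = n := by simp [hs₀, inputState]
  have h4 : s₀.wreg 4 = 2 := by simp [hs₀]
  have hnm' : (n : ℝ) ≤ nnz M := by exact_mod_cast hnm
  have hn' : (1 : ℝ) ≤ n := by exact_mod_cast hn
  rcases hn.eq_or_lt with rfl | hn2
  · refine (Spec.seq_nat (Spec.block hb) fun s hs => Spec.ite_nat (Or.inl ⟨?_, Spec.block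
      (l := [.rone 0, .remit 0, .wemit 5]) ?_⟩)).mono ?_ fun _ h => h
    · simp [hs, Test.holds, h0, h4]
    · apply wpBlock_of_mk
      simp only [wpBlock, Instr.wp, hs]
      refine ⟨_, isDecomposition_one hM, ?_⟩
      rw [List.take_of_length_le (by simpa using hk)]
      constructor <;> simp [hs₀, inputState]
    · rw [← ENNReal.ofReal_natCast]
      refine ENNReal.ofReal_le_ofReal ?_
      simp
      linarith
  · have hfit : Layout.Fits (layout hn hM hadj k) W := hW
    have hhold := holds_layout hn hM hadj k (s := s₀) (by rw [hs₀]) (by rw [hs₀]) (by rw [hs₀])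
    refine (Spec.seq (Spec.block hb) fun s hs => Spec.ite (Or.inr ⟨?_, Spec.seq
      (setup_spec hfit (hs ▸ hhold)) fun s' ⟨hr, e2, e6, ew, er⟩ => extractAll_spec hfit hM hkW hr
        ?_ ?_ ?_ ?_⟩)).mono ?_ fun _ h => h
    · simp [hs, Test.holds, h0, h4]
      omega
    · rw [e6, hs, hs₀]; simp [inputState]
    · rw [e2, hs, hs₀]; simp [inputState]
    · rw [ew, hs, hs₀]; simp [inputState]
    · rw [er, hs, hs₀]; simp [inputState]
    · have h1 : 1 + extractTime (layout hn hM hadj k) ≤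
          ENNReal.ofReal (1300 * (n * Real.log n ^ 2)) :=
        one_add_extractTime_le rfl hn2
      calc _ = ((46 * nnz M + 34 * n + 26 : ℕ) : ℝ≥0∞) +
            k * (1 + extractTime (layout hn hM hadj k)) := by
            simp only [layout, List.length_singleton]
            push_cast
            ring
        _ ≤ ((46 * nnz M + 34 * n + 26 : ℕ) : ℝ≥0∞) +
            k * ENNReal.ofReal (1300 * (n * Real.log n ^ 2)) := by gcongr
        _ = ENNReal.ofReal (46 * nnz M + 34 * n + 26 + k * (1300 * (n * Real.log n ^ 2))) := by
            rw [← ENNReal.ofReal_natCast, ← ENNReal.ofReal_natCast,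
              ← ENNReal.ofReal_mul (by positivity),
              ← ENNReal.ofReal_add (by positivity) (by positivity)]
            push_cast
            rfl
        _ ≤ _ := ENNReal.ofReal_le_ofReal (by nlinarith)

end RandomRAM

/-- One program finds, for every `n × n` doubly stochastic matrix `M` with `m` nonzero entries and
every `k ≥ 1`, the first `k` matchings of a Birkhoff-von Neumann decomposition of `M` (all of them
if there are fewer than `k`), in expected time `O(m + k n log² n)` on words of
`O(log (n + m + k))` bits. -/
theorem corollary1 :
    ∃ (P : RandomRAM.Prog) (C : ℕ) (c : ℝ),
      ∀ (n k : ℕ), 1 ≤ n → 1 ≤ k →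
      ∀ M ∈ doublyStochastic ℝ (Fin n),
      ∀ adj : Fin n → List (Fin n), BirkhoffVonNeumann.IsAdjacencyArray M adj →
        RandomRAM.AlwaysReturns ((n + BirkhoffVonNeumann.nnz M + k) ^ C) P
          (BirkhoffVonNeumann.inputState M adj k)
          (fun s => ∃ l : List (ℝ × Equiv.Perm (Fin n)),
            BirkhoffVonNeumann.IsDecomposition M l ∧
            BirkhoffVonNeumann.Outputs s (l.take k)) ∧
        RandomRAM.expectedTime ((n + BirkhoffVonNeumann.nnz M + k) ^ C) P
          (BirkhoffVonNeumann.inputState M adj k) ≤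
            ENNReal.ofReal
              (c * ((BirkhoffVonNeumann.nnz M : ℝ) + k * n * Real.log n ^ 2)) := by
  refine ⟨RandomRAM.decompose, 4, 1300, fun n k hn hk M hM adj hadj => ?_⟩
  have hnm : n ≤ BirkhoffVonNeumann.nnz M :=
    (BirkhoffVonNeumann.layout hn hM hadj k).n_le_m
  -- The base is at least 3, as `n`, `nnz M` and `k` are at least 1. So the fourth power leaves room
  -- for all addresses and for `k`.
  have hN : 27 * (n + BirkhoffVonNeumann.nnz M + k) ≤ (n + BirkhoffVonNeumann.nnz M + k) ^ 4 := by
    rw [pow_succ]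
    exact Nat.mul_le_mul_right _ (Nat.pow_le_pow_left (by omega : 3 ≤ _) 3)
  have h := RandomRAM.decompose_spec hn hk hM hadj (W := (n + BirkhoffVonNeumann.nnz M + k) ^ 4)
    (by omega) (by omega)
  exact ⟨h.alwaysReturns ENNReal.ofReal_ne_top, h.expectedTime_le⟩
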